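/- **Notation.** Let $k$ be a field. Let $\mathcal M=K_0(\mathrm{Var}_k)$ be the Grothendieck ring: generated by classes of finite type $k$-schemes up to isomorphism, with $[X]=[U]+[Y]$ for $Y\subset X$ closed with open complement $U$, product $[X][Y]=[X\times_k Y]$ and unit $[\operatorname{Spec}k]$. If $\operatorname{char}k>0$ (and only then), we also impose $[X]=[Y]$ whenever there is a surjective universally injective (radicial) $k$-morphism $X\to Y$. Let $X$ be a separated $k$-scheme of finite type (for instance a variety). A partition is a finite multiset $\nu$ of positive integers; $|\nu|$ is its number of parts, $\sum\nu$ their sum, $m(\nu)$ the multiset of the multiplicities of its distinct parts, and juxtaposition is multiset union. Write $\lambda\le\mu$ if $\mu$ is obtained from $\lambda$ by a sequence of merges, each replacing two parts $x,y$ by $x+y$. For a partition $\lambda$ let $w_\lambda=w_\lambda(X)\in\mathcal M$ be the class of the complement of the big diagonal in $\prod_{r\in m(\lambda)}\mathrm{Sym}^rX$ (configurations of $|\lambda|$ distinct points labelled by the parts of $\lambda$), and put $\overline w_\lambda=\sum_{\mu\ge\lambda}w_\mu$. (When a quotient of $X^n$ by a group of permutations is only an algebraic space, its class is the sum of the classes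 of the quotients of the members of a finite invariant decomposition into locally closed subschemes whose quotients are schemes.) Let $\mathbf Z_X(t)=\sum_{n\ge0}[\mathrm{Sym}^nX]t^n$ and $$K_{(<a)\nu}(t)=\sum_{j\ge0}\ \sum_{\substack{\mu\vdash j\\ \text{all parts of }\mu\,<\,a}}w_{\mu\nu}\,t^j,\qquad \overline K_{1^\bullet\nu}(t)=\sum_{j\ge0}\overline w_{1^j\nu}\,t^j .$$ **Theorem.** For each partition $\nu$ and each $a\ge2$ there are universal formulas $A_{\nu,a}(t),B_{\nu,a}(t)$ and $C_\nu(t),D_\nu(t)$ (the latter two independent of $a$), i.e. formulas whose coefficients do not depend on $k$ or $X$, such that * $A_{\nu,a}(t)$ is a $\mathbb Z[t]$-linear combination of finitely many classes $w_{\nu'}$, with $\nu'$ partitions satisfying $|\nu'|=|\nu|$ and $m(\nu')\le m(\nu)$; * $C_\nu(t)$ is a $\mathbb Z[t]$-linear combination of $1$ and of finitely many series $w_{\nu'}/\mathbf Z_X(t^i)$, with $\nu'$ partitions satisfying $|\nu'|\le|\nu|-1$ and $i$ a part of $\nu$ (so that $i\ge 2$ if all parts of $\nu$ are at least $2$); *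 $B_{\nu,a}(t),D_\nu(t)\in\mathbb Z[t]$ have constant coefficient $1$; and such that for all $k$ and $X$, with no stabilization hypothesis, the following hold in $\mathcal M[[t]]$: (a) if all parts of $\nu$ are at least $a$, then $$K_{(<a)\nu}(t)=\frac{\mathbf Z_X(t)}{\mathbf Z_X(t^a)}\cdot\frac{A_{\nu,a}(t)}{B_{\nu,a}(t)};$$ (b) $$t^{\sum\nu}\,\overline K_{1^\bullet\nu}(t)=\mathbf Z_X(t)\,\frac{C_\nu(t)}{D_\nu(t)} .$$ -/

import Mathlib

open CategoryTheory CategoryTheory.Limits AlgebraicGeometry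

universe u

noncomputable section

namespace MotivicConf

/-! ### The Grothendieck ring of varieties -/

/-- A finite type `k`-scheme. -/
structure FTScheme (k : Type u) [Field k] where
  /-- the underlying `k`-scheme -/
  obj : Over (Spec (CommRingCat.of k))
  locallyOfFiniteType : LocallyOfFiniteType obj.hom
  quasiCompact : QuasiCompact obj.hom

/-- The relations of the Grothendieck ring of varieties over `k`, imposed on the polynomial ring
with one generator for each finite type `k`-scheme: isomorphic schemes have the same class; the
class is additive for a closed subscheme and its open complement; the product of classes is the
class of the fibre product over `k`; the class of `Spec k` is `1`.

If `k` has positive characteristic, the source and the target of a surjective universally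
injective (radicial) `k`-morphism have the same class as well. In characteristic zero this last
relation is not imposed. -/
inductive K0Rel (k : Type u) [Field k] :
    MvPolynomial (FTScheme k) ℤ → MvPolynomial (FTScheme k) ℤ → Prop
  | iso (X Y : FTScheme k) (e : X.obj ≅ Y.obj) :
      K0Rel k (MvPolynomial.X X) (MvPolynomial.X Y)
  | scissor (X Y U : FTScheme k) (i : Y.obj ⟶ X.obj) (j : U.obj ⟶ X.obj)
      (hi : IsClosedImmersion i.left) (hj : IsOpenImmersion j.left)
      (hij : Set.range j.left = (Set.range i.left)ᶜ) :
      K0Rel k (MvPolynomial.X X) (MvPolynomial.X U + MvPolynomial.X Y)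
  | prod (X Y P : FTScheme k) (p : P.obj ⟶ X.obj) (q : P.obj ⟶ Y.obj)
      (h : IsPullback p.left q.left X.obj.hom Y.obj.hom) :
      K0Rel k (MvPolynomial.X P) (MvPolynomial.X X * MvPolynomial.X Y)
  | unit (X : FTScheme k) (h : IsIso X.obj.hom) :
      K0Rel k (MvPolynomial.X X) 1
  | radicial (hk : ringChar k ≠ 0) (X Y : FTScheme k) (f : X.obj ⟶ Y.obj)
      (hs : Surjective f.left) (hi : UniversallyInjective f.left) :
      K0Rel k (MvPolynomial.X X) (MvPolynomial.X Y)

/-- The Grothendieck ring of varieties over `k`, presented as a ring. (The product relations make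
every element a `ℤ`-linear combination of classes, so this is the abelian group generated by
classes with the scissor relations, with the product induced by the fibre product.) -/
abbrev K0 (k : Type u) [Field k] : Type (u + 1) :=
  MvPolynomial (FTScheme k) ℤ ⧸ Ideal.ofRel (K0Rel k)

/-- The class `[X]` of a finite type `k`-scheme. -/
def cls {k : Type u} [Field k] (X : FTScheme k) : K0 k :=
  Ideal.Quotient.mk _ (MvPolynomial.X X)

/-! ### Quotients by finite groups and their classes -/

/-- `q : Z ⟶ Q` is the quotient of `Z` by the group whose elements `g` act by `α g`: the morphism
`q` is affine and invariant, and identifies `𝒪_Q` with the invariants of `q_* 𝒪_Z`. For an affine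
scheme `Z` this is `Z ⟶ Spec Γ(Z)^G`. -/
structure IsGroupQuotient {G : Type*} {Z Q : Scheme.{u}} (α : G → (Z ⟶ Z)) (q : Z ⟶ Q) :
    Prop where
  isAffineHom : IsAffineHom q
  inv : ∀ g, α g ≫ q = q
  injective : ∀ U : Q.Opens, Function.Injective (q.app U)
  range_eq : ∀ U : Q.Opens, Set.range (q.app U) =
    {s | ∀ (g : G) (e : q ⁻¹ᵁ U ≤ (α g) ⁻¹ᵁ (q ⁻¹ᵁ U)),
      (α g).appLE (q ⁻¹ᵁ U) (q ⁻¹ᵁ U) e s = s}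

variable {k : Type u} [Field k]

/-- The power `X ^ I` of a `k`-scheme, as a fibre product over `k`. -/
abbrev power (X : Over (Spec (CommRingCat.of k))) (I : Type) [Finite I] :
    Over (Spec (CommRingCat.of k)) :=
  ∏ᶜ fun _ : I => X

/-- The permutation of the factors of `X ^ I` induced by a permutation of `I`. -/
def permMap (X : Over (Spec (CommRingCat.of k))) (I : Type) [Finite I] (σ : Equiv.Perm I) :
    power X I ⟶ power X I :=
  Pi.lift fun i => Pi.π (fun _ : I => X) (σ i)

/-- The set of points of `X ^ I` outside of the big diagonal, i.e. outside of all the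
subschemes where the `i`-th and the `j`-th coordinate agree, `i ≠ j`. -/
def distinctLocus (X : Over (Spec (CommRingCat.of k))) (I : Type) [Finite I] :
    Set (power X I).left :=
  {x | ∀ i j : I, i ≠ j →
    x ∉ Set.range
      (equalizer.ι (Pi.π (fun _ : I => X) i) (Pi.π (fun _ : I => X) j)).left}

/-- A locally closed subscheme `Z` of `X ^ I`, stable under a group `G` of permutations of `I`,
together with a quotient `Q` of `Z` by `G`, of finite type over `k`. -/
structure QuotientStratum (X : Over (Spec (CommRingCat.of k))) (I : Type) [Finite I]
    (G : Subgroup (Equiv.Perm I)) where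
  /-- the subscheme -/
  Z : Over (Spec (CommRingCat.of k))
  /-- its inclusion -/
  incl : Z ⟶ power X I
  isImmersion : IsImmersion incl.left
  /-- the action of the group on the subscheme -/
  act : G → (Z ⟶ Z)
  act_incl : ∀ σ : G, act σ ≫ incl = incl ≫ permMap X I σ
  /-- the quotient -/
  Q : FTScheme k
  /-- the quotient morphism -/
  quot : Z ⟶ Q.obj
  isGroupQuotient : IsGroupQuotient (fun σ : G => (act σ).left) quot.left

/-- `c` is the class of the quotient by `G` of the `G`-stable subset `S` of `X ^ I`: there is a
finite decomposition of `S` into disjoint `G`-stable locally closed subschemes that have quotient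
schemes, and `c` is the sum of the classes of these quotients. If `S` is a locally closed
subscheme which has itself a quotient scheme (for instance when `X` is quasi-projective), the
decomposition with one member gives the class of that quotient. In general the quotient
is only an algebraic space, and this is its class. -/
def IsQuotientClass (X : Over (Spec (CommRingCat.of k))) (I : Type) [Finite I]
    (G : Subgroup (Equiv.Perm I)) (S : Set (power X I).left) (c : K0 k) : Prop :=
  ∃ (m : ℕ) (T : Fin m → QuotientStratum X I G),
    Pairwise (fun a b => Disjoint (Set.range (T a).incl.left) (Set.range (T b).incl.left)) ∧
    (⋃ a, Set.range (T a).incl.left) = S ∧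
    c = ∑ a, cls (T a).Q

/-- The class of `S / G`; it does not depend on the decomposition. -/
def quotientClass (X : Over (Spec (CommRingCat.of k))) (I : Type) [Finite I]
    (G : Subgroup (Equiv.Perm I)) (S : Set (power X I).left) : K0 k :=
  Classical.epsilon (IsQuotientClass X I G S)

/-! ### Partitions -/

/-- The multiplicity partition of a partition: the multiset of the multiplicities of its distinct
elements. -/
def multPartition (l : Multiset ℕ) : Multiset ℕ :=
  l.toFinset.val.map fun i => l.count i

/-- Elementary merges: `m` arises from `l` by replacing two parts by their sum. -/
def ElementaryMerge (l m : Multiset ℕ) : Prop :=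
  ∃ (x y : ℕ) (r : Multiset ℕ), l = x ::ₘ y ::ₘ r ∧ m = (x + y) ::ₘ r

/-- The refinement ordering `l ≤ m`: `m` arises from `l` by a sequence of elementary merges. -/
def RefineLE : Multiset ℕ → Multiset ℕ → Prop :=
  Relation.ReflTransGen ElementaryMerge

/-- The permutations of the elements of a multiset that preserve the labels. -/
def labelPerms (l : Multiset ℕ) : Subgroup (Equiv.Perm l) where
  carrier := {σ | ∀ i, (σ i).1 = i.1}
  one_mem' := fun _ => rfl
  mul_mem' := fun {a b} ha hb i => by
    rw [Equiv.Perm.mul_apply, ha, hb]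
  inv_mem' := fun {a} ha i => by
    have h := ha (a⁻¹ i)
    rwa [← Equiv.Perm.mul_apply, mul_inv_cancel, Equiv.Perm.one_apply, eq_comm] at h

/-! ### Configuration spaces and generating functions -/

/-- The class of the symmetric power `Sym ^ n X`. -/
def symClass (X : Over (Spec (CommRingCat.of k))) (n : ℕ) : K0 k :=
  quotientClass X (Fin n) ⊤ Set.univ

/-- The motivic zeta function `Z_X(t) = ∑ [Sym ^ n X] t ^ n`. -/
def zeta (X : Over (Spec (CommRingCat.of k))) : PowerSeries (K0 k) :=
  PowerSeries.mk fun n => symClass X n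

/-- `Z_X(t ^ i)`, for `i ≥ 1`. -/
def zetaPow (X : Over (Spec (CommRingCat.of k))) (i : ℕ) : PowerSeries (K0 k) :=
  PowerSeries.mk fun n => if i ∣ n then symClass X (n / i) else 0

/-- The class of `w_l(X)`: configurations of distinct points of `X` labelled by the elements of
`l`, where points with the same label are not ordered. This is the complement of the big diagonal
in the product of the `Sym ^ m X`, for `m` in the multiplicity partition of `l`. -/
def w (X : Over (Spec (CommRingCat.of k))) (l : Multiset ℕ) : K0 k :=
  quotientClass X l (labelPerms l) (distinctLocus X l)

open Classical in
/-- `w̄_l = ∑ [w_m]`, over all partitions `m ≥ l` of positive integers in the refinement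
ordering. -/
def wbar (X : Over (Spec (CommRingCat.of k))) (l : Multiset ℕ) : K0 k :=
  ∑ p : Nat.Partition l.sum, if RefineLE l p.parts then w X p.parts else 0

open Classical in
/-- `w_{(<a ⊢ j) ν} = ∑ [w_{μ ν}]`, over all partitions `μ` of `j` with all parts less than
`a`. -/
def wLT (X : Over (Spec (CommRingCat.of k))) (a j : ℕ) (ν : Multiset ℕ) : K0 k :=
  ∑ p : Nat.Partition j, if ∀ i ∈ p.parts, i < a then w X (p.parts + ν) else 0

/-- `K_{(<a) ν}(t) = ∑ w_{(<a ⊢ j) ν}(X) t ^ j`. -/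
def K (X : Over (Spec (CommRingCat.of k))) (a : ℕ) (ν : Multiset ℕ) : PowerSeries (K0 k) :=
  PowerSeries.mk fun j => wLT X a j ν

/-- `K̄_{1^• ν}(t) = ∑ w̄_{1 ^ j ν}(X) t ^ j`. -/
def Kbar (X : Over (Spec (CommRingCat.of k))) (ν : Multiset ℕ) : PowerSeries (K0 k) :=
  PowerSeries.mk fun j => wbar X (Multiset.replicate j 1 + ν)

/-! ### Universal formulas -/

/-- An integer polynomial as a power series with coefficients in a ring. -/
def intPoly {R : Type*} [CommRing R] (p : Polynomial ℤ) : PowerSeries R :=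
  Polynomial.aeval (PowerSeries.X : PowerSeries R) p

/-- The inverse of a power series with constant coefficient `1`. -/
def inv1 {R : Type*} [CommRing R] (f : PowerSeries R) : PowerSeries R :=
  PowerSeries.invOfUnit f 1

/-- The `ℤ[t]`-linear combination `∑ α(ν') w_{ν'}(X)`. -/
def evalA (α : Multiset ℕ →₀ Polynomial ℤ) (X : Over (Spec (CommRingCat.of k))) :
    PowerSeries (K0 k) :=
  α.sum fun ν' p => intPoly p * PowerSeries.C (w X ν')

/-- The `ℤ[t]`-linear combination `γ₀ + ∑ γ(ν', i) w_{ν'}(X) / Z_X(t ^ i)`. -/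
def evalC (γ₀ : Polynomial ℤ) (γ : Multiset ℕ × ℕ →₀ Polynomial ℤ)
    (X : Over (Spec (CommRingCat.of k))) : PowerSeries (K0 k) :=
  intPoly γ₀ + γ.sum fun c p => intPoly p * PowerSeries.C (w X c.1) * inv1 (zetaPow X c.2)

end MotivicConf

end

/-!
The proof has a geometric part, which reduces the theorem to three relations between the classes
`w l`, and a combinatorial part, which works with any elements of a commutative ring that satisfy
these relations.

**Classes are determined by field-valued points.** A surjective universally injective morphism
preserves classes (`cls_eq_of_universallyInjective`): in positive characteristic this is one of the
defining relations, and in characteristic zero such a morphism is generically an isomorphism up to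
nilpotents, so that Noetherian induction applies. Therefore two surjections from a scheme to `Q` and
`Q'` that identify the same pairs of field-valued points show that `Q` and `Q'` have the same class
(`cls_eq_of_same_kernel`); no morphism between `Q` and `Q'` is needed. Quotients by finite groups
have this property: they exist on invariant affine open subschemes, by the finiteness of rings of
invariants, hence piecewise on every power of `X` (`exists_isQuotientClass`), and their geometric
points are the orbits.

Configurations of points with labels in a commutative monoid are encoded as finitely supported
functions on the field-valued points of `X`. A class is *presented* by a family of configurations
(`Presents`) if it is the class of a disjoint union of schemes parametrizing the configurations up
to extension of the field, and then it depends only on the family (`Presents.unique`). The class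
`w l` is presented by the configurations with the multiset of labels `l`, the class of a symmetric
power by the multisets of the given number of points, and products of classes by pairs of
configurations. This gives the relations `ConfigLaws`: `w 0 = 1`; the labels may be renamed; and a
product `w l * w m` is the sum over all ways to superpose two configurations. It also shows that the
class of the `n`-th symmetric power is the sum of `w l` over the partitions of `n` (`symClass_eq`).

**The generating functions.** Division of all labels with remainder by `a` turns a configuration
into a superposition of one with arbitrary labels and one with labels less than `a`. Hence the
series of the latter is the quotient `Z(t) / Z(t ^ a)` (`ConfigLaws.totalSeries_eq`). Superposing
the configurations labelled by `ν` with those with labels less than `a` gives a linear equation for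
the series with labels `ν` and further labels less than `a` (`ConfigLaws.C_mul_smallSeries`). Its
terms either have the same series, up to renaming of labels, or have fewer coincidences among the
large labels. So the equation can be solved by induction (`ConfigLaws.ratComb_smallSeries`), which
is the first assertion.

For the second assertion, a partition `l` is a coarsening of `ν` together with parts `1` if and only
if the parts of `ν` can be packed into the parts of `l` (`refineLE_replicate_one_add_iff`). Let `e`
be the smallest part of `ν`. If at least `ν.card` parts of `l` are at least `e`, then `e` can be
removed from the packing problem (`packs_cons_iff`), and induction applies. Otherwise `l` has a
bounded number of large parts, and only their values up to a bound matter (`packs_capped_iff`). The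
series of the configurations with such large labels is obtained from the first assertion, because
raising the unspecified large labels by one multiplies a series by a power of `t`
(`ConfigLaws.ratComb_largeLabels`, `ConfigLaws.ratComb_packs`).

**Universality.** The combinatorial part is applied in the product of the Grothendieck rings of all
fields, indexed by all separated schemes of finite type (`universalW`). A formula that holds there
holds for every scheme, with the same coefficients.
-/

open CategoryTheory CategoryTheory.Limits AlgebraicGeometry

noncomputable section

namespace MotivicConf

section

variable {k : Type u} [Field k]

/-! ### Classes of finite type schemes -/

namespace FTScheme

instance (X : FTScheme k) : LocallyOfFiniteType X.obj.hom := X.locallyOfFiniteType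

instance (X : FTScheme k) : QuasiCompact X.obj.hom := X.quasiCompact

instance (X : FTScheme k) : IsNoetherian X.obj.left where
  toIsLocallyNoetherian :=
    haveI : IsLocallyNoetherian ((Functor.fromPUnit (Spec (CommRingCat.of k))).obj X.obj.right) :=
      inferInstanceAs (IsLocallyNoetherian (Spec (CommRingCat.of k)))
    LocallyOfFiniteType.isLocallyNoetherian X.obj.hom
  toCompactSpace :=
    haveI : CompactSpace ((Functor.fromPUnit (Spec (CommRingCat.of k))).obj X.obj.right) :=
      inferInstanceAs (CompactSpace (Spec (CommRingCat.of k)))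
    QuasiCompact.compactSpace_of_compactSpace X.obj.hom

/-- The finite type `k`-scheme given by a morphism of finite type to a finite type `k`-scheme. -/
def along (X : FTScheme k) {Y : Scheme.{u}} (f : Y ⟶ X.obj.left) [LocallyOfFiniteType f]
    [QuasiCompact f] : FTScheme k where
  obj := Over.mk (f ≫ X.obj.hom)
  locallyOfFiniteType := by dsimp; infer_instance
  quasiCompact := by dsimp; infer_instance

/-- The structure morphism of `X.along f` as a morphism over `k`. -/
def alongHom (X : FTScheme k) {Y : Scheme.{u}} (f : Y ⟶ X.obj.left) [LocallyOfFiniteType f]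
    [QuasiCompact f] : (X.along f).obj ⟶ X.obj := Over.homMk f

end FTScheme

/-- A morphism between finite type `k`-schemes is locally of finite type. -/
lemma locallyOfFiniteType_left {X Y : FTScheme k} (f : X.obj ⟶ Y.obj) :
    LocallyOfFiniteType f.left := by
  have h : LocallyOfFiniteType (f.left ≫ Y.obj.hom) := by rw [Over.w f]; infer_instance
  exact locallyOfFiniteType_of_comp f.left Y.obj.hom

lemma cls_eq_of_rel {X : FTScheme k} {p : MvPolynomial (FTScheme k) ℤ}
    (h : K0Rel k (MvPolynomial.X X) p) : cls X = Ideal.Quotient.mk _ p := by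
  refine Ideal.Quotient.eq.mpr ?_
  refine Submodule.subset_span ⟨_, _, h, ?_⟩
  ring

lemma cls_iso {X Y : FTScheme k} (e : X.obj ≅ Y.obj) : cls X = cls Y :=
  cls_eq_of_rel (K0Rel.iso X Y e)

lemma cls_scissor {X Y U : FTScheme k} (i : Y.obj ⟶ X.obj) (j : U.obj ⟶ X.obj)
    (hi : IsClosedImmersion i.left) (hj : IsOpenImmersion j.left)
    (hij : Set.range j.left = (Set.range i.left)ᶜ) : cls X = cls U + cls Y := by
  rw [cls_eq_of_rel (K0Rel.scissor X Y U i j hi hj hij), map_add]; rfl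

lemma cls_prod {X Y P : FTScheme k} (p : P.obj ⟶ X.obj) (q : P.obj ⟶ Y.obj)
    (h : IsPullback p.left q.left X.obj.hom Y.obj.hom) : cls P = cls X * cls Y := by
  rw [cls_eq_of_rel (K0Rel.prod X Y P p q h), map_mul]; rfl

lemma cls_unit {X : FTScheme k} (h : IsIso X.obj.hom) : cls X = 1 := by
  rw [cls_eq_of_rel (K0Rel.unit X h), map_one]

lemma cls_empty (X : FTScheme k) [IsEmpty X.obj.left] : cls X = 0 := by
  have := cls_scissor (𝟙 X.obj) (𝟙 X.obj) (by dsimp; infer_instance) (by dsimp; infer_instance)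
    (by ext x; exact isEmptyElim x)
  simpa using this

/-- Additivity of the class for a closed and an open subscheme, in terms of morphisms of
schemes. -/
lemma cls_eq_add {X : FTScheme k} {Y U : Scheme.{u}} (i : Y ⟶ X.obj.left) (j : U ⟶ X.obj.left)
    [IsClosedImmersion i] [IsOpenImmersion j] (hij : Set.range j = (Set.range i)ᶜ) :
    cls X = cls (X.along j) + cls (X.along i) :=
  cls_scissor (X.alongHom i) (X.alongHom j) ‹IsClosedImmersion i›
    ‹IsOpenImmersion j› hij

/-- A surjective closed immersion, i.e. a nilpotent thickening, does not change the class. -/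
lemma cls_eq_of_isClosedImmersion_of_surjective {X Y : FTScheme k} (i : Y.obj ⟶ X.obj)
    [IsClosedImmersion i.left] [Surjective i.left] : cls Y = cls X := by
  have := cls_eq_add (X := X) i.left (Scheme.emptyTo X.obj.left) (by
    rw [i.left.surjective.range_eq, Set.compl_univ]
    ext x; constructor
    · rintro ⟨y, _⟩; exact isEmptyElim y
    · simp)
  have h0 : cls (X.along (Scheme.emptyTo X.obj.left)) = 0 :=
    have : IsEmpty (X.along (Scheme.emptyTo X.obj.left)).obj.left :=
      inferInstanceAs (IsEmpty (∅ : Scheme))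
    cls_empty _
  rw [h0, zero_add] at this
  rw [this]
  exact cls_iso (Over.isoMk (Iso.refl _) (by simp [FTScheme.along]))

/-- The class of a scheme covered by two disjoint open subschemes. -/
lemma cls_eq_add_of_isOpenImmersion {X U V : FTScheme k} (i : U.obj ⟶ X.obj) (j : V.obj ⟶ X.obj)
    [IsOpenImmersion i.left] [IsOpenImmersion j.left]
    (hij : Set.range j.left = (Set.range i.left)ᶜ) : cls X = cls U + cls V := by
  have : IsClosedImmersion i.left := by
    refine IsClosedImmersion.of_isPreimmersion _ ?_
    rw [← compl_compl (Set.range i.left), ← hij]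
    exact j.left.isOpenEmbedding.isOpen_range.isClosed_compl
  rw [add_comm]
  exact cls_scissor i j inferInstance inferInstance hij

end

section

variable {k : Type u} [Field k]

/-! ### Generic isomorphisms in characteristic zero -/

section Algebra

variable {A B : Type u} [CommRing A] [CommRing B] [Algebra A B]

/-- If a ring map is an epimorphism towards fields and the residue fields have characteristic
zero, then it induces isomorphisms of residue fields: here, in terms of fractions. -/
lemma exists_smul_sub_mem_of_unique_field_points
    (h : ∀ (K : Type u) [Field K] (g₁ g₂ : B →+* K),
      g₁.comp (algebraMap A B) = g₂.comp (algebraMap A B) → g₁ = g₂)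
    (p : Ideal A) [p.IsPrime] [CharZero p.ResidueField] (P : Ideal B) [P.IsPrime] [P.LiesOver p]
    (b : B) : ∃ s ∉ p, ∃ a, algebraMap A B s * b - algebraMap A B a ∈ P := by
  let : Algebra p.ResidueField P.ResidueField :=
    (Ideal.ResidueField.map p P (algebraMap A B) (Ideal.LiesOver.over (P := P) (p := p))).toAlgebra
  have htow : ∀ a : A, algebraMap B P.ResidueField (algebraMap A B a) =
      algebraMap p.ResidueField P.ResidueField (algebraMap A p.ResidueField a) := fun a =>
    (Ideal.ResidueField.map_algebraMap p P (algebraMap A B) _ a).symm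
  have hins : IsPurelyInseparable p.ResidueField P.ResidueField := by
    rw [isPurelyInseparable_iff_subsingleton_emb, subsingleton_iff]
    intro σ₁ σ₂
    have h1 : σ₁.toRingHom.comp (algebraMap B P.ResidueField) =
        σ₂.toRingHom.comp (algebraMap B P.ResidueField) := by
      apply h
      ext a
      simp [htow]
    ext x
    obtain ⟨x, y, hy, rfl⟩ := IsFractionRing.div_surjective (A := B ⧸ P) x
    obtain ⟨x, rfl⟩ := Ideal.Quotient.mk_surjective x
    obtain ⟨y, rfl⟩ := Ideal.Quotient.mk_surjective y
    have h2 : ∀ x : B, σ₁ (algebraMap (B ⧸ P) P.ResidueField (Ideal.Quotient.mk P x)) =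
      σ₂ (algebraMap (B ⧸ P) P.ResidueField (Ideal.Quotient.mk P x)) := fun x => congr($h1 x)
    rw [map_div₀, map_div₀, h2, h2]
  obtain ⟨t, ht⟩ := IsPurelyInseparable.surjective_algebraMap_of_isSeparable p.ResidueField
    P.ResidueField (algebraMap B P.ResidueField b)
  obtain ⟨x, y, hy, rfl⟩ := IsFractionRing.div_surjective (A := A ⧸ p) t
  obtain ⟨a, rfl⟩ := Ideal.Quotient.mk_surjective x
  obtain ⟨s, rfl⟩ := Ideal.Quotient.mk_surjective y
  have hs : s ∉ p := fun hs => by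
    rw [Ideal.Quotient.eq_zero_iff_mem.mpr hs] at hy
    exact zero_notMem_nonZeroDivisors hy
  refine ⟨s, hs, a, ?_⟩
  rw [← Ideal.algebraMap_residueField_eq_zero, map_sub, map_mul, ← ht]
  have e2 : ∀ a : A, algebraMap (A ⧸ p) p.ResidueField (Ideal.Quotient.mk p a) =
    algebraMap A p.ResidueField a := fun a => rfl
  rw [htow, htow, e2, e2, ← map_mul, ← map_sub, mul_div_cancel₀, sub_self, map_zero]
  rwa [Ne, Ideal.algebraMap_residueField_eq_zero]

/-- An element lying in all the primes over a minimal prime `p` becomes nilpotent after inverting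
an element outside of `p`. -/
lemma exists_mul_pow_eq_zero (p : Ideal A) [hp : p.IsPrime]
    (hmin : ∀ q : Ideal A, q.IsPrime → q ≤ p → q = p) (x : B)
    (hx : ∀ Q : Ideal B, Q.IsPrime → Q.comap (algebraMap A B) = p → x ∈ Q) :
    ∃ s ∉ p, ∃ n : ℕ, algebraMap A B s * x ^ n = 0 := by
  by_contra! hcon
  let M : Submonoid B := (p.primeCompl.map (algebraMap A B)) ⊔ Submonoid.powers x
  have hM : Disjoint ((⊥ : Ideal B) : Set B) (M : Set B) := by
    rw [Set.disjoint_left]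
    rintro y hy hyM
    obtain ⟨u, ⟨s, hs, rfl⟩, v, ⟨n, rfl⟩, huv⟩ := Submonoid.mem_sup.mp hyM
    refine hcon s hs n ?_
    rw [← Ideal.mem_bot]
    exact huv ▸ hy
  obtain ⟨Q, hQ, -, hQM⟩ := Ideal.exists_le_prime_disjoint ⊥ M hM
  have hQp : Q.comap (algebraMap A B) = p := by
    refine hmin _ inferInstance fun a ha => ?_
    by_contra hap
    exact Set.disjoint_left.mp hQM (Ideal.mem_comap.mp ha)
      (Submonoid.mem_sup_left ⟨a, hap, rfl⟩)
  exact Set.disjoint_left.mp hQM (hx Q hQ hQp) (Submonoid.mem_sup_right ⟨1, pow_one x⟩)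

/-- A ring map of finite type that is an epimorphism towards fields is surjective up to nilpotents
near a minimal prime in the image of the spectrum. -/
lemma exists_awayMap_surjective [Algebra.FiniteType A B]
    (h : ∀ (K : Type u) [Field K] (g₁ g₂ : B →+* K),
      g₁.comp (algebraMap A B) = g₂.comp (algebraMap A B) → g₁ = g₂)
    (p : Ideal A) [p.IsPrime] (hmin : ∀ q : Ideal A, q.IsPrime → q ≤ p → q = p)
    [CharZero p.ResidueField] (P : Ideal B) [P.IsPrime] [P.LiesOver p]
    (hP : ∀ Q : Ideal B, Q.IsPrime → Q.comap (algebraMap A B) = p → Q = P) :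
    ∃ s ∉ p, Function.Surjective ((Ideal.Quotient.mk
      (nilradical (Localization.Away (algebraMap A B s)))).comp
      (Localization.awayMap (algebraMap A B) s)) := by
  classical
  obtain ⟨S, hS⟩ := ‹Algebra.FiniteType A B›.out
  have key : ∀ b : B, ∃ s ∉ p, ∃ a, ∃ n : ℕ,
      algebraMap A B s * (algebraMap A B s * b - algebraMap A B a) ^ n = 0 := by
    intro b
    obtain ⟨s, hs, a, ha⟩ := exists_smul_sub_mem_of_unique_field_points h p P b
    obtain ⟨s', hs', n, hn⟩ := exists_mul_pow_eq_zero p hmin _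
      (fun Q hQ hQp => hP Q hQ hQp ▸ ha)
    refine ⟨s * s', fun h => (Ideal.IsPrime.mem_or_mem ‹_› h).elim hs hs', a * s', n, ?_⟩
    rw [map_mul, map_mul]
    have : (algebraMap A B s * algebraMap A B s' * b - algebraMap A B a * algebraMap A B s') =
      algebraMap A B s' * (algebraMap A B s * b - algebraMap A B a) := by ring
    rw [this, mul_pow]
    linear_combination (algebraMap A B s * algebraMap A B s' ^ n) * hn
  choose s hs a n hn using key
  refine ⟨∏ b ∈ S, s b, fun h => ?_, ?_⟩
  · obtain ⟨b, -, hb⟩ := Ideal.IsPrime.prod_mem_iff.mp h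
    exact hs b hb
  set t := ∏ b ∈ S, s b with ht
  set φ := (Ideal.Quotient.mk (nilradical (Localization.Away (algebraMap A B t)))).comp
      (Localization.awayMap (algebraMap A B) t) with hφ
  have hφa : ∀ x : A, φ (algebraMap A _ x) =
      Ideal.Quotient.mk _ (algebraMap B _ (algebraMap A B x)) := by
    intro x
    simp [hφ, Localization.awayMap, IsLocalization.Away.map]
  have hunit : IsUnit (algebraMap A (Localization.Away t) t) :=
    IsLocalization.Away.algebraMap_isUnit t
  have hgen : ∀ b : B, Ideal.Quotient.mk (nilradical (Localization.Away (algebraMap A B t)))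
      (algebraMap B _ b) ∈ φ.range := by
    intro b
    have hb : b ∈ Algebra.adjoin A (S : Set B) := hS ▸ Algebra.mem_top
    induction hb using Algebra.adjoin_induction with
    | mem b hbS =>
      have hdvd : s b ∣ t := Finset.dvd_prod_of_mem _ hbS
      have hu : IsUnit (algebraMap A (Localization.Away t) (s b)) :=
        isUnit_of_dvd_unit (map_dvd _ hdvd) hunit
      obtain ⟨v, hv⟩ := hu.exists_left_inv
      have hu' : IsUnit (algebraMap B (Localization.Away (algebraMap A B t))
          (algebraMap A B (s b))) :=
        isUnit_of_dvd_unit (map_dvd _ (map_dvd _ hdvd))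
          (IsLocalization.Away.algebraMap_isUnit (algebraMap A B t))
      have hnil : IsNilpotent (algebraMap B (Localization.Away (algebraMap A B t))
          (algebraMap A B (s b) * b - algebraMap A B (a b))) := by
        refine ⟨n b, ?_⟩
        have := congr(algebraMap B (Localization.Away (algebraMap A B t)) $(hn b))
        rw [map_mul, map_zero, hu'.mul_right_eq_zero, map_pow] at this
        exact this
      have h0 := Ideal.Quotient.eq_zero_iff_mem.mpr (mem_nilradical.mpr hnil)
      rw [map_sub, map_sub, map_mul, map_mul, ← hφa, ← hφa, sub_eq_zero] at h0
      refine ⟨v * algebraMap A _ (a b), ?_⟩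
      rw [map_mul, ← h0, ← mul_assoc, ← map_mul, hv, map_one, one_mul]
    | algebraMap x => exact ⟨_, hφa x⟩
    | add x y _ _ hx hy => rw [map_add, map_add]; exact add_mem hx hy
    | mul x y _ _ hx hy => rw [map_mul, map_mul]; exact mul_mem hx hy
  intro c
  obtain ⟨c, rfl⟩ := Ideal.Quotient.mk_surjective c
  obtain ⟨m, b, hb⟩ := IsLocalization.Away.surj (algebraMap A B t) c
  obtain ⟨v, hv⟩ := hunit.exists_left_inv
  obtain ⟨y, hy⟩ := hgen b
  refine ⟨v ^ m * y, ?_⟩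
  rw [map_mul, hy, ← hb, map_mul, map_pow, map_pow, ← hφa, mul_left_comm, ← mul_pow,
    ← map_mul, hv, map_one, one_pow, mul_one]

end Algebra

/-- Universally injective morphisms are those that are injective on field-valued points. -/
lemma universallyInjective_iff_field {X Y : Scheme.{u}} (f : X ⟶ Y) :
    UniversallyInjective f ↔
      ∀ (K : Type u) [Field K], Function.Injective (fun g : Spec (.of K) ⟶ X => g ≫ f) :=
  (tfae_universallyInjective f).out 0 1

/-- On affine opens, universal injectivity says that a homomorphism from the upper ring to a field is
determined by its restriction to the lower ring. -/
lemma ringHom_eq_of_universallyInjective {X Y : Scheme.{u}} (f : X ⟶ Y) [UniversallyInjective f]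
    {U : Y.Opens} (hU : IsAffineOpen U) {V : X.Opens} (hV : IsAffineOpen V) (e : V ≤ f ⁻¹ᵁ U)
    (K : Type u) [Field K] (g₁ g₂ : Γ(X, V) →+* K)
    (h : g₁.comp (f.appLE U V e).hom = g₂.comp (f.appLE U V e).hom) : g₁ = g₂ := by
  have h1 := (universallyInjective_iff_field f).mp inferInstance K
  have key : ∀ g : Γ(X, V) →+* K, (Spec.map (CommRingCat.ofHom g) ≫ hV.fromSpec) ≫ f =
      Spec.map (CommRingCat.ofHom (g.comp (f.appLE U V e).hom)) ≫ hU.fromSpec := by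
    intro g
    rw [Category.assoc, ← IsAffineOpen.SpecMap_appLE_fromSpec f hU hV e, ← Spec.map_comp_assoc]
    rfl
  have h2 : Spec.map (CommRingCat.ofHom g₁) ≫ hV.fromSpec =
      Spec.map (CommRingCat.ofHom g₂) ≫ hV.fromSpec := h1 (by
    dsimp only
    rw [key, key, h])
  rw [cancel_mono] at h2
  exact congr($(Spec.map_injective h2).hom)

/-- A nonempty Noetherian scheme has a nonempty affine open subscheme that is irreducible: take it
inside the part of an irreducible component that meets no other one. -/
lemma exists_affine_irreducible (X : Scheme.{u}) [IsNoetherian X] [Nonempty X] :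
    ∃ U : X.Opens, IsAffineOpen U ∧ (nilradical Γ(X, U)).IsPrime := by
  obtain ⟨x⟩ := ‹Nonempty X›
  obtain ⟨o, ho, ⟨y, hy⟩, hoZ⟩ :=
    TopologicalSpace.NoetherianSpace.exists_isOpen_nonempty_subset_irreducibleComponent
      (irreducibleComponent x) (irreducibleComponent_mem_irreducibleComponents x)
  obtain ⟨_, ⟨U, hU, rfl⟩, hyU, hUo⟩ := X.isBasis_affineOpens.exists_subset_of_mem_open hy ho
  refine ⟨U, hU, ?_⟩
  have hirr : IsPreirreducible (U : Set X) :=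
    (isIrreducible_irreducibleComponent (x := x)).isPreirreducible.open_subset U.2
      (hUo.trans hoZ)
  have h1 : IsIrreducible (hU.fromSpec ⁻¹' (U : Set X)) :=
    IsIrreducible.preimage ⟨⟨y, hyU⟩, hirr⟩
      (IsAffineOpen.isOpenImmersion_fromSpec hU).base_open ⟨y, hyU, by rw [hU.range_fromSpec]; exact hyU⟩
  have h2 : hU.fromSpec ⁻¹' (U : Set X) = Set.univ := by
    rw [← hU.range_fromSpec, Set.preimage_range]
  rw [h2] at h1
  exact PrimeSpectrum.irreducibleSpace_iff_isPrime_nilradical.mp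
    ((irreducibleSpace_def _).mpr h1)

lemma charZero_residueField {X : FTScheme k} [CharZero k] (U : X.obj.left.Opens)
    (p : Ideal Γ(X.obj.left, U)) [p.IsPrime] : CharZero p.ResidueField :=
  charZero_of_injective_ringHom (f := (algebraMap Γ(X.obj.left, U) p.ResidueField).comp
    ((Scheme.ΓSpecIso (CommRingCat.of k)).inv ≫ X.obj.hom.appLE ⊤ U le_top).hom)
    (RingHom.injective _)

/-- Open subschemes that share a closed subscheme with the same points have the same class. -/
lemma cls_along_eq_of_thickening {E X : FTScheme k} {Y F C : Scheme.{u}} (i : Y ⟶ X.obj.left)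
    (j : F ⟶ E.obj.left) (c : C ⟶ F) (d : C ⟶ Y) [IsOpenImmersion i] [IsOpenImmersion j]
    [IsClosedImmersion c] [IsClosedImmersion d] [Surjective c] [Surjective d]
    (h : c ≫ j ≫ E.obj.hom = d ≫ i ≫ X.obj.hom) : cls (E.along j) = cls (X.along i) := by
  let c' : C ⟶ (E.along j).obj.left := c
  let d' : C ⟶ (X.along i).obj.left := d
  have : LocallyOfFiniteType c' := inferInstanceAs (LocallyOfFiniteType c)
  have : LocallyOfFiniteType d' := inferInstanceAs (LocallyOfFiniteType d)
  have : QuasiCompact c' := inferInstanceAs (QuasiCompact c)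
  have : QuasiCompact d' := inferInstanceAs (QuasiCompact d)
  have : IsClosedImmersion ((E.along j).alongHom c').left := inferInstanceAs (IsClosedImmersion c)
  have : IsClosedImmersion ((X.along i).alongHom d').left := inferInstanceAs (IsClosedImmersion d)
  have : Surjective ((E.along j).alongHom c').left := inferInstanceAs (Surjective c)
  have : Surjective ((X.along i).alongHom d').left := inferInstanceAs (Surjective d)
  refine (cls_eq_of_isClosedImmersion_of_surjective ((E.along j).alongHom c')).symm.trans
    (Eq.trans ?_ (cls_eq_of_isClosedImmersion_of_surjective ((X.along i).alongHom d')))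
  refine cls_iso (Over.isoMk (Iso.refl _) ?_)
  exact (Category.id_comp _).trans h.symm

/-- In characteristic zero, a surjective universally injective morphism is an isomorphism over a
nonempty open subscheme, up to nilpotents. -/
lemma exists_isOpenImmersion_cls_eq [CharZero k] {E X : FTScheme k} (f : E.obj ⟶ X.obj)
    [Surjective f.left] [UniversallyInjective f.left] [Nonempty X.obj.left] :
    ∃ (Y F : Scheme.{u}) (i : Y ⟶ X.obj.left) (j : F ⟶ E.obj.left) (_ : IsOpenImmersion i)
      (_ : IsOpenImmersion j), Nonempty Y ∧ Set.range j = f.left ⁻¹' Set.range i ∧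
      cls (E.along j) = cls (X.along i) := by
  obtain ⟨U, hU, hp⟩ := exists_affine_irreducible X.obj.left
  set p := nilradical Γ(X.obj.left, U) with hpdef
  set x := hU.fromSpec ⟨p, hp⟩ with hx
  have hxU : x ∈ U := by
    have : x ∈ Set.range hU.fromSpec := ⟨_, rfl⟩
    rwa [hU.range_fromSpec] at this
  obtain ⟨e, he⟩ := f.left.surjective x
  obtain ⟨_, ⟨W, hW, rfl⟩, heW, hWU⟩ :=
    E.obj.left.isBasis_affineOpens.exists_subset_of_mem_open
      (show e ∈ (f.left ⁻¹ᵁ U : E.obj.left.Opens) from show f.left e ∈ U from he ▸ hxU) (f.left ⁻¹ᵁ U).2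
  have hW : IsAffineOpen W := hW
  have hWU : W ≤ f.left ⁻¹ᵁ U := hWU
  have := locallyOfFiniteType_left f
  set φ := f.left.appLE U W hWU with hφ
  algebraize [φ.hom]
  have : Algebra.FiniteType Γ(X.obj.left, U) Γ(E.obj.left, W) :=
    f.left.finiteType_appLE hU hW hWU
  have hchar := charZero_residueField U p
  set P := hW.primeIdealOf ⟨e, heW⟩ with hP
  have hPe : hW.fromSpec P = e := hW.fromSpec_primeIdealOf ⟨e, heW⟩
  have hcomap : ∀ Q : PrimeSpectrum Γ(E.obj.left, W),
      hU.fromSpec (PrimeSpectrum.comap φ.hom Q) = f.left (hW.fromSpec Q) := by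
    intro Q
    exact congr($(IsAffineOpen.SpecMap_appLE_fromSpec f.left hU hW hWU) Q)
  have hPp : P.asIdeal.comap φ.hom = p := by
    have : PrimeSpectrum.comap φ.hom P = ⟨p, hp⟩ :=
      hU.fromSpec.isOpenEmbedding.injective (by rw [hcomap, hPe, he])
    exact congr($(this).asIdeal)
  have : P.asIdeal.LiesOver p := ⟨hPp.symm⟩
  obtain ⟨s, hs, hsurj⟩ := exists_awayMap_surjective (A := Γ(X.obj.left, U))
    (B := Γ(E.obj.left, W))
    (fun K _ g₁ g₂ h => ringHom_eq_of_universallyInjective f.left hU hW hWU K g₁ g₂ h) p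
    (fun q hq hqp => le_antisymm hqp (nilradical_le_prime q)) P.asIdeal
    (fun Q hQ hQp => by
      have h1 : PrimeSpectrum.comap φ.hom ⟨Q, hQ⟩ = ⟨p, hp⟩ := PrimeSpectrum.ext hQp
      have h2 : (⟨Q, hQ⟩ : PrimeSpectrum _) = P := by
        apply hW.fromSpec.isOpenEmbedding.injective
        apply f.left.injective
        rw [← hcomap, h1, hPe, he]
      exact congr($(h2).asIdeal))
  set ψ := (Ideal.Quotient.mk
      (nilradical (Localization.Away (algebraMap Γ(X.obj.left, U) Γ(E.obj.left, W) s)))).comp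
      (Localization.awayMap (algebraMap Γ(X.obj.left, U) Γ(E.obj.left, W)) s) with hψ
  let As := CommRingCat.of (Localization.Away s)
  let Bs := CommRingCat.of
    (Localization.Away (algebraMap Γ(X.obj.left, U) Γ(E.obj.left, W) s))
  let i : Spec As ⟶ X.obj.left :=
    Spec.map (CommRingCat.ofHom (algebraMap Γ(X.obj.left, U) As)) ≫ hU.fromSpec
  let j : Spec Bs ⟶ E.obj.left :=
    Spec.map (CommRingCat.ofHom (algebraMap Γ(E.obj.left, W) Bs)) ≫ hW.fromSpec
  have hi' : IsOpenImmersion (Spec.map (CommRingCat.ofHom (algebraMap Γ(X.obj.left, U) As))) :=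
    IsOpenImmersion.of_isLocalization s
  have hj' : IsOpenImmersion (Spec.map (CommRingCat.ofHom (algebraMap Γ(E.obj.left, W) Bs))) :=
    IsOpenImmersion.of_isLocalization (algebraMap Γ(X.obj.left, U) Γ(E.obj.left, W) s)
  have hi : IsOpenImmersion i := inferInstance
  have hj : IsOpenImmersion j := inferInstance
  let c : Spec (CommRingCat.of (Bs ⧸ nilradical Bs)) ⟶ Spec Bs :=
    Spec.map (CommRingCat.ofHom (Ideal.Quotient.mk (nilradical Bs)))
  let d : Spec (CommRingCat.of (Bs ⧸ nilradical Bs)) ⟶ Spec As := Spec.map (CommRingCat.ofHom ψ)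
  have hc : IsClosedImmersion c :=
    IsClosedImmersion.spec_of_surjective _ Ideal.Quotient.mk_surjective
  have hd : IsClosedImmersion d := IsClosedImmersion.spec_of_surjective _ hsurj
  have hcf : LocallyOfFiniteType c := inferInstance
  have hdf : LocallyOfFiniteType d := inferInstance
  have hcs : Surjective c := ⟨
    (PrimeSpectrum.comap_quotientMk_bijective_of_le_nilradical (le_refl (nilradical Bs))).2⟩
  have hcomm : (c ≫ j) ≫ f.left = d ≫ i := by
    simp only [c, j, d, i, Category.assoc]
    rw [← IsAffineOpen.SpecMap_appLE_fromSpec f.left hU hW hWU, ← Spec.map_comp_assoc,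
      ← Spec.map_comp_assoc, ← Spec.map_comp_assoc, ← CommRingCat.ofHom_comp]
    congr 2
    ext a
    simp only [hψ, CommRingCat.hom_comp, CommRingCat.hom_ofHom, RingHom.comp_apply]
    congr 1
    simp only [Localization.awayMap, IsLocalization.Away.map, As, Bs]
    rw [IsLocalization.map_eq]
    rfl
  have hds : Surjective d := by
    constructor
    have hker : RingHom.ker ψ ≤ nilradical As := by
      intro a ha
      obtain ⟨n, b, hb⟩ := IsLocalization.Away.surj s a
      have h1 : algebraMap _ As b ∈ RingHom.ker ψ := hb ▸ Ideal.mul_mem_right _ _ ha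
      have h2 : IsNilpotent (algebraMap Γ(E.obj.left, W) Bs
          (algebraMap Γ(X.obj.left, U) Γ(E.obj.left, W) b)) := by
        rw [RingHom.mem_ker, hψ, RingHom.comp_apply, Ideal.Quotient.eq_zero_iff_mem,
          mem_nilradical] at h1
        simpa [As, Bs, Localization.awayMap, IsLocalization.Away.map] using h1
      obtain ⟨m, hm⟩ := h2
      rw [← map_pow, IsLocalization.map_eq_zero_iff (Submonoid.powers
        (algebraMap Γ(X.obj.left, U) Γ(E.obj.left, W) s))] at hm
      obtain ⟨⟨_, l, rfl⟩, hl⟩ := hm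
      have hb' : b ∈ p := by
        have h3 : s ^ l * b ^ m ∈ P.asIdeal.comap φ.hom := by
          rw [Ideal.mem_comap]
          have : φ.hom (s ^ l * b ^ m) = 0 := by
            rw [map_mul, map_pow, map_pow]; exact hl
          rw [this]; exact Ideal.zero_mem _
        rw [hPp] at h3
        rcases hp.mem_or_mem h3 with h4 | h4
        · exact absurd (hp.mem_of_pow_mem _ h4) hs
        · exact hp.mem_of_pow_mem _ h4
      have hbn : IsNilpotent (algebraMap _ As b) := (mem_nilradical.mp hb').map _
      rw [← hb] at hbn
      have hu : IsUnit (algebraMap Γ(X.obj.left, U) As s ^ n) :=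
        (IsLocalization.Away.algebraMap_isUnit s).pow n
      rw [mem_nilradical]
      obtain ⟨v, hv⟩ := hu.exists_right_inv
      have : a = a * algebraMap Γ(X.obj.left, U) As s ^ n * v := by rw [mul_assoc, hv, mul_one]
      rw [this]
      exact (Commute.all _ _).isNilpotent_mul_right hbn
    intro q
    have hq : q ∈ Set.range (PrimeSpectrum.comap ψ) := by
      rw [range_comap_of_surjective _ ψ hsurj]
      exact hker.trans (@nilradical_le_prime _ _ q.asIdeal q.isPrime)
    exact hq
  refine ⟨Spec As, Spec Bs, i, j, hi, hj, ?_, ?_, ?_⟩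
  · have h1 : (⟨p, hp⟩ : PrimeSpectrum Γ(X.obj.left, U)) ∈
        Set.range (PrimeSpectrum.comap (algebraMap Γ(X.obj.left, U) As)) := by
      rw [PrimeSpectrum.localization_away_comap_range As s]
      exact hs
    exact ⟨h1.choose⟩
  · ext e'
    constructor
    · rintro ⟨y, rfl⟩
      obtain ⟨z, rfl⟩ := hcs.1 y
      exact ⟨d z, congr($hcomm.symm z)⟩
    · rintro ⟨y, hy⟩
      obtain ⟨z, rfl⟩ := hds.1 y
      refine ⟨c z, f.left.injective ?_⟩
      rw [← hy]
      exact congr($hcomm z)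
  · refine cls_along_eq_of_thickening i j c d ?_
    have h1 : f.left ≫ X.obj.hom = E.obj.hom := Over.w f
    have h2 : d ≫ i ≫ X.obj.hom = c ≫ j ≫ E.obj.hom := by
      rw [← h1, ← Category.assoc d, ← hcomm, Category.assoc, Category.assoc]
    exact h2.symm

end

section

variable {k : Type u} [Field k]

/-! ### Radicial surjections and geometric bijections -/

instance universallyInjective_comp {X Y Z : Scheme.{u}} (f : X ⟶ Y) (g : Y ⟶ Z)
    [hf : UniversallyInjective f] [hg : UniversallyInjective g] :
    UniversallyInjective (f ≫ g) := by
  rw [universallyInjective_iff_field] at hf hg ⊢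
  intro K _ a b hab
  refine hf K (hg K ?_)
  simpa only [Category.assoc] using hab

instance universallyInjective_pullback_fst {X Y S : Scheme.{u}} (f : X ⟶ S) (g : Y ⟶ S)
    [hg : UniversallyInjective g] : UniversallyInjective (pullback.fst f g) := by
  rw [universallyInjective_iff_field] at hg ⊢
  intro K _ a b hab
  refine pullback.hom_ext hab (hg K ?_)
  simp only [Category.assoc] at hab ⊢
  rw [← pullback.condition, ← Category.assoc, ← Category.assoc, hab]

instance universallyInjective_pullback_snd {X Y S : Scheme.{u}} (f : X ⟶ S) (g : Y ⟶ S)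
    [hf : UniversallyInjective f] : UniversallyInjective (pullback.snd f g) := by
  rw [universallyInjective_iff_field] at hf ⊢
  intro K _ a b hab
  refine pullback.hom_ext (hf K ?_) hab
  simp only [Category.assoc] at hab ⊢
  rw [pullback.condition, ← Category.assoc, ← Category.assoc, hab]

/-- A morphism from the spectrum of a field factors through an immersion as soon as it does so on
points. -/
lemma exists_field_lift {K : Type u} [Field K] {X Y : Scheme.{u}} (j : Y ⟶ X) [IsPreimmersion j]
    (g : Spec (CommRingCat.of K) ⟶ X) (h : g (IsLocalRing.closedPoint K) ∈ Set.range j) :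
    ∃ g' : Spec (CommRingCat.of K) ⟶ Y, g' ≫ j = g := by
  obtain ⟨⟨x, φ⟩, rfl⟩ := (X.SpecToEquivOfField K).symm.surjective g
  have hx : x ∈ Set.range j := by
    have e : (Spec.map φ ≫ X.fromSpecResidueField x) (IsLocalRing.closedPoint K) = x :=
      (Scheme.Hom.comp_apply _ _ _).trans (Scheme.fromSpecResidueField_apply _ _)
    exact e ▸ h
  obtain ⟨y, rfl⟩ := hx
  have hb : Function.Surjective (j.residueFieldMap y) := by
    have h1 := j.stalkMap_surjective y
    intro z
    obtain ⟨z, rfl⟩ := Y.residue_surjective y z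
    obtain ⟨w, rfl⟩ := h1 z
    exact ⟨X.residue (j y) w, rfl⟩
  have : IsIso (j.residueFieldMap y) :=
    (ConcreteCategory.isIso_iff_bijective _).mpr ⟨RingHom.injective _, hb⟩
  refine ⟨(Y.SpecToEquivOfField K).symm ⟨y, inv (j.residueFieldMap y) ≫ φ⟩, ?_⟩
  rw [Scheme.SpecToEquivOfField_symm_apply, Scheme.SpecToEquivOfField_symm_apply, Category.assoc,
    ← j.SpecMap_residueFieldMap_fromSpecResidueField, ← Spec.map_comp_assoc]
  simp

namespace FTScheme

variable {A : Type} [Finite A]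

/-- The disjoint union of a finite family of finite type schemes. -/
def sigma (Q : A → FTScheme k) : FTScheme k where
  obj := Over.mk (Sigma.desc fun a => (Q a).obj.hom :
    (∐ fun a => (Q a).obj.left) ⟶ Spec (CommRingCat.of k))
  locallyOfFiniteType :=
    have : IsZariskiLocalAtSource @LocallyOfFiniteType :=
      HasRingHomProperty.instIsZariskiLocalAtSource
    IsZariskiLocalAtSource.sigmaDesc (P := @LocallyOfFiniteType) fun a =>
      (Q a).locallyOfFiniteType
  quasiCompact := by
    have h : ∀ a, CompactSpace (Q a).obj.left := fun a => inferInstance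
    have : Finite (sigmaOpenCover fun a => (Q a).obj.left).I₀ := ‹Finite A›
    have : ∀ a, CompactSpace ((sigmaOpenCover fun a => (Q a).obj.left).X a) := h
    exact (quasiCompact_iff_compactSpace _).mpr
      (Scheme.OpenCover.compactSpace (sigmaOpenCover fun a => (Q a).obj.left))

/-- The inclusion of a summand. -/
def sigmaι (Q : A → FTScheme k) (a : A) : (Q a).obj ⟶ (sigma Q).obj :=
  Over.homMk (Sigma.ι (fun a => (Q a).obj.left) a) (by simp [sigma])

instance (Q : A → FTScheme k) (a : A) : IsOpenImmersion (sigmaι Q a).left :=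
  inferInstanceAs (IsOpenImmersion (Sigma.ι (fun a => (Q a).obj.left) a))

lemma exists_sigmaι_apply (Q : A → FTScheme k) (x : (sigma Q).obj.left) :
    ∃ a y, (sigmaι Q a).left y = x := by
  obtain ⟨a, y, h⟩ := (sigmaOpenCover fun a => (Q a).obj.left).exists_eq x
  exact ⟨a, y, h⟩

lemma sigmaι_apply_eq (Q : A → FTScheme k) {a b : A} {x : (Q a).obj.left} {y : (Q b).obj.left}
    (h : (sigmaι Q a).left x = (sigmaι Q b).left y) : a = b :=
  congr_arg Sigma.fst ((sigmaι_eq_iff (fun a => (Q a).obj.left) a b x y).mp h)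

/-- The morphism from a disjoint union given by morphisms from the summands. -/
def sigmaDesc (Q : A → FTScheme k) {X : Over (Spec (CommRingCat.of k))}
    (f : ∀ a, (Q a).obj ⟶ X) : (sigma Q).obj ⟶ X :=
  Over.homMk (Sigma.desc fun a => (f a).left) (by
    refine Sigma.hom_ext _ _ fun a => ?_
    simp [sigma])

@[simp] lemma sigmaι_sigmaDesc (Q : A → FTScheme k) {X : Over (Spec (CommRingCat.of k))}
    (f : ∀ a, (Q a).obj ⟶ X) (a : A) : sigmaι Q a ≫ sigmaDesc Q f = f a := by
  ext1
  exact Sigma.ι_desc _ _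

lemma sigmaDesc_apply (Q : A → FTScheme k) {X : Over (Spec (CommRingCat.of k))}
    (f : ∀ a, (Q a).obj ⟶ X) (a : A) (x : (Q a).obj.left) :
    (sigmaDesc Q f).left ((sigmaι Q a).left x) = (f a).left x := by
  rw [← sigmaι_sigmaDesc Q f a]; rfl

lemma range_sigmaDesc (Q : A → FTScheme k) {X : Over (Spec (CommRingCat.of k))}
    (f : ∀ a, (Q a).obj ⟶ X) :
    Set.range (sigmaDesc Q f).left = ⋃ a, Set.range (f a).left := by
  ext x
  simp only [Set.mem_range, Set.mem_iUnion]
  constructor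
  · rintro ⟨y, rfl⟩
    obtain ⟨a, y, rfl⟩ := exists_sigmaι_apply Q y
    exact ⟨a, y, (sigmaDesc_apply Q f a y).symm⟩
  · rintro ⟨a, y, rfl⟩
    exact ⟨_, sigmaDesc_apply Q f a y⟩

/-- A field-valued point of a disjoint union is a point of a summand. -/
lemma exists_comp_sigmaι (Q : A → FTScheme k) {K : Type u} [Field K]
    (g : Spec (CommRingCat.of K) ⟶ (sigma Q).obj.left) :
    ∃ a, ∃ g' : Spec (CommRingCat.of K) ⟶ (Q a).obj.left, g' ≫ (sigmaι Q a).left = g := by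
  obtain ⟨a, y, hy⟩ := exists_sigmaι_apply Q (g (IsLocalRing.closedPoint K))
  obtain ⟨g', hg'⟩ := exists_field_lift (sigmaι Q a).left g ⟨y, hy⟩
  exact ⟨a, g', hg'⟩

lemma universallyInjective_sigmaDesc (Q : A → FTScheme k) {X : Over (Spec (CommRingCat.of k))}
    (f : ∀ a, (Q a).obj ⟶ X) (hf : ∀ a, UniversallyInjective (f a).left)
    (hd : ∀ a b, a ≠ b → Disjoint (Set.range (f a).left) (Set.range (f b).left)) :
    UniversallyInjective (sigmaDesc Q f).left := by
  rw [universallyInjective_iff_field]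
  intro K _ g₁ g₂ h
  obtain ⟨a, g₁, rfl⟩ := exists_comp_sigmaι Q g₁
  obtain ⟨b, g₂, rfl⟩ := exists_comp_sigmaι Q g₂
  have e : ∀ a, (sigmaι Q a).left ≫ (sigmaDesc Q f).left = (f a).left := fun a => by
    rw [← Over.comp_left, sigmaι_sigmaDesc]
  simp only [Category.assoc, e] at h
  have hab : a = b := by
    by_contra hab
    exact Set.disjoint_left.mp (hd a b hab) ⟨g₁ (IsLocalRing.closedPoint K), rfl⟩
      ⟨g₂ (IsLocalRing.closedPoint K), congr($h.symm (IsLocalRing.closedPoint K))⟩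
  subst hab
  rw [(universallyInjective_iff_field _).mp (hf a) K h]

end FTScheme

/-- Noetherian induction on finite type schemes: a property holds for all of them if it holds for
`X` as soon as it holds for all the proper closed subschemes of `X`. -/
lemma FTScheme.noetherian_induction {P : FTScheme k → Prop}
    (h : ∀ X : FTScheme k, (∀ (Y : FTScheme k) (i : Y.obj ⟶ X.obj), IsClosedImmersion i.left →
      Set.range i.left ≠ Set.univ → P Y) → P X) (X : FTScheme k) : P X := by
  suffices H : ∀ (T : TopologicalSpace.Closeds X.obj.left) (Y : FTScheme k) (i : Y.obj ⟶ X.obj),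
      IsClosedImmersion i.left → Set.range i.left = T → P Y from
    H ⊤ X (𝟙 _) (by dsimp; infer_instance) (by ext; simp)
  intro T
  induction T using WellFoundedLT.induction with
  | ind T ih =>
    intro Y i hi hT
    refine h Y fun Z j hj hjT => ?_
    refine ih ⟨Set.range (j ≫ i).left, ?_⟩ ?_ Z (j ≫ i) (by dsimp; infer_instance) rfl
    · have : IsClosedImmersion (j ≫ i).left := by dsimp; infer_instance
      exact (j ≫ i).left.isClosedEmbedding.isClosed_range
    · refine lt_of_le_of_ne ?_ ?_
      · rintro _ ⟨x, rfl⟩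
        have : (j ≫ i).left x ∈ Set.range i.left := ⟨j.left x, rfl⟩
        rwa [hT] at this
      · intro heq
        apply hjT
        have heq : Set.range (j ≫ i).left = T := congr(($heq : Set X.obj.left))
        rw [Set.eq_univ_iff_forall]
        intro y
        have hy : i.left y ∈ Set.range (j ≫ i).left := by rw [heq, ← hT]; exact ⟨y, rfl⟩
        obtain ⟨z, hz⟩ := hy
        exact ⟨z, i.left.isClosedEmbedding.injective hz⟩

/-- The reduced closed subscheme with a given closed set of points. -/
lemma exists_isClosedImmersion_range (X : Scheme.{u}) {T : Set X} (hT : IsClosed T) :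
    ∃ (Y : Scheme.{u}) (i : Y ⟶ X), IsClosedImmersion i ∧ Set.range i = T :=
  ⟨_, (Scheme.IdealSheafData.vanishingIdeal ⟨T, hT⟩).subschemeι, inferInstance, by
    rw [Scheme.IdealSheafData.range_subschemeι]; simp⟩

/-- The source and the target of a radicial surjection have the same class. In positive
characteristic this is imposed on the Grothendieck ring. In characteristic zero it follows by
Noetherian induction. -/
theorem cls_eq_of_universallyInjective {E X : FTScheme k} (f : E.obj ⟶ X.obj)
    [Surjective f.left] [UniversallyInjective f.left] : cls E = cls X := by
  by_cases hk : ringChar k = 0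
  swap
  · exact cls_eq_of_rel (K0Rel.radicial hk E X f inferInstance inferInstance)
  have : CharP k 0 := hk ▸ ringChar.charP k
  have : CharZero k := CharP.charP_to_charZero k
  suffices H : ∀ X : FTScheme k, ∀ (E : FTScheme k) (f : E.obj ⟶ X.obj), Surjective f.left →
      UniversallyInjective f.left → cls E = cls X from H X E f inferInstance inferInstance
  intro X
  induction X using FTScheme.noetherian_induction with
  | h X ih =>
    intro E f hf hf'
    rcases isEmpty_or_nonempty X.obj.left with hX | hX
    · have : IsEmpty E.obj.left := ⟨fun x => isEmptyElim (f.left x)⟩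
      rw [cls_empty, cls_empty]
    obtain ⟨Y, F, i, j, hi, hj, ⟨y⟩, hij, hcls⟩ := exists_isOpenImmersion_cls_eq f
    obtain ⟨Z, ι, hι, hιr⟩ := exists_isClosedImmersion_range X.obj.left
      (i.isOpenEmbedding.isOpen_range.isClosed_compl)
    have e1 := cls_eq_add ι i (by rw [hιr, compl_compl])
    have e2 := cls_eq_add (X := E) (pullback.fst f.left ι) j (by
      rw [Scheme.Pullback.range_fst, hιr, hij]
      simp)
    rw [e1, e2, hcls]
    congr 1
    refine ih (X.along ι) (X.alongHom ι) hι ?_ (E.along (pullback.fst f.left ι))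
      (Over.homMk (pullback.snd f.left ι) ?_) ?_ ?_
    · intro h
      replace h : (Set.range i)ᶜ = Set.univ := hιr.symm.trans h
      have : i y ∈ (Set.range i)ᶜ := h ▸ Set.mem_univ _
      exact this ⟨y, rfl⟩
    · have := Over.w f
      dsimp [FTScheme.along] at this ⊢
      rw [← pullback.condition_assoc, this]
    · exact inferInstanceAs (Surjective (pullback.snd f.left ι))
    · exact universallyInjective_pullback_snd f.left ι

/-- Every constructible subset of a finite type scheme is the set of points of a finite type
scheme with a radicial morphism to it. -/
lemma exists_range_eq_of_isConstructible (P : FTScheme k) {s : Set P.obj.left}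
    (hs : Topology.IsConstructible s) :
    ∃ (E : FTScheme k) (f : E.obj ⟶ P.obj), UniversallyInjective f.left ∧
      Set.range f.left = s := by
  let M : Set P.obj.left → Prop := fun s => ∃ (E : FTScheme k) (f : E.obj ⟶ P.obj),
    UniversallyInjective f.left ∧ Set.range f.left = s
  have hopen : ∀ s : Set P.obj.left, IsOpen s → M s := fun s hs =>
    ⟨P.along (Scheme.Opens.ι ⟨s, hs⟩), P.alongHom _,
      inferInstanceAs (UniversallyInjective (Scheme.Opens.ι ⟨s, hs⟩)),
      Scheme.Opens.range_ι ⟨s, hs⟩⟩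
  have hclosed : ∀ s : Set P.obj.left, IsClosed s → M s := fun s hs => by
    obtain ⟨Z, ι, hι, hιr⟩ := exists_isClosedImmersion_range P.obj.left hs
    exact ⟨P.along ι, P.alongHom ι, inferInstanceAs (UniversallyInjective ι), hιr⟩
  have hinter : ∀ s t : Set P.obj.left, M s → M t → M (s ∩ t) := by
    rintro _ _ ⟨E, f, hf, rfl⟩ ⟨F, g, hg, rfl⟩
    have := locallyOfFiniteType_left f
    have := locallyOfFiniteType_left g
    let h : pullback f.left g.left ⟶ P.obj.left := pullback.fst f.left g.left ≫ f.left
    refine ⟨P.along h, P.alongHom h, ?_, ?_⟩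
    · have : UniversallyInjective (pullback.fst f.left g.left) :=
        universallyInjective_pullback_fst f.left g.left
      exact inferInstanceAs (UniversallyInjective (pullback.fst f.left g.left ≫ f.left))
    · exact Scheme.Pullback.range_fst_comp _ _
  have hunion : ∀ s t : Set P.obj.left, Disjoint s t → M s → M t → M (s ∪ t) := by
    rintro _ _ hst ⟨E, f, hf, rfl⟩ ⟨F, g, hg, rfl⟩
    have := locallyOfFiniteType_left f
    have := locallyOfFiniteType_left g
    let Q : Bool → FTScheme k := fun b => cond b E F
    let d : ∀ b, (Q b).obj ⟶ P.obj := fun b => match b with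
      | true => f
      | false => g
    have hd : ∀ b, UniversallyInjective (d b).left := fun b => by cases b <;> assumption
    refine ⟨FTScheme.sigma Q, FTScheme.sigmaDesc Q d, ?_, ?_⟩
    · refine FTScheme.universallyInjective_sigmaDesc Q d hd fun a b hab => ?_
      cases a <;> cases b
      · exact absurd rfl hab
      · exact hst.symm
      · exact hst
      · exact absurd rfl hab
    · rw [FTScheme.range_sigmaDesc]
      ext x
      simp [d, Q]
      tauto
  have key := BooleanSubalgebra.closure_bot_sup_induction
    (p := fun s _ => M s ∧ M sᶜ) (fun s hs => ⟨hopen s hs.1, hclosed _ hs.1.isClosed_compl⟩)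
    ⟨hopen _ isOpen_empty, by simpa using hopen _ isOpen_univ⟩ ?_ ?_ hs
  · exact key.1
  · rintro s - t - ⟨hs1, hs2⟩ ⟨ht1, ht2⟩
    refine ⟨?_, ?_⟩
    · have : s ⊔ t = s ∪ (sᶜ ∩ t) := by ext; simp; tauto
      rw [this]
      exact hunion _ _ (Set.disjoint_left.mpr fun x hx hx' => hx'.1 hx) hs1 (hinter _ _ hs2 ht1)
    · have : (s ⊔ t)ᶜ = sᶜ ∩ tᶜ := by ext; simp
      rw [this]
      exact hinter _ _ hs2 ht2
  · rintro s - ⟨h1, h2⟩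
    exact ⟨h2, by rwa [compl_compl]⟩

end

section

variable {k : Type u} [Field k]

/-! ### Field-valued points -/

lemma epi_of_isField_spec {K L : Type u} [Field K] [Field L]
    (h : Spec (CommRingCat.of L) ⟶ Spec (CommRingCat.of K)) : Epi h := by
  obtain ⟨φ, rfl⟩ := Spec.map_surjective h
  algebraize [φ.hom]
  have : Flat (Spec.map φ) := by
    rw [Flat.SpecMap_iff]
    exact Module.Flat.of_free
  have : Surjective (Spec.map φ) := ⟨fun x => ⟨IsLocalRing.closedPoint L,
    Subsingleton.elim (α := PrimeSpectrum K) _ _⟩⟩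
  exact Flat.epi_of_flat_of_surjective _

/-- A field-valued point lifts along a morphism after a field extension, if it does so as a point
of the underlying space. -/
lemma exists_extension_lift {V P : Scheme.{u}} (m : V ⟶ P) {K : Type u} [Field K]
    (g : Spec (CommRingCat.of K) ⟶ P) (h : g (IsLocalRing.closedPoint K) ∈ Set.range m) :
    ∃ (L : Type u) (_ : Field L) (e : Spec (CommRingCat.of L) ⟶ Spec (CommRingCat.of K))
      (v : Spec (CommRingCat.of L) ⟶ V), v ≫ m = e ≫ g := by
  obtain ⟨y, hy⟩ := h
  obtain ⟨z, -, -⟩ := Scheme.Pullback.exists_preimage_pullback (f := m) (g := g) y _ hy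
  refine ⟨(pullback m g).residueField z, inferInstance,
    (pullback m g).fromSpecResidueField z ≫ pullback.snd m g,
    (pullback m g).fromSpecResidueField z ≫ pullback.fst m g, ?_⟩
  rw [Category.assoc, Category.assoc, pullback.condition]

/-- A scheme over `k` that is isomorphic to the spectrum of a field. -/
class IsFieldPoint (T : Over (Spec (CommRingCat.of k))) : Prop where
  exists_iso : ∃ (K : Type u) (_ : Field K), Nonempty (Spec (CommRingCat.of K) ≅ T.left)

instance isFieldPoint_mk {K : Type u} [Field K]
    (s : Spec (CommRingCat.of K) ⟶ Spec (CommRingCat.of k)) : IsFieldPoint (Over.mk s) :=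
  ⟨K, inferInstance, ⟨Iso.refl _⟩⟩

/-- A morphism between spectra of fields is an epimorphism: points can be compared after a field
extension. -/
lemma epi_of_isFieldPoint {T T' : Over (Spec (CommRingCat.of k))} [hT : IsFieldPoint T]
    [hT' : IsFieldPoint T'] (e : T' ⟶ T) : Epi e := by
  obtain ⟨K, _, ⟨i⟩⟩ := hT
  obtain ⟨L, _, ⟨j⟩⟩ := hT'
  have h := epi_of_isField_spec (j.hom ≫ e.left ≫ i.inv)
  have : Epi e.left := by
    have e1 : e.left = j.inv ≫ (j.hom ≫ e.left ≫ i.inv) ≫ i.hom := by simp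
    rw [e1]
    infer_instance
  exact (Over.forget _).epi_of_epi_map this

/-- The product over `k`. -/
def FTScheme.prod (X Y : FTScheme k) : FTScheme k :=
  X.along (pullback.fst X.obj.hom Y.obj.hom)

namespace FTScheme

variable (X Y : FTScheme k)

/-- The first projection. -/
def fst : (X.prod Y).obj ⟶ X.obj := X.alongHom _

/-- The second projection. -/
def snd : (X.prod Y).obj ⟶ Y.obj :=
  Over.homMk (pullback.snd X.obj.hom Y.obj.hom) pullback.condition.symm

lemma isPullback_prod : IsPullback (X.fst Y).left (X.snd Y).left X.obj.hom Y.obj.hom :=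
  IsPullback.of_hasPullback _ _

lemma cls_prod' : cls (X.prod Y) = cls X * cls Y :=
  cls_prod _ _ (X.isPullback_prod Y)

variable {X Y}

/-- The morphism to a product. -/
def lift {T : Over (Spec (CommRingCat.of k))} (f : T ⟶ X.obj) (g : T ⟶ Y.obj) :
    T ⟶ (X.prod Y).obj :=
  Over.homMk (pullback.lift f.left g.left (by rw [Over.w f, Over.w g])) (by
    refine Eq.trans ?_ (Over.w f)
    exact pullback.lift_fst_assoc _ _ _ _)

@[simp] lemma lift_fst {T : Over (Spec (CommRingCat.of k))} (f : T ⟶ X.obj)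
    (g : T ⟶ Y.obj) : lift f g ≫ X.fst Y = f := by
  ext1
  exact pullback.lift_fst _ _ _

@[simp] lemma lift_snd {T : Over (Spec (CommRingCat.of k))} (f : T ⟶ X.obj)
    (g : T ⟶ Y.obj) : lift f g ≫ X.snd Y = g := by
  ext1
  exact pullback.lift_snd _ _ _

lemma prod_hom_ext {T : Over (Spec (CommRingCat.of k))} {f g : T ⟶ (X.prod Y).obj}
    (h₁ : f ≫ X.fst Y = g ≫ X.fst Y) (h₂ : f ≫ X.snd Y = g ≫ X.snd Y) : f = g := by
  ext1
  exact pullback.hom_ext congr($(h₁).left) congr($(h₂).left)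

end FTScheme

/-- Universal injectivity can be tested on field-valued points over `k`. -/
lemma universallyInjective_iff_fieldPoint {X Y : Over (Spec (CommRingCat.of k))} (f : X ⟶ Y) :
    UniversallyInjective f.left ↔ ∀ (T : Over (Spec (CommRingCat.of k))) [IsFieldPoint T],
      Function.Injective (fun g : T ⟶ X => g ≫ f) := by
  rw [universallyInjective_iff_field]
  refine ⟨fun h T hT a b hab => ?_, fun h K _ a b hab => ?_⟩
  · obtain ⟨K, _, ⟨i⟩⟩ := hT
    ext1
    rw [← cancel_epi i.hom]
    refine h K ?_
    have : a.left ≫ f.left = b.left ≫ f.left := congr($(hab).left)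
    simp only [Category.assoc, this]
  · replace hab : a ≫ f.left = b ≫ f.left := hab
    let a' : Over.mk (a ≫ X.hom) ⟶ X := Over.homMk a
    let b' : Over.mk (a ≫ X.hom) ⟶ X := Over.homMk b (by
      dsimp
      rw [← Over.w f, ← Category.assoc, ← hab, Category.assoc])
    have : a' = b' := h _ (by ext1; exact hab)
    exact congr($(this).left)

/-- A field-valued point lifts along a surjective morphism after a field extension. -/
lemma exists_fieldPoint_lift {X Y T : Over (Spec (CommRingCat.of k))} [hT : IsFieldPoint T]
    (f : X ⟶ Y) (y : T ⟶ Y) (h : Set.range y.left ⊆ Set.range f.left) :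
    ∃ (T' : Over (Spec (CommRingCat.of k))) (_ : IsFieldPoint T') (e : T' ⟶ T) (x : T' ⟶ X),
      x ≫ f = e ≫ y := by
  obtain ⟨K, _, ⟨i⟩⟩ := hT
  obtain ⟨L, _, e, v, hv⟩ := exists_extension_lift f.left (i.hom ≫ y.left) (h ⟨_, rfl⟩)
  refine ⟨Over.mk (v ≫ X.hom), inferInstance, Over.homMk (e ≫ i.hom) ?_, Over.homMk v, ?_⟩
  · dsimp
    rw [← Over.w y, ← Over.w f, ← Category.assoc v, hv]
    simp
  · ext1
    simpa using hv

/-- A morphism is surjective if each field-valued point of the target lifts after a field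
extension. -/
lemma surjective_of_fieldPoint {X Y : Over (Spec (CommRingCat.of k))} (f : X ⟶ Y)
    (h : ∀ (T : Over (Spec (CommRingCat.of k))) [IsFieldPoint T] (y : T ⟶ Y),
      ∃ (T' : Over (Spec (CommRingCat.of k))) (_ : IsFieldPoint T') (e : T' ⟶ T) (x : T' ⟶ X),
      x ≫ f = e ≫ y) : Surjective f.left := by
  refine ⟨fun y => ?_⟩
  obtain ⟨T', hT', e, x, hx⟩ := h (Over.mk (Y.left.fromSpecResidueField y ≫ Y.hom))
    (Over.homMk (Y.left.fromSpecResidueField y))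
  have hx : x.left ≫ f.left = e.left ≫ Y.left.fromSpecResidueField y := congr($(hx).left)
  obtain ⟨L, _, ⟨j⟩⟩ := hT'
  let z : T'.left := j.hom (IsLocalRing.closedPoint L)
  refine ⟨x.left z, ?_⟩
  have h1 : f.left (x.left z) = (x.left ≫ f.left) z := rfl
  rw [h1, hx]
  exact (Scheme.Hom.comp_apply _ _ _).trans (Scheme.fromSpecResidueField_apply _ _)

/-- Two quotients of a scheme by the same equivalence relation, up to radicial morphisms, have
the same class. -/
theorem cls_eq_of_same_kernel {V Q₁ Q₂ : FTScheme k} (q₁ : V.obj ⟶ Q₁.obj) (q₂ : V.obj ⟶ Q₂.obj)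
    [Surjective q₁.left] [Surjective q₂.left]
    (h : ∀ (T : Over (Spec (CommRingCat.of k))) [IsFieldPoint T] (v w : T ⟶ V.obj),
      v ≫ q₁ = w ≫ q₁ ↔ v ≫ q₂ = w ≫ q₂) :
    cls Q₁ = cls Q₂ := by
  let m : V.obj ⟶ (Q₁.prod Q₂).obj := FTScheme.lift q₁ q₂
  have := locallyOfFiniteType_left m
  have : LocallyOfFinitePresentation m.left :=
    LocallyOfFinitePresentation.iff_locallyOfFiniteType.mpr this
  have hc : Topology.IsConstructible (Set.range m.left) := by
    rw [← Set.image_univ]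
    exact m.left.isConstructible_image .univ
  obtain ⟨E, f, hf, hfr⟩ := exists_range_eq_of_isConstructible _ hc
  have key : ∀ (Q : FTScheme k) (q : V.obj ⟶ Q.obj) (p : (Q₁.prod Q₂).obj ⟶ Q.obj),
      m ≫ p = q → Surjective q.left →
      (∀ (T : Over (Spec (CommRingCat.of k))) [IsFieldPoint T] (v w : T ⟶ V.obj),
        v ≫ q = w ≫ q → v ≫ m = w ≫ m) → cls E = cls Q := by
    intro Q q p hpq hq hker
    have h1 : Surjective (f ≫ p).left := by
      refine ⟨fun y => ?_⟩
      obtain ⟨x, hx⟩ := hq.surj y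
      have h2 : m.left x ∈ Set.range f.left := hfr ▸ ⟨x, rfl⟩
      obtain ⟨z, hz⟩ := h2
      refine ⟨z, ?_⟩
      rw [← hx, ← hpq]
      exact congr(p.left $hz)
    have h2 : UniversallyInjective (f ≫ p).left := by
      rw [universallyInjective_iff_fieldPoint] at hf ⊢
      intro T _ a b hab
      replace hab : a ≫ f ≫ p = b ≫ f ≫ p := hab
      -- both points lift to `V` over a common field extension
      obtain ⟨T₁, _, e, v, hv⟩ := exists_fieldPoint_lift m (a ≫ f) (by
        rw [← hfr]; exact Set.range_comp_subset_range a.left f.left)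
      obtain ⟨T₂, _, e', w, hw⟩ := exists_fieldPoint_lift m (e ≫ b ≫ f) (by
        rw [← hfr, ← Category.assoc]; exact Set.range_comp_subset_range (e ≫ b).left f.left)
      have h3 : (e' ≫ v) ≫ q = w ≫ q := by
        rw [← hpq, Category.assoc, reassoc_of% hv, reassoc_of% hw, hab]
      have h4 := hker _ _ _ h3
      rw [Category.assoc, hv, hw] at h4
      have := epi_of_isFieldPoint e
      have := epi_of_isFieldPoint e'
      rw [cancel_epi, cancel_epi] at h4
      exact hf T h4
    exact cls_eq_of_universallyInjective (f ≫ p)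
  rw [← key Q₁ q₁ (Q₁.fst Q₂) (FTScheme.lift_fst _ _) inferInstance,
    ← key Q₂ q₂ (Q₁.snd Q₂) (FTScheme.lift_snd _ _) inferInstance]
  · intro T _ v w hvw
    exact FTScheme.prod_hom_ext (by simpa [m] using (h T v w).mpr hvw) (by simpa [m] using hvw)
  · intro T _ v w hvw
    exact FTScheme.prod_hom_ext (by simpa [m] using hvw) (by simpa [m] using (h T v w).mp hvw)

/-! ### Classes of disjoint unions -/

lemma FTScheme.cls_sigma {A : Type} [Fintype A] (Q : A → FTScheme k) :
    cls (sigma Q) = ∑ a, cls (Q a) := by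
  classical
  suffices H : ∀ S : Finset A, cls ((sigma Q).along
      (⨆ a ∈ S, (sigmaι Q a).left.opensRange : (sigma Q).obj.left.Opens).ι) =
        ∑ a ∈ S, cls (Q a) by
    rw [← H]
    have : (⨆ a ∈ Finset.univ, (sigmaι Q a).left.opensRange : (sigma Q).obj.left.Opens) = ⊤ := by
      ext x
      obtain ⟨a, y, rfl⟩ := exists_sigmaι_apply Q x
      simp only [TopologicalSpace.Opens.coe_iSup, Set.mem_iUnion, TopologicalSpace.Opens.coe_top,
        Set.mem_univ, iff_true, Finset.mem_univ, exists_true_left]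
      exact ⟨a, y, rfl⟩
    rw [this]
    exact (cls_iso (Over.isoMk (Scheme.topIso _) rfl)).symm
  have hmem : ∀ (S : Finset A) (x), x ∈ (⨆ a ∈ S, (sigmaι Q a).left.opensRange :
      (sigma Q).obj.left.Opens) ↔ ∃ a ∈ S, x ∈ Set.range (sigmaι Q a).left := by
    intro S x
    simp only [TopologicalSpace.Opens.mem_iSup, exists_prop]
    rfl
  intro S
  induction S using Finset.induction_on with
  | empty =>
    rw [Finset.sum_empty]
    refine @cls_empty _ _ _ ?_
    constructor
    rintro ⟨x, hx⟩
    rw [hmem] at hx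
    simp at hx
  | insert a S ha ih =>
    rw [Finset.sum_insert ha, ← ih]
    set O := (⨆ b ∈ insert a S, (sigmaι Q b).left.opensRange : (sigma Q).obj.left.Opens)
    set O' := (⨆ b ∈ S, (sigmaι Q b).left.opensRange : (sigma Q).obj.left.Opens)
    have hO : O' ≤ O := fun x hx => by
      rw [hmem] at hx ⊢
      obtain ⟨b, hb, h⟩ := hx
      exact ⟨b, Finset.mem_insert_of_mem hb, h⟩
    have hr : Set.range (sigmaι Q a).left ⊆ Set.range O.ι := by
      rw [Scheme.Opens.range_ι]
      rintro _ ⟨x, rfl⟩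
      exact (hmem _ _).mpr ⟨a, Finset.mem_insert_self _ _, x, rfl⟩
    let l : (Q a).obj.left ⟶ O.toScheme := IsOpenImmersion.lift O.ι (sigmaι Q a).left hr
    have hl : l ≫ O.ι = (sigmaι Q a).left := IsOpenImmersion.lift_fac O.ι (sigmaι Q a).left hr
    let i : (Q a).obj ⟶ ((sigma Q).along O.ι).obj := Over.homMk l (by
      rw [← Over.w (sigmaι Q a), ← hl]
      exact (Category.assoc _ _ _).symm)
    let j : ((sigma Q).along O'.ι).obj ⟶ ((sigma Q).along O.ι).obj :=
      Over.homMk ((sigma Q).obj.left.homOfLE hO) (by simp [along])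
    have hi : IsOpenImmersion i.left :=
      have : IsOpenImmersion (l ≫ O.ι) := by rw [hl]; infer_instance
      IsOpenImmersion.of_comp l O.ι
    have hj : IsOpenImmersion j.left :=
      inferInstanceAs (IsOpenImmersion ((sigma Q).obj.left.homOfLE hO))
    refine cls_eq_add_of_isOpenImmersion i j ?_
    have hi' : ∀ x, O.ι (i.left x) = (sigmaι Q a).left x := fun x =>
      congr($hl x)
    have hj' : ∀ x, O.ι (j.left x) = O'.ι x := fun x =>
      congr($((sigma Q).obj.left.homOfLE_ι hO) x)
    ext x
    constructor
    · rintro ⟨y, rfl⟩ ⟨z, hz⟩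
      have h1 := hi' z
      rw [hz, hj'] at h1
      obtain ⟨b, hb, w, hw⟩ := (hmem _ _).mp y.2
      exact ha (sigmaι_apply_eq Q (h1.symm.trans hw.symm) ▸ hb)
    · intro hx
      obtain ⟨b, hb, w, hw⟩ := (hmem _ _).mp x.2
      rcases Finset.mem_insert.mp hb with rfl | hb
      · exact absurd ⟨w, O.ι.isOpenEmbedding.injective ((hi' w).trans hw)⟩ hx
      · exact ⟨⟨x.1, (hmem _ _).mpr ⟨b, hb, w, hw⟩⟩, O.ι.isOpenEmbedding.injective (hj' _)⟩

end

section

variable {k : Type u} [Field k]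

/-! ### Quotients by finite groups -/

section Algebra

variable {G : Type*} [Group G] [Finite G] {B K : Type*} [CommRing B] [MulSemiringAction G B]
  [CommRing K] [IsDomain K]

/-- For each element separately, two ring maps to a domain that agree on the invariants differ by
an element of the group. -/
lemma exists_apply_eq_of_eq_on_invariants (φ₁ φ₂ : B →+* K)
    (h : ∀ b, (∀ g : G, g • b = b) → φ₁ b = φ₂ b) (b : B) : ∃ g : G, φ₂ b = φ₁ (g • b) := by
  have := Fintype.ofFinite G
  have h1 : (MulSemiringAction.charpoly G b).map φ₁ = (MulSemiringAction.charpoly G b).map φ₂ := by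
    ext n
    rw [Polynomial.coeff_map, Polynomial.coeff_map]
    exact h _ fun g => MulSemiringAction.smul_coeff_charpoly b n g
  have h2 : ((MulSemiringAction.charpoly G b).map φ₁).eval (φ₂ b) = 0 := by
    rw [h1, Polynomial.eval_map_apply, MulSemiringAction.eval_charpoly, map_zero]
  rw [MulSemiringAction.charpoly_eq, Polynomial.map_prod, Polynomial.eval_prod,
    Finset.prod_eq_zero_iff] at h2
  obtain ⟨g, -, hg⟩ := h2
  refine ⟨g, ?_⟩
  simpa [sub_eq_zero] using hg

/-- Two ring maps to a domain that agree on the invariants of a finite group differ by an element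
of the group. -/
lemma exists_comp_eq_of_eq_on_invariants (φ₁ φ₂ : B →+* K)
    (h : ∀ b, (∀ g : G, g • b = b) → φ₁ b = φ₂ b) : ∃ g : G, ∀ b, φ₂ b = φ₁ (g • b) := by
  by_contra! hcon
  choose β hβ using hcon
  have := Fintype.ofFinite G
  let e := Fintype.equivFin G
  -- a polynomial that has the elements `β g` as coefficients
  let p : Polynomial B := ∑ g : G, Polynomial.monomial (e g : ℕ) (β g)
  have hp : ∀ g, p.coeff (e g) = β g := fun g => by
    simp only [p, Polynomial.finsetSum_coeff, Polynomial.coeff_monomial]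
    rw [Finset.sum_eq_single g]
    · simp
    · intro b _ hb
      rw [if_neg]
      intro h
      exact hb (e.injective (Fin.ext h))
    · simp
  obtain ⟨g, hg⟩ := exists_apply_eq_of_eq_on_invariants (G := G) (Polynomial.mapRingHom φ₁)
    (Polynomial.mapRingHom φ₂) (fun b hb => by
      ext n
      simp only [Polynomial.coe_mapRingHom, Polynomial.coeff_map]
      refine h _ fun g => ?_
      conv_rhs => rw [← hb g]
      rw [Polynomial.coeff_smul]) p
  apply hβ g
  have := congr(Polynomial.coeff $hg (e g))
  simpa [Polynomial.coeff_map, Polynomial.coeff_smul, hp] using this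

/-- A ring is integral over the invariants of a finite group. -/
lemma isIntegral_of_invariants {A : Type*} [CommRing A] (φ : A →+* B)
    (h : ∀ b, (∀ g : G, g • b = b) → b ∈ Set.range φ) : φ.IsIntegral := by
  intro b
  have := Fintype.ofFinite G
  have h1 : MulSemiringAction.charpoly G b ∈ Polynomial.lifts φ := by
    rw [Polynomial.lifts_iff_coeff_lifts]
    exact fun n => h _ fun g => MulSemiringAction.smul_coeff_charpoly b n g
  obtain ⟨p, hp, -, hpm⟩ := Polynomial.lifts_and_natDegree_eq_and_monic h1
    (MulSemiringAction.monic_charpoly G b)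
  refine ⟨p, hpm, ?_⟩
  rw [← Polynomial.eval_map, hp, MulSemiringAction.eval_charpoly]

end Algebra

/-- An action of a group on a scheme, by a family of endomorphisms. -/
structure IsAction {G : Type*} [Group G] {Z : Scheme.{u}} (α : G → (Z ⟶ Z)) : Prop where
  one : α 1 = 𝟙 Z
  mul : ∀ g h, α (g * h) = α g ≫ α h

namespace IsAction

variable {G : Type*} [Group G] {Z : Scheme.{u}} {α : G → (Z ⟶ Z)}


/-- The action on the sections over an invariant open subset. -/
abbrev mulSemiringAction (h : IsAction α) {V : Z.Opens} (hV : ∀ g, V ≤ α g ⁻¹ᵁ V) :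
    MulSemiringAction G Γ(Z, V) where
  smul g s := (α g).appLE V V (hV g) s
  one_smul s := by
    have : ∀ (f : Z ⟶ Z) (hf : f = 𝟙 Z) (e), f.appLE V V e s = s := by
      rintro _ rfl e
      have : (𝟙 Z : Z ⟶ Z).appLE V V e = 𝟙 _ :=
        (Scheme.Hom.appLE_eq_app _).trans (Scheme.Hom.id_app _)
      rw [this]; rfl
    exact this _ h.one _
  mul_smul g g' s := by
    have : ∀ (f : Z ⟶ Z) (hf : f = α g ≫ α g') (e), f.appLE V V e s =
        (α g).appLE V V (hV g) ((α g').appLE V V (hV g') s) := by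
      rintro _ rfl e
      rw [← CommRingCat.comp_apply, Scheme.Hom.appLE_comp_appLE]
    exact this _ (h.mul g g') _
  smul_zero g := map_zero _
  smul_add g := map_add _
  smul_one g := map_one _
  smul_mul g := map_mul _

end IsAction

namespace IsGroupQuotient

lemma le_preimage {G : Type*} {Z Q : Scheme.{u}} {α : G → (Z ⟶ Z)} {q : Z ⟶ Q}
    (h : IsGroupQuotient α q) (U : Q.Opens) (g : G) :
    q ⁻¹ᵁ U ≤ α g ⁻¹ᵁ (q ⁻¹ᵁ U) := by
  rw [← Scheme.Hom.comp_preimage, h.inv g]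

variable {G : Type*} [Group G] {Z Q : Scheme.{u}} {α : G → (Z ⟶ Z)} {q : Z ⟶ Q}

lemma mem_range_app_iff (h : IsGroupQuotient α q) (hα : IsAction α) (U : Q.Opens) :
    letI := hα.mulSemiringAction (h.le_preimage U)
    ∀ b : Γ(Z, q ⁻¹ᵁ U), (∀ g : G, g • b = b) ↔ b ∈ Set.range (q.app U).hom := by
  intro b
  have := h.range_eq U
  refine Iff.trans ?_ (Set.ext_iff.mp this b).symm
  exact ⟨fun hb g e => hb g, fun hb g => hb g _⟩

lemma surjective [Finite G] (h : IsGroupQuotient α q) (hα : IsAction α) : Surjective q := by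
  have := h.isAffineHom
  refine ⟨fun y => ?_⟩
  obtain ⟨_, ⟨U, hU, rfl⟩, hyU, -⟩ := Q.isBasis_affineOpens.exists_subset_of_mem_open
    (Set.mem_univ y) isOpen_univ
  have hU : IsAffineOpen U := hU
  let := hα.mulSemiringAction (h.le_preimage U)
  have h1 : (q.app U).hom.IsIntegral := isIntegral_of_invariants (G := G) _
    fun b hb => (h.mem_range_app_iff hα U b).mp hb
  have h2 := h1.comap_surjective (h.injective U)
  obtain ⟨z, hz⟩ := h2 (hU.primeIdealOf ⟨y, hyU⟩)
  refine ⟨(hU.preimage q).fromSpec z, ?_⟩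
  have h3 := congr($(IsAffineOpen.SpecMap_appLE_fromSpec q hU (hU.preimage q) le_rfl) z)
  refine (h3.symm.trans ?_).trans (hU.fromSpec_primeIdealOf ⟨y, hyU⟩)
  rw [← hz, ← Scheme.Hom.app_eq_appLE]
  rfl

/-- The fibres of a quotient morphism on field-valued points are the orbits of the group. -/
lemma comp_eq_comp_iff [Finite G] (h : IsGroupQuotient α q) (hα : IsAction α) {K : Type u} [Field K]
    (v w : Spec (CommRingCat.of K) ⟶ Z) : v ≫ q = w ≫ q ↔ ∃ g, w = v ≫ α g := by
  refine ⟨fun hvw => ?_, ?_⟩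
  swap
  · rintro ⟨g, rfl⟩
    rw [Category.assoc, h.inv]
  have := h.isAffineHom
  obtain ⟨_, ⟨U, hU, rfl⟩, hyU, -⟩ := Q.isBasis_affineOpens.exists_subset_of_mem_open
    (Set.mem_univ ((v ≫ q) (IsLocalRing.closedPoint K))) isOpen_univ
  have hU : IsAffineOpen U := hU
  let := hα.mulSemiringAction (h.le_preimage U)
  have hV : IsAffineOpen (q ⁻¹ᵁ U) := hU.preimage q
  have hlift : ∀ v : Spec (CommRingCat.of K) ⟶ Z, (v ≫ q) (IsLocalRing.closedPoint K) ∈ U →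
      ∃ φ : Γ(Z, q ⁻¹ᵁ U) →+* K, v = Spec.map (CommRingCat.ofHom φ) ≫ hV.fromSpec := by
    intro v hv
    obtain ⟨v', hv'⟩ := exists_field_lift hV.fromSpec v (by rw [hV.range_fromSpec]; exact hv)
    obtain ⟨φ, rfl⟩ := Spec.map_surjective v'
    exact ⟨φ.hom, hv'.symm⟩
  obtain ⟨φ₁, rfl⟩ := hlift v hyU
  obtain ⟨φ₂, rfl⟩ := hlift w (hvw ▸ hyU)
  have key : ∀ φ : Γ(Z, q ⁻¹ᵁ U) →+* K, (Spec.map (CommRingCat.ofHom φ) ≫ hV.fromSpec) ≫ q =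
      Spec.map (CommRingCat.ofHom (φ.comp (q.app U).hom)) ≫ hU.fromSpec := by
    intro φ
    rw [Category.assoc, ← IsAffineOpen.SpecMap_appLE_fromSpec q hU hV le_rfl,
      ← Spec.map_comp_assoc, ← Scheme.Hom.app_eq_appLE]
    rfl
  rw [key, key, cancel_mono] at hvw
  have h1 : φ₁.comp (q.app U).hom = φ₂.comp (q.app U).hom :=
    congr($(Spec.map_injective hvw).hom)
  obtain ⟨g, hg⟩ := exists_comp_eq_of_eq_on_invariants (G := G) φ₁ φ₂ (fun b hb => by
    obtain ⟨a, rfl⟩ := (h.mem_range_app_iff hα U b).mp hb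
    exact congr($h1 a))
  refine ⟨g, ?_⟩
  rw [Category.assoc, ← IsAffineOpen.SpecMap_appLE_fromSpec (α g) hV hV (h.le_preimage U g),
    ← Spec.map_comp_assoc]
  congr 2
  ext b
  exact hg b

end IsGroupQuotient

end

section

variable {k : Type u} [Field k]

/-! ### Existence of quotients of affine schemes -/

/-- Invariants of a finite set of endomorphisms commute with localization at an invariant
element. -/
lemma invariants_localization {G A B A' B' : Type*} [Finite G] [CommRing A] [CommRing B]
    [CommRing A'] [CommRing B'] (φ : A →+* B) (φ' : A' →+* B') (ρ : A →+* A') (ρ' : B →+* B')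
    (a : G → B →+* B) (a' : G → B' →+* B') (f : A)
    (hφ : ∀ x, φ' (ρ x) = ρ' (φ x)) (ha : ∀ g x, a' g (ρ' x) = ρ' (a g x))
    (hinv : ∀ g x, a g (φ x) = φ x) (hφinj : Function.Injective φ)
    (hφrange : ∀ b, (∀ g, a g b = b) → b ∈ Set.range φ) (hu : IsUnit (ρ f))
    (hsurj : ∀ s, ∃ (n : ℕ) (x : A), s * ρ f ^ n = ρ x)
    (hsurj' : ∀ s, ∃ (n : ℕ) (x : B), s * ρ' (φ f) ^ n = ρ' x)
    (hker' : ∀ x, ρ' x = 0 → ∃ n : ℕ, φ f ^ n * x = 0) :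
    Function.Injective φ' ∧ ∀ b, (∀ g, a' g b = b) → b ∈ Set.range φ' := by
  refine ⟨(injective_iff_map_eq_zero _).mpr fun s hs => ?_, fun b hb => ?_⟩
  · obtain ⟨n, x, hx⟩ := hsurj s
    have h1 : ρ' (φ x) = 0 := by rw [← hφ, ← hx, map_mul, hs, zero_mul]
    obtain ⟨m, hm⟩ := hker' _ h1
    have h2 : f ^ m * x = 0 := hφinj (by rw [map_mul, map_pow, hm, map_zero])
    have h3 : ρ f ^ m * (s * ρ f ^ n) = 0 := by rw [hx, ← map_pow, ← map_mul, h2, map_zero]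
    rwa [(hu.pow m).mul_right_eq_zero, (hu.pow n).mul_left_eq_zero] at h3
  · obtain ⟨n, x, hx⟩ := hsurj' b
    have h1 : ∀ g, ρ' (a g x - x) = 0 := fun g => by
      rw [map_sub, ← ha, ← hx, map_mul, hb, map_pow, ha, hinv, sub_self]
    choose m hm using fun g => hker' _ (h1 g)
    have := Fintype.ofFinite G
    set N := ∑ g, m g
    have h2 : ∀ g, a g (φ f ^ N * x) = φ f ^ N * x := fun g => by
      have hle : m g ≤ N := Finset.single_le_sum (fun _ _ => Nat.zero_le _) (Finset.mem_univ g)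
      rw [map_mul, map_pow, hinv, ← sub_eq_zero, ← mul_sub, ← Nat.sub_add_cancel hle, pow_add,
        mul_assoc, hm, mul_zero]
    obtain ⟨y, hy⟩ := hφrange _ h2
    obtain ⟨v, hv⟩ := (hu.pow (N + n)).exists_right_inv
    refine ⟨ρ y * v, ?_⟩
    have h4 : φ' (ρ f) ^ (N + n) * φ' v = 1 := by rw [← map_pow, ← map_mul, hv, map_one]
    rw [map_mul, hφ, hy, map_mul, ← hx, map_pow, ← hφ]
    linear_combination b * h4

/-- Restriction to a basic open subset of an affine scheme is a localization, in the form in which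
`invariants_localization` uses it. -/
lemma isLocalization_facts (X : Scheme.{u}) [IsAffine X] (f : Γ(X, ⊤)) (V : X.Opens)
    (hV : V = X.basicOpen f) :
    IsUnit ((X.presheaf.map (homOfLE (le_top : V ≤ ⊤)).op).hom f) ∧
    (∀ s, ∃ (n : ℕ) (x : Γ(X, ⊤)), s * (X.presheaf.map (homOfLE (le_top : V ≤ ⊤)).op).hom f ^ n =
      (X.presheaf.map (homOfLE (le_top : V ≤ ⊤)).op).hom x) ∧
    ∀ x, (X.presheaf.map (homOfLE (le_top : V ≤ ⊤)).op).hom x = 0 → ∃ n : ℕ, f ^ n * x = 0 := by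
  let := (X.presheaf.map (homOfLE (le_top : V ≤ ⊤)).op).hom.toAlgebra
  have := (isAffineOpen_top X).isLocalization_of_eq_basicOpen f (homOfLE (le_top : V ≤ ⊤)) hV
  refine ⟨IsLocalization.Away.algebraMap_isUnit f, IsLocalization.Away.surj f, fun x hx => ?_⟩
  obtain ⟨⟨_, n, rfl⟩, h⟩ := (IsLocalization.map_eq_zero_iff (Submonoid.powers f) Γ(X, V) x).mp hx
  exact ⟨n, h⟩

/-- A morphism of affine schemes is a quotient by a finite group if it is so on global
sections. -/
lemma IsGroupQuotient.of_isAffine {G : Type*} [Finite G] {Z Q : Scheme.{u}} [IsAffine Z]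
    [IsAffine Q] {α : G → (Z ⟶ Z)} {q : Z ⟶ Q} (hinv : ∀ g, α g ≫ q = q)
    (hinj : Function.Injective q.appTop)
    (hrange : ∀ b, (∀ g, (α g).appTop b = b) → b ∈ Set.range q.appTop) :
    IsGroupQuotient α q := by
  have hle : ∀ (U : Q.Opens) (g : G), q ⁻¹ᵁ U ≤ α g ⁻¹ᵁ (q ⁻¹ᵁ U) := fun U g => by
    rw [← Scheme.Hom.comp_preimage, hinv g]
  -- the restriction maps are equivariant
  have hres : ∀ {U V : Q.Opens} (i : V ≤ U) (g : G) (s : Γ(Z, q ⁻¹ᵁ U)),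
      (α g).appLE _ _ (hle V g) (Z.presheaf.map (homOfLE (q.preimage_mono i)).op s) =
      Z.presheaf.map (homOfLE (q.preimage_mono i)).op ((α g).appLE _ _ (hle U g) s) := by
    intro U V i g s
    rw [← CommRingCat.comp_apply, ← CommRingCat.comp_apply, Scheme.Hom.map_appLE,
      Scheme.Hom.appLE_map]
  have hnat : ∀ {U V : Q.Opens} (i : V ≤ U) (s : Γ(Q, U)),
      q.app V (Q.presheaf.map (homOfLE i).op s) =
      Z.presheaf.map (homOfLE (q.preimage_mono i)).op (q.app U s) := by
    intro U V i s
    rw [← CommRingCat.comp_apply, ← CommRingCat.comp_apply, q.naturality]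
    rfl
  have hinv' : ∀ (U : Q.Opens) (g : G) (s : Γ(Q, U)),
      (α g).appLE _ _ (hle U g) (q.app U s) = q.app U s := by
    intro U g s
    rw [← CommRingCat.comp_apply, q.app_eq_appLE, Scheme.Hom.appLE_comp_appLE]
    have : ∀ (f : Z ⟶ Q) (hf : f = q) (e), f.appLE U (q ⁻¹ᵁ U) e s = q.appLE U (q ⁻¹ᵁ U) le_rfl s := by
      rintro _ rfl e; rfl
    exact this _ (hinv g) _
  have hbasic : ∀ f : Γ(Q, ⊤), Function.Injective (q.app (Q.basicOpen f)) ∧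
      ∀ b : Γ(Z, q ⁻¹ᵁ Q.basicOpen f), (∀ g, (α g).appLE _ _ (hle _ g) b = b) →
        b ∈ Set.range (q.app (Q.basicOpen f)) := by
    intro f
    obtain ⟨h1, h2, -⟩ := isLocalization_facts Q f _ rfl
    obtain ⟨-, h2', h3'⟩ := isLocalization_facts Z (q.appTop f) _ (q.preimage_basicOpen_top f)
    exact invariants_localization (G := G) q.appTop.hom (q.app (Q.basicOpen f)).hom
      (Q.presheaf.map (homOfLE le_top).op).hom (Z.presheaf.map (homOfLE le_top).op).hom
      (fun g => ((α g).appLE _ _ (hle ⊤ g)).hom) (fun g => ((α g).appLE _ _ (hle _ g)).hom) f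
      (hnat le_top) (hres le_top) (hinv' ⊤) hinj (fun b hb => hrange b fun g =>
        congr($(Scheme.Hom.app_eq_appLE (α g) (U := ⊤)) b).trans (hb g)) h1 h2 h2' h3'
  have hcov : ∀ U : Q.Opens, ∃ B : Set Γ(Q, ⊤), (∀ f : B, Q.basicOpen f.1 ≤ U) ∧
      U ≤ ⨆ f : B, Q.basicOpen f.1 := by
    intro U
    refine ⟨{f | Q.basicOpen f ≤ U}, fun f => f.2, fun y hy => ?_⟩
    obtain ⟨_, ⟨_, ⟨f, rfl⟩, rfl⟩, hyf, hfU⟩ :=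
      (isBasis_basicOpen Q).exists_subset_of_mem_open hy U.2
    exact TopologicalSpace.Opens.mem_iSup.mpr ⟨⟨f, hfU⟩, hyf⟩
  have hcov' : ∀ (U : Q.Opens) (B : Set Γ(Q, ⊤)), U ≤ ⨆ f : B, Q.basicOpen f.1 →
      q ⁻¹ᵁ U ≤ ⨆ f : B, q ⁻¹ᵁ Q.basicOpen f.1 := by
    intro U B hB x hx
    obtain ⟨f, hf⟩ := TopologicalSpace.Opens.mem_iSup.mp (hB hx)
    exact TopologicalSpace.Opens.mem_iSup.mpr ⟨f, hf⟩
  have hinjU : ∀ U : Q.Opens, Function.Injective (q.app U) := by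
    intro U s t hst
    obtain ⟨B, hBU, hB⟩ := hcov U
    refine Q.sheaf.eq_of_locally_eq' (fun f : B => Q.basicOpen f.1) U (fun f => homOfLE (hBU f))
      hB s t fun f => (hbasic f.1).1 ?_
    exact (hnat (hBU f) s).trans (congr_arg _ hst |>.trans (hnat (hBU f) t).symm)
  refine ⟨inferInstance, hinv, hinjU, fun U => ?_⟩
  ext b
  constructor
  · rintro ⟨s, rfl⟩ g e
    exact hinv' U g s
  · intro hb
    obtain ⟨B, hBU, hB⟩ := hcov U
    have hloc : ∀ f : B, ∃ t, q.app (Q.basicOpen f.1) t =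
        Z.presheaf.map (homOfLE (q.preimage_mono (hBU f))).op b := fun f =>
      (hbasic f.1).2 _ fun g => by rw [hres (hBU f), hb g]
    choose t ht using hloc
    obtain ⟨s, hs, -⟩ := Q.sheaf.existsUnique_gluing' (fun f : B => Q.basicOpen f.1) U
      (fun f => homOfLE (hBU f)) hB t (by
        intro f f'
        apply hinjU
        refine (hnat (inf_le_left : Q.basicOpen f.1 ⊓ Q.basicOpen f'.1 ≤ _) (t f)).trans
          (Eq.trans ?_ (hnat (inf_le_right : Q.basicOpen f.1 ⊓ Q.basicOpen f'.1 ≤ _) (t f')).symm)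
        rw [ht, ht, ← CommRingCat.comp_apply, ← CommRingCat.comp_apply, ← Functor.map_comp,
          ← Functor.map_comp]
        rfl)
    refine ⟨s, Z.sheaf.eq_of_locally_eq' (fun f : B => q ⁻¹ᵁ Q.basicOpen f.1) (q ⁻¹ᵁ U)
      (fun f => homOfLE (q.preimage_mono (hBU f))) (hcov' U B hB) _ _ fun f => ?_⟩
    exact (hnat (hBU f) s).symm.trans ((congr_arg _ (hs f)).trans (ht f))

end

section

variable {k : Type u} [Field k]

/-! ### Quotients of affine schemes of finite type -/

/-- The invariants of a finite group acting on an algebra of finite type over a field form an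
algebra of finite type (Artin–Tate). -/
lemma finiteType_of_invariants {F B : Type*} [Field F] [CommRing B] {G : Type*} [Group G]
    [Finite G] [MulSemiringAction G B] (κ : F →+* B) (hκ : κ.FiniteType) (A : Subring B)
    (hA : ∀ b, b ∈ A ↔ ∀ g : G, g • b = b) (κ' : F →+* A) (h : A.subtype.comp κ' = κ) :
    κ'.FiniteType := by
  algebraize [κ, κ']
  have : IsScalarTower F A B := IsScalarTower.of_algebraMap_eq' h.symm
  have h1 : A.subtype.IsIntegral := isIntegral_of_invariants (G := G) _ fun b hb =>
    ⟨⟨b, (hA b).mpr hb⟩, rfl⟩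
  have : Algebra.IsIntegral A B := ⟨h1⟩
  have : Algebra.FiniteType A B := Algebra.FiniteType.of_restrictScalars_finiteType F A B
  have : Module.Finite A B := Algebra.IsIntegral.finite
  exact ⟨fg_of_fg_of_fg F A B (Algebra.FiniteType.out) Module.Finite.fg_top
    Subtype.val_injective⟩

/-- An affine scheme of finite type has a quotient by a finite group, and it is of finite type. -/
lemma exists_isGroupQuotient {G : Type} [Group G] [Finite G] (Z : FTScheme k)
    [IsAffine Z.obj.left] (α : G → (Z.obj ⟶ Z.obj)) (hα : IsAction fun g => (α g).left) :
    ∃ (Q : FTScheme k) (q : Z.obj ⟶ Q.obj), IsGroupQuotient (fun g => (α g).left) q.left := by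
  let B := Γ(Z.obj.left, ⊤)
  let : MulSemiringAction G B := hα.mulSemiringAction (V := ⊤) fun g => le_top
  have hsmul : ∀ (g : G) (b : B), g • b = (α g).left.appTop b := fun g b =>
    congr($((Scheme.Hom.app_eq_appLE (α g).left (U := ⊤)).symm) b)
  let A : Subring B :=
    { carrier := {b | ∀ g : G, g • b = b}
      zero_mem' := fun g => smul_zero g
      one_mem' := fun g => smul_one g
      add_mem' := fun {a b} ha hb g => by rw [smul_add, ha, hb]
      neg_mem' := fun {a} ha g => by rw [smul_neg, ha]
      mul_mem' := fun {a b} ha hb g => by rw [smul_mul', ha, hb] }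
  have hA : ∀ b, b ∈ A ↔ ∀ g : G, g • b = b := fun b => Iff.rfl
  let s : Z.obj.left ⟶ Spec (CommRingCat.of k) := Z.obj.hom
  have hs : ∀ g, (α g).left ≫ s = s := fun g => Over.w (α g)
  have hsft : LocallyOfFiniteType s := Z.locallyOfFiniteType
  let κ : CommRingCat.of k ⟶ CommRingCat.of B := (Scheme.ΓSpecIso (CommRingCat.of k)).inv ≫ s.appTop
  have hκ : κ.hom.FiniteType := by
    have h1 : s.appTop.hom.FiniteType := by
      have := s.finiteType_appLE (isAffineOpen_top _) (isAffineOpen_top Z.obj.left) le_top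
      rwa [← show s.app ⊤ = s.appLE ⊤ ⊤ le_top from s.app_eq_appLE] at this
    exact h1.comp (RingHom.FiniteType.of_surjective _
      (ConcreteCategory.bijective_of_isIso (Scheme.ΓSpecIso (CommRingCat.of k)).inv).2)
  have hκA : ∀ x, κ x ∈ A := fun x g => by
    rw [hsmul]
    have : s.appTop ≫ (α g).left.appTop = s.appTop := by
      rw [← Scheme.Hom.comp_appTop, hs]
    exact congr($this ((Scheme.ΓSpecIso (CommRingCat.of k)).inv x))
  let κ' : k →+* A := κ.hom.codRestrict A hκA
  have hκ' : κ'.FiniteType := finiteType_of_invariants (G := G) κ.hom hκ A hA κ' rfl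
  let ι : CommRingCat.of A ⟶ Γ(Z.obj.left, ⊤) := CommRingCat.ofHom A.subtype
  let q : Z.obj.left ⟶ Spec (CommRingCat.of A) := Z.obj.left.toSpecΓ ≫ Spec.map ι
  have hq : q.appTop = (Scheme.ΓSpecIso _).hom ≫ ι := by
    simp only [q, Scheme.Hom.comp_appTop, Scheme.toSpecΓ_appTop]
    exact Scheme.ΓSpecIso_naturality ι
  let Q : FTScheme k :=
    { obj := Over.mk (Spec.map (CommRingCat.ofHom κ'))
      locallyOfFiniteType := by
        have : LocallyOfFiniteType (Spec.map (CommRingCat.ofHom κ')) := by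
          rw [HasRingHomProperty.Spec_iff (P := @LocallyOfFiniteType)]
          exact hκ'
        exact this
      quasiCompact := inferInstanceAs (QuasiCompact (Spec.map (CommRingCat.ofHom κ'))) }
  refine ⟨Q, Over.homMk q ?_, ?_⟩
  · have h1 : q ≫ Spec.map (CommRingCat.ofHom κ') = s := by
      simp only [q, Category.assoc]
      rw [← Spec.map_comp]
      have : CommRingCat.ofHom κ' ≫ ι = κ := rfl
      rw [this]
      simp only [κ]
      rw [Spec.map_comp, ← Scheme.toSpecΓ_naturality_assoc, toSpecΓ_SpecMap_ΓSpecIso_inv,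
        Category.comp_id]
    exact h1
  · have hQ : IsAffine Q.obj.left := inferInstanceAs (IsAffine (Spec (CommRingCat.of A)))
    have hbij := ConcreteCategory.bijective_of_isIso (Scheme.ΓSpecIso (CommRingCat.of A)).hom
    refine IsGroupQuotient.of_isAffine (q := q) (fun g => ?_) ?_ fun b hb => ?_
    · have : ι ≫ (α g).left.appTop = ι := by
        ext a
        exact (hsmul g a.1).symm.trans (a.2 g)
      simp only [q]
      rw [Scheme.toSpecΓ_naturality_assoc, ← Spec.map_comp, this]
    · rw [hq]
      exact (Subtype.val_injective : Function.Injective (A.subtype)).comp hbij.1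
    · rw [hq]
      obtain ⟨a, ha⟩ := hbij.2 ⟨b, fun g => (hsmul g b).trans (hb g)⟩
      exact ⟨a, congr_arg Subtype.val ha⟩

end

section

variable {k : Type u} [Field k]

/-! ### Invariant affine open and closed subschemes -/

lemma scheme_isSeparated {Y : Scheme.{u}} (f : Y ⟶ Spec (CommRingCat.of k)) [IsSeparated f] :
    Y.IsSeparated := by
  constructor
  rw [← terminal.comp_from f]
  infer_instance

lemma IsAction.isIso {G : Type*} [Group G] {Z : Scheme.{u}} {α : G → (Z ⟶ Z)} (h : IsAction α)
    (g : G) : IsIso (α g) :=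
  ⟨α g⁻¹, by rw [← h.mul, mul_inv_cancel, h.one], by rw [← h.mul, inv_mul_cancel, h.one]⟩

/-- A finite group acting on a separated scheme has an invariant affine open subset in each
nonempty invariant open subset. Among the intersections of translates of an affine open subset, a
minimal nonempty one has translates that are equal or disjoint, so their union is affine. -/
lemma IsAction.exists_isAffineOpen {G : Type} [Group G] [Finite G] {Y : Scheme.{u}}
    [Y.IsSeparated] {β : G → (Y ⟶ Y)} (h : IsAction β) (U : Y.Opens) (hU : ∀ g, U ≤ β g ⁻¹ᵁ U)
    (hne : (U : Set Y).Nonempty) :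
    ∃ W ≤ U, IsAffineOpen W ∧ (W : Set Y).Nonempty ∧ ∀ g, W ≤ β g ⁻¹ᵁ W := by
  classical
  have := Fintype.ofFinite G
  obtain ⟨y, hy⟩ := hne
  obtain ⟨_, ⟨V, hV, rfl⟩, hyV, hVU⟩ :=
    Y.isBasis_affineOpens.exists_subset_of_mem_open hy U.2
  have hV : IsAffineOpen V := hV
  have hVU : V ≤ U := hVU
  -- the intersections of translates
  let D : Finset G → Y.Opens := fun A => A.inf fun g => β g ⁻¹ᵁ V
  have hmemD : ∀ A x, x ∈ D A ↔ ∀ g ∈ A, β g x ∈ V := by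
    intro A x
    have h2 : x ∈ D A ↔ x ∈ (D A : Set Y) := Iff.rfl
    rw [h2, TopologicalSpace.Opens.coe_finset_inf, Finset.inf_set_eq_iInter]
    simp only [Set.mem_iInter]
    rfl
  have hmul : ∀ g h' x, β (g * h') x = β h' (β g x) := fun g h' x => by rw [h.mul]; rfl
  have hone : ∀ x, β 1 x = x := fun x => by rw [h.one]; rfl
  obtain ⟨A, hA, hmax⟩ := Finset.exists_max_image (Finset.univ.filter fun A : Finset G =>
    (D A : Set Y).Nonempty ∧ A.Nonempty) Finset.card ⟨{1}, Finset.mem_filter.mpr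
      ⟨Finset.mem_univ _, ⟨y, (hmemD _ _).mpr (by simpa [hone] using hyV)⟩, by simp⟩⟩
  obtain ⟨-, hA, hA1⟩ := Finset.mem_filter.mp hA
  have hDaff : ∀ B : Finset G, B.Nonempty → IsAffineOpen (D B) := fun B hB => by
    simp only [D, Finset.inf_eq_iInf]
    refine IsAffineOpen.biInf (B : Set G) B.finite_toSet hB fun g _ => ?_
    have := h.isIso g
    exact hV.preimage (β g)
  let τ : G → Y.Opens := fun g => D (A.image (g * ·))
  have hτ : ∀ g x, x ∈ τ g ↔ β g x ∈ D A := by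
    intro g x
    simp only [τ, hmemD, Finset.mem_image, forall_exists_index, and_imp,
      forall_apply_eq_imp_iff₂, hmul]
  have hdisj : ∀ g g', τ g ≠ τ g' → Disjoint (τ g) (τ g') := by
    intro g g' hne
    rw [← TopologicalSpace.Opens.coe_disjoint]
    by_contra hnd
    apply hne
    obtain ⟨x, hx, hx'⟩ := Set.not_disjoint_iff.mp hnd
    have hx : β g x ∈ D A := (hτ g x).mp hx
    have hx' : β g' x ∈ D A := (hτ g' x).mp hx'
    -- the translates of `A` agree by maximality
    have key : ∀ g g' x, β g x ∈ D A → β g' x ∈ D A → A.image (g⁻¹ * g' * ·) ⊆ A := by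
      intro g g' x hx hx'
      have h1 : β g x ∈ D (A ∪ A.image (g⁻¹ * g' * ·)) := by
        rw [hmemD] at hx hx' ⊢
        intro a ha
        rcases Finset.mem_union.mp ha with ha | ha
        · exact hx a ha
        · obtain ⟨b, hb, rfl⟩ := Finset.mem_image.mp ha
          rw [← hmul, mul_assoc, mul_inv_cancel_left, hmul]
          exact hx' b hb
      have h2 := hmax (A ∪ A.image (g⁻¹ * g' * ·)) (Finset.mem_filter.mpr
        ⟨Finset.mem_univ _, ⟨_, h1⟩, hA1.mono Finset.subset_union_left⟩)
      have h3 := Finset.eq_of_subset_of_card_le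
        (Finset.subset_union_left : A ⊆ A ∪ A.image (g⁻¹ * g' * ·)) h2
      exact Finset.subset_union_right.trans h3.ge
    have h3 : A.image (g * ·) = A.image (g' * ·) := by
      ext a
      simp only [Finset.mem_image]
      constructor
      · rintro ⟨b, hb, rfl⟩
        exact ⟨g'⁻¹ * g * b, key g' g x hx' hx (Finset.mem_image_of_mem _ hb), by group⟩
      · rintro ⟨b, hb, rfl⟩
        exact ⟨g⁻¹ * g' * b, key g g' x hx hx' (Finset.mem_image_of_mem _ hb), by group⟩
    simp only [τ, h3]
  let W : Y.Opens := ⨆ T : Set.range τ, T.1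
  have hW : ∀ x, x ∈ W ↔ ∃ g, β g x ∈ D A := by
    intro x
    simp only [W, TopologicalSpace.Opens.mem_iSup, Subtype.exists, Set.mem_range, ← hτ]
    constructor
    · rintro ⟨_, ⟨g, rfl⟩, hx⟩; exact ⟨g, hx⟩
    · rintro ⟨g, hx⟩; exact ⟨_, ⟨g, rfl⟩, hx⟩
  have hUmem : ∀ g x, β g x ∈ U → x ∈ U := fun g x hx => by
    have h1 : β g⁻¹ (β g x) ∈ U := hU g⁻¹ hx
    rwa [← hmul, mul_inv_cancel, hone] at h1
  refine ⟨W, ?_, ?_, ?_, ?_⟩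
  · intro x hx
    obtain ⟨g, hg⟩ := (hW x).mp hx
    obtain ⟨a, ha⟩ := hA1
    exact hUmem g x (hUmem a _ (hVU ((hmemD _ _).mp hg a ha)))
  · refine IsAffineOpen.iSup_of_disjoint ?_ ?_
    · rintro ⟨_, g, rfl⟩
      exact hDaff _ (hA1.image _)
    · rintro ⟨_, g, rfl⟩ ⟨_, g', rfl⟩ hne
      exact hdisj g g' fun h => hne (Subtype.ext h)
  · obtain ⟨x, hx⟩ := hA
    exact ⟨x, (hW x).mpr ⟨1, by rwa [hone]⟩⟩
  · intro g x hx
    obtain ⟨g', hg'⟩ := (hW x).mp hx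
    refine (hW _).mpr ⟨g⁻¹ * g', ?_⟩
    rwa [← hmul, mul_inv_cancel_left]

/-- An action on a scheme over `k` restricts to each closed subset that it preserves, with its
reduced structure. -/
lemma exists_action_of_isClosed {G : Type} [Group G] (P : FTScheme k) (α : G → (P.obj ⟶ P.obj))
    (hα : IsAction fun g => (α g).left) {C : Set P.obj.left} (hC : IsClosed C)
    (hstab : ∀ g, ∀ x ∈ C, (α g).left x ∈ C) :
    ∃ (Y : FTScheme k) (ι : Y.obj ⟶ P.obj) (β : G → (Y.obj ⟶ Y.obj)), IsClosedImmersion ι.left ∧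
      Set.range ι.left = C ∧ (∀ g, β g ≫ ι = ι ≫ α g) ∧ IsAction fun g => (β g).left := by
  let I := Scheme.IdealSheafData.vanishingIdeal (⟨C, hC⟩ : TopologicalSpace.Closeds P.obj.left)
  have hr : Set.range I.subschemeι = C := by
    rw [Scheme.IdealSheafData.range_subschemeι]; simp [I]
  have himg : ∀ g, (α g).left '' C = C := fun g => by
    refine Set.Subset.antisymm ?_ fun x hx => ⟨(α g⁻¹).left x, hstab _ _ hx, ?_⟩
    · rintro _ ⟨x, hx, rfl⟩; exact hstab g x hx
    · have h1 : (α (g⁻¹ * g)).left x = (α g).left ((α g⁻¹).left x) :=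
        congr($(hα.mul g⁻¹ g) x)
      rw [← h1, inv_mul_cancel]
      exact congr($(hα.one) x)
  have hker : ∀ g, I.subschemeι.ker ≤ (I.subschemeι ≫ (α g).left).ker := fun g => by
    rw [Scheme.IdealSheafData.ker_subschemeι]
    change I ≤ I.map (α g).left
    rw [Scheme.IdealSheafData.map_vanishingIdeal]
    refine le_of_eq (congr_arg Scheme.IdealSheafData.vanishingIdeal
      (show (⟨C, hC⟩ : TopologicalSpace.Closeds _) = _ from TopologicalSpace.Closeds.ext ?_))
    change C = closure ((α g).left '' C)
    rw [himg, hC.closure_eq]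
  let b : G → (I.subscheme ⟶ I.subscheme) := fun g => IsClosedImmersion.lift _ _ (hker g)
  have hb : ∀ g, b g ≫ I.subschemeι = I.subschemeι ≫ (α g).left := fun g =>
    IsClosedImmersion.lift_fac _ _ (hker g)
  refine ⟨P.along I.subschemeι, P.alongHom I.subschemeι, fun g => Over.homMk (b g) ?_,
    inferInstanceAs (IsClosedImmersion I.subschemeι), hr, fun g => ?_, ?_, fun g h => ?_⟩
  · change b g ≫ I.subschemeι ≫ P.obj.hom = I.subschemeι ≫ P.obj.hom
    rw [← Category.assoc, hb, Category.assoc, Over.w]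
  · ext1; exact hb g
  · change b 1 = 𝟙 _
    rw [← cancel_mono I.subschemeι, hb, hα.one, Category.comp_id, Category.id_comp]
  · change b (g * h) = b g ≫ b h
    rw [← cancel_mono I.subschemeι, hb, Category.assoc, hb, hα.mul]
    rw [← Category.assoc (b g), hb, Category.assoc]

end

section

variable {k : Type u} [Field k]

/-! ### Piecewise quotients of powers -/

lemma FTScheme.noetherianSpace (X : FTScheme k) : TopologicalSpace.NoetherianSpace X.obj.left :=
  inferInstance

/-- The trivial scheme over `k`. -/
def FTScheme.point (k : Type u) [Field k] : FTScheme k where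
  obj := Over.mk (𝟙 _)
  locallyOfFiniteType := inferInstanceAs (LocallyOfFiniteType (𝟙 (Spec (CommRingCat.of k))))
  quasiCompact := inferInstanceAs (QuasiCompact (𝟙 (Spec (CommRingCat.of k))))

instance FTScheme.isSeparated_prod (X Y : FTScheme k) [IsSeparated X.obj.hom]
    [IsSeparated Y.obj.hom] : IsSeparated (X.prod Y).obj.hom :=
  inferInstanceAs (IsSeparated (pullback.fst X.obj.hom Y.obj.hom ≫ X.obj.hom))

/-- Finite powers of separated schemes of finite type exist as separated schemes of finite
type. -/
lemma exists_power (X : FTScheme k) [IsSeparated X.obj.hom] (I : Type) [Finite I] :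
    ∃ (P : FTScheme k) (_ : IsSeparated P.obj.hom) (p : I → (P.obj ⟶ X.obj)),
      ∀ (T : Over (Spec (CommRingCat.of k))) (f : I → (T ⟶ X.obj)), ∃! g, ∀ i, g ≫ p i = f i := by
  induction I using Finite.induction_empty_option with
  | of_equiv e h =>
    obtain ⟨P, hP, p, h⟩ := h
    refine ⟨P, hP, fun i => p (e.symm i), fun T f => ?_⟩
    obtain ⟨g, hg, hg'⟩ := h T fun i => f (e i)
    refine ⟨g, fun i => by simp [hg], fun g' hg'' => hg' _ fun i => ?_⟩
    simpa using hg'' (e i)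
  | h_empty =>
    refine ⟨FTScheme.point k, inferInstanceAs (IsSeparated (𝟙 (Spec (CommRingCat.of k)))),
      fun i => i.elim, fun T f => ⟨Over.homMk T.hom (Category.comp_id _), fun i => i.elim,
        fun g _ => ?_⟩⟩
    ext1
    have := Over.w g
    exact (Category.comp_id _).symm.trans this
  | h_option h =>
    obtain ⟨P, hP, p, h⟩ := h
    refine ⟨X.prod P, inferInstance,
      fun i => i.elim (X.fst P) fun i => X.snd P ≫ p i, fun T f => ?_⟩
    obtain ⟨g, hg, hg'⟩ := h T fun i => f (some i)
    refine ⟨FTScheme.lift (f none) g, ?_, fun g' hg'' => ?_⟩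
    · rintro (_ | i)
      · simp
      · simp [← Category.assoc, hg]
    · refine FTScheme.prod_hom_ext ?_ ?_
      · simpa using hg'' none
      · simp only [FTScheme.lift_snd]
        refine hg' _ fun i => ?_
        simpa using hg'' (some i)

/-- The power of a separated scheme of finite type as a scheme of finite type. -/
lemma power_finiteType (X : FTScheme k) [IsSeparated X.obj.hom] (I : Type) [Finite I] :
    LocallyOfFiniteType (power X.obj I).hom ∧ QuasiCompact (power X.obj I).hom ∧
      IsSeparated (power X.obj I).hom := by
  obtain ⟨P, hP, p, h⟩ := exists_power X I
  obtain ⟨g, hg, -⟩ := h (power X.obj I) fun i => Pi.π _ i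
  let g' : P.obj ⟶ power X.obj I := Pi.lift p
  have h1 : g' ≫ g = 𝟙 _ := (h P.obj p).unique (fun i => by simp [g', hg]) (fun i => by simp)
  have h2 : g ≫ g' = 𝟙 _ := Pi.hom_ext _ _ fun i => by simp [g', hg]
  let e : power X.obj I ≅ P.obj := ⟨g, g', h2, h1⟩
  have he : IsIso g.left := inferInstanceAs (IsIso ((Over.forget _).mapIso e).hom)
  rw [← Over.w g]
  exact ⟨inferInstance, inferInstance, inferInstance⟩

/-- `power X I` as a scheme of finite type. -/
abbrev powerFT (X : FTScheme k) [IsSeparated X.obj.hom] (I : Type) [Finite I] : FTScheme k where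
  obj := power X.obj I
  locallyOfFiniteType := (power_finiteType X I).1
  quasiCompact := (power_finiteType X I).2.1

lemma permMap_π (X : Over (Spec (CommRingCat.of k))) (I : Type) [Finite I] (σ : Equiv.Perm I)
    (i : I) : permMap X I σ ≫ Pi.π (fun _ : I => X) i = Pi.π (fun _ : I => X) (σ i) := by
  simp [permMap]

lemma permMap_one (X : Over (Spec (CommRingCat.of k))) (I : Type) [Finite I] :
    permMap X I 1 = 𝟙 _ :=
  Pi.hom_ext _ _ fun i => by simp [permMap_π]

lemma permMap_mul (X : Over (Spec (CommRingCat.of k))) (I : Type) [Finite I]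
    (σ τ : Equiv.Perm I) : permMap X I (σ * τ) = permMap X I σ ≫ permMap X I τ :=
  Pi.hom_ext _ _ fun i => by simp [permMap_π]

lemma isAction_permMap (X : Over (Spec (CommRingCat.of k))) (I : Type) [Finite I]
    (G : Subgroup (Equiv.Perm I)) : IsAction fun σ : G => (permMap X I σ).left where
  one := by rw [OneMemClass.coe_one, permMap_one]; rfl
  mul σ τ := by rw [Subgroup.coe_mul, permMap_mul]; rfl

namespace QuotientStratum

variable {X : Over (Spec (CommRingCat.of k))} {I : Type} [Finite I] {G : Subgroup (Equiv.Perm I)}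

lemma isAction_act (T : QuotientStratum X I G) : IsAction fun σ : G => (T.act σ).left := by
  have := T.isImmersion
  have h : ∀ σ : G, (T.act σ).left ≫ T.incl.left = T.incl.left ≫ (permMap X I σ).left :=
    fun σ => congr($(T.act_incl σ).left)
  constructor
  · rw [← cancel_mono T.incl.left, h, (isAction_permMap X I G).one, Category.comp_id,
      Category.id_comp]
  · intro σ τ
    rw [← cancel_mono T.incl.left, h, (isAction_permMap X I G).mul, Category.assoc, h,
      ← Category.assoc (T.act σ).left, h, Category.assoc]

end QuotientStratum

/-- A nonempty locally closed subset that is invariant contains the members of a stratum. -/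
lemma exists_quotientStratum (X : FTScheme k) [IsSeparated X.obj.hom] (I : Type) [Finite I]
    (G : Subgroup (Equiv.Perm I)) {C O : Set (power X.obj I).left} (hC : IsClosed C)
    (hO : IsOpen O) (hCs : ∀ σ : G, ∀ x ∈ C, (permMap X.obj I σ).left x ∈ C)
    (hOs : ∀ σ : G, ∀ x ∈ O, (permMap X.obj I σ).left x ∈ O) (hne : (C ∩ O).Nonempty) :
    ∃ T : QuotientStratum X.obj I G, (Set.range T.incl.left).Nonempty ∧
      Set.range T.incl.left ⊆ C ∩ O ∧ IsClosed (C \ Set.range T.incl.left) := by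
  let p : G → ((powerFT X I).obj ⟶ (powerFT X I).obj) := fun σ => permMap X.obj I σ
  obtain ⟨Y, ι, β, hι, hιr, hβ, hβa⟩ := exists_action_of_isClosed (powerFT X I) p (isAction_permMap X.obj I G) hC hCs
  have hYs : IsSeparated Y.obj.hom := by
    have h1 : IsSeparated (powerFT X I).obj.hom := (power_finiteType X I).2.2
    rw [← Over.w ι]
    infer_instance
  have hYsep : Y.obj.left.IsSeparated := scheme_isSeparated Y.obj.hom
  let U : Y.obj.left.Opens := ι.left ⁻¹ᵁ ⟨O, hO⟩
  have hβ' : ∀ (σ : G) (y : Y.obj.left),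
      ι.left ((β σ).left y) = (permMap X.obj I σ).left (ι.left y) := fun σ y =>
    congr($(hβ σ).left y)
  obtain ⟨W, hWU, hWaff, hWne, hWs⟩ := hβa.exists_isAffineOpen U
    (fun σ y hy => by
      change ι.left ((β σ).left y) ∈ O
      rw [hβ']
      exact hOs σ _ hy)
    (by
      obtain ⟨x, hxC, hxO⟩ := hne
      rw [← hιr] at hxC
      obtain ⟨y, rfl⟩ := hxC
      exact ⟨y, hxO⟩)
  let Z : FTScheme k := Y.along W.ι
  have hr : ∀ σ : G, Set.range (W.ι ≫ (β σ).left) ⊆ Set.range W.ι := by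
    rintro σ _ ⟨y, rfl⟩
    rw [Scheme.Opens.range_ι]
    exact hWs σ y.2
  let b : G → (W.toScheme ⟶ W.toScheme) := fun σ => IsOpenImmersion.lift W.ι _ (hr σ)
  have hb : ∀ σ : G, b σ ≫ W.ι = W.ι ≫ (β σ).left := fun σ =>
    IsOpenImmersion.lift_fac W.ι _ (hr σ)
  let act : G → (Z.obj ⟶ Z.obj) := fun σ => Over.homMk (b σ) (by
    change b σ ≫ W.ι ≫ Y.obj.hom = W.ι ≫ Y.obj.hom
    rw [← Category.assoc, hb, Category.assoc, Over.w])
  have hact : ∀ σ, act σ ≫ Y.alongHom W.ι = Y.alongHom W.ι ≫ β σ := fun σ => by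
    ext1; exact hb σ
  have hacta : IsAction fun σ : G => (act σ).left := by
    constructor
    · change b 1 = 𝟙 _
      rw [← cancel_mono W.ι, hb, hβa.one, Category.comp_id, Category.id_comp]
    · intro σ τ
      change b (σ * τ) = b σ ≫ b τ
      rw [← cancel_mono W.ι, hb, Category.assoc, hb, hβa.mul]
      rw [← Category.assoc (b σ), hb, Category.assoc]
  have hZaff : IsAffine Z.obj.left := hWaff
  obtain ⟨Q, q, hq⟩ := exists_isGroupQuotient Z act hacta
  have hrange : Set.range (Y.alongHom W.ι ≫ ι).left = ι.left '' W := by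
    change Set.range (ι.left ∘ W.ι) = _
    rw [Set.range_comp, Scheme.Opens.range_ι]
  have hincl : ∀ σ : G, act σ ≫ Y.alongHom W.ι ≫ ι = (Y.alongHom W.ι ≫ ι) ≫ p σ := fun σ => by
    rw [← Category.assoc, hact, Category.assoc, hβ, Category.assoc]
  refine ⟨
    { Z := Z.obj
      incl := Y.alongHom W.ι ≫ ι
      isImmersion := inferInstanceAs (IsImmersion (W.ι ≫ ι.left))
      act := act
      act_incl := hincl
      Q := Q
      quot := q
      isGroupQuotient := hq }, ?_, ?_, ?_⟩
  · dsimp only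
    rw [hrange]
    exact hWne.image _
  · dsimp only
    rw [hrange]
    rintro _ ⟨y, hy, rfl⟩
    exact ⟨hιr ▸ ⟨y, rfl⟩, hWU hy⟩
  · dsimp only
    rw [hrange]
    have : C \ ι.left '' W = ι.left '' (W : Set Y.obj.left)ᶜ := by
      rw [← hιr, Set.image_compl_eq_range_sdiff_image ι.left.isClosedEmbedding.injective]
    rw [this]
    exact ι.left.isClosedEmbedding.isClosedMap _ W.2.isClosed_compl

lemma QuotientStratum.range_stable {X : Over (Spec (CommRingCat.of k))} {I : Type} [Finite I]
    {G : Subgroup (Equiv.Perm I)} (T : QuotientStratum X I G) (σ : G) (x : (power X I).left)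
    (hx : x ∈ Set.range T.incl.left) : (permMap X I σ).left x ∈ Set.range T.incl.left := by
  obtain ⟨z, rfl⟩ := hx
  exact ⟨(T.act σ).left z, congr($(T.act_incl σ).left z)⟩

/-- An invariant open subset of a power of a scheme has a decomposition into invariant locally
closed subschemes with quotients. -/
theorem exists_isQuotientClass (X : FTScheme k) [IsSeparated X.obj.hom] (I : Type) [Finite I]
    (G : Subgroup (Equiv.Perm I)) {O : Set (power X.obj I).left} (hO : IsOpen O)
    (hOs : ∀ σ : G, ∀ x ∈ O, (permMap X.obj I σ).left x ∈ O) :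
    ∃ c, IsQuotientClass X.obj I G O c := by
  have hN : TopologicalSpace.NoetherianSpace (power X.obj I).left :=
    (powerFT X I).noetherianSpace
  suffices H : ∀ C : TopologicalSpace.Closeds (power X.obj I).left,
      (∀ σ : G, ∀ x ∈ C, (permMap X.obj I σ).left x ∈ C) →
      ∃ c, IsQuotientClass X.obj I G (C ∩ O) c by
    simpa using H ⊤ (fun _ _ _ => trivial)
  intro C
  induction C using WellFoundedLT.induction with
  | ind C ih =>
    intro hC
    rcases Set.eq_empty_or_nonempty (C ∩ O : Set (power X.obj I).left) with he | hne
    · exact ⟨0, 0, Fin.elim0, fun a => a.elim0, by rw [he]; simp, by simp⟩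
    obtain ⟨T, hTne, hT, hTc⟩ := exists_quotientStratum X I G C.isClosed hO hC hOs hne
    let C' : TopologicalSpace.Closeds (power X.obj I).left := ⟨_, hTc⟩
    have hstab : ∀ (σ : G) x, (permMap X.obj I σ).left x ∈ Set.range T.incl.left →
        x ∈ Set.range T.incl.left := by
      intro σ x hx
      have h1 := T.range_stable σ⁻¹ _ hx
      have h2 : (permMap X.obj I (σ * σ⁻¹ : G)).left x =
        (permMap X.obj I (σ⁻¹ : G)).left ((permMap X.obj I σ).left x) :=
        congr($((isAction_permMap X.obj I G).mul σ σ⁻¹) x)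
      rw [← h2, mul_inv_cancel] at h1
      have h3 : (permMap X.obj I (1 : G)).left x = x := congr($((isAction_permMap X.obj I G).one) x)
      rwa [h3] at h1
    obtain ⟨c, m, T', hT'd, hT'u, rfl⟩ := ih C' (by
      refine lt_of_le_of_ne Set.sdiff_subset fun h => ?_
      obtain ⟨x, hx⟩ := hTne
      have hxC : x ∈ C' := by rw [h]; exact (hT hx).1
      exact hxC.2 hx) (fun σ x hx => ⟨hC σ x hx.1, fun hx' => hx.2 (hstab σ x hx')⟩)
    have hsub : ∀ a, Disjoint (Set.range T.incl.left) (Set.range (T' a).incl.left) := fun a => by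
      refine Set.disjoint_left.mpr fun x hx hx' => ?_
      have : x ∈ (C' ∩ O : Set (power X.obj I).left) := hT'u ▸ Set.mem_iUnion.mpr ⟨a, hx'⟩
      exact this.1.2 hx
    refine ⟨_, m + 1, Fin.cons T T', ?_, ?_, rfl⟩
    · intro a b
      induction a using Fin.cases <;> induction b using Fin.cases
      · intro h; exact absurd rfl h
      · intro _; exact hsub _
      · intro _; exact (hsub _).symm
      · intro h
        exact hT'd fun h' => h (congr_arg Fin.succ h')
    · ext x
      rw [Set.mem_iUnion, Fin.exists_fin_succ]
      change (x ∈ Set.range T.incl.left ∨ ∃ a, x ∈ Set.range (T' a).incl.left) ↔ _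
      rw [← Set.mem_iUnion (s := fun a => Set.range (T' a).incl.left), hT'u]
      constructor
      · rintro (h | h)
        · exact hT h
        · exact ⟨h.1.1, h.2⟩
      · intro h
        by_cases hx : x ∈ Set.range T.incl.left
        · exact Or.inl hx
        · exact Or.inr ⟨⟨h.1, hx⟩, h.2⟩

end

section

variable {k : Type u} [Field k]

/-! ### Families of labelled configurations -/

/-- The fibre product of finite type schemes. -/
def FTScheme.pull {X Y Z : FTScheme k} (f : X.obj ⟶ Z.obj) (g : Y.obj ⟶ Z.obj) : FTScheme k :=
  haveI := locallyOfFiniteType_left g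
  X.along (pullback.fst f.left g.left)

namespace FTScheme

variable {X Y Z : FTScheme k} (f : X.obj ⟶ Z.obj) (g : Y.obj ⟶ Z.obj)

/-- The first projection of a fibre product. -/
def pullFst : (pull f g).obj ⟶ X.obj :=
  haveI := locallyOfFiniteType_left g
  X.alongHom (pullback.fst f.left g.left)

/-- The second projection of a fibre product. -/
def pullSnd : (pull f g).obj ⟶ Y.obj :=
  Over.homMk (pullback.snd f.left g.left) (by
    change pullback.snd f.left g.left ≫ Y.obj.hom = pullback.fst f.left g.left ≫ X.obj.hom
    rw [← Over.w g, ← Over.w f, pullback.condition_assoc])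

lemma pull_condition : pullFst f g ≫ f = pullSnd f g ≫ g := by
  ext1
  exact pullback.condition

lemma exists_pull_lift {T : Over (Spec (CommRingCat.of k))} (a : T ⟶ X.obj) (b : T ⟶ Y.obj)
    (h : a ≫ f = b ≫ g) : ∃ c : T ⟶ (pull f g).obj, c ≫ pullFst f g = a ∧ c ≫ pullSnd f g = b := by
  have h' : a.left ≫ f.left = b.left ≫ g.left := congr($(h).left)
  refine ⟨Over.homMk (pullback.lift a.left b.left h') ?_, ?_, ?_⟩
  · refine Eq.trans ?_ (Over.w a)
    exact pullback.lift_fst_assoc _ _ _ _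
  · ext1; exact pullback.lift_fst _ _ _
  · ext1; exact pullback.lift_snd _ _ _

end FTScheme

/-- A family of finite configurations of points of `X` with labels in `M`, parametrized by a
scheme `V`, together with a quotient `Q` of `V` whose field-valued points (up to extensions of
fields) are the configurations. The configurations are represented by finitely supported
functions, so that labels of coinciding points are added. -/
structure Chart (X : FTScheme k) (M : Type*) [AddCommMonoid M] where
  /-- the parameter space -/
  V : FTScheme k
  /-- the space of configurations -/
  Q : FTScheme k
  /-- the quotient morphism -/
  q : V.obj ⟶ Q.obj
  /-- the index set of the points -/
  I : Type
  [fintype : Fintype I]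
  /-- the points of the configuration -/
  x : I → (V.obj ⟶ X.obj)
  /-- their labels -/
  label : I → M
  surjective : Surjective q.left
  ker : ∀ (T : Over (Spec (CommRingCat.of k))) [IsFieldPoint T] (v w : T ⟶ V.obj),
    v ≫ q = w ≫ q ↔ ∑ i, Finsupp.single (v ≫ x i) (label i) =
      ∑ i, Finsupp.single (w ≫ x i) (label i)

attribute [instance] Chart.fintype

/-- The configuration of a point of the parameter space. -/
def Chart.config {X : FTScheme k} {M : Type*} [AddCommMonoid M] (C : Chart X M)
    {T : Over (Spec (CommRingCat.of k))} (v : T ⟶ C.V.obj) : (T ⟶ X.obj) →₀ M :=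
  ∑ i, Finsupp.single (v ≫ C.x i) (C.label i)

/-- `c` is the class of the space of configurations described by `F`: there are finitely many
charts that together describe each configuration in `F` once. -/
def Presents (X : FTScheme k) {M : Type*} [AddCommMonoid M] (c : K0 k)
    (F : ∀ T : Over (Spec (CommRingCat.of k)), Set ((T ⟶ X.obj) →₀ M)) : Prop :=
  ∃ (A : Type) (_ : Fintype A) (C : A → Chart X M), c = ∑ a, cls (C a).Q ∧
    ∀ (T : Over (Spec (CommRingCat.of k))) [IsFieldPoint T],
      (∀ f, f ∈ F T ↔ ∃ a, ∃ v : T ⟶ (C a).V.obj, (C a).config v = f) ∧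
      ∀ (a b : A) (v : T ⟶ (C a).V.obj) (w : T ⟶ (C b).V.obj),
        (C a).config v = (C b).config w → a = b

section Coincidence

variable {X : FTScheme k} {M : Type*} [AddCommMonoid M]

/-- Two sums of labelled points agree if and only if the points coincide according to a pattern for
which the sums of labels agree. -/
lemma sum_single_eq_iff {I J P : Type*} [Fintype I] [Fintype J] (a : I → P) (b : J → P)
    (ℓ : I → M) (ℓ' : J → M) [DecidableEq (I ⊕ J)] :
    ∑ i, Finsupp.single (a i) (ℓ i) = ∑ j, Finsupp.single (b j) (ℓ' j) ↔
    ∃ ρ : I ⊕ J → I ⊕ J, (∀ s, ∑ i with ρ (.inl i) = s, ℓ i = ∑ j with ρ (.inr j) = s, ℓ' j) ∧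
      ∃ y : I ⊕ J → P, ∀ s, Sum.elim a b s = y (ρ s) := by
  classical
  constructor
  · intro h
    set p := Sum.elim a b
    have hrep : ∀ s, ∃ s', p s' = p s := fun s => ⟨s, rfl⟩
    let r : P → I ⊕ J → I ⊕ J := fun x s => if h : ∃ s', p s' = x then h.choose else s
    let ρ : I ⊕ J → I ⊕ J := fun s => r (p s) s
    have hρ : ∀ s, p (ρ s) = p s := fun s => by
      simp only [ρ, r]
      rw [dif_pos (hrep s)]
      exact (hrep s).choose_spec
    have hρ' : ∀ s s', p s = p s' → ρ s = ρ s' := fun s s' h => by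
      simp only [ρ, r]
      rw [dif_pos (hrep s), dif_pos (hrep s')]
      simp only [h]
    refine ⟨ρ, fun s => ?_, p, fun s => (hρ s).symm⟩
    by_cases hs : ∃ s', ρ s' = s
    · obtain ⟨s', rfl⟩ := hs
      have h1 : ∀ t, ρ t = ρ s' ↔ p t = p s' := fun t =>
        ⟨fun h => by rw [← hρ t, h, hρ], hρ' t s'⟩
      simp only [h1]
      have h2 := congr($h (p s'))
      simp only [Finsupp.finsetSum_apply, Finsupp.single_apply] at h2
      rw [Finset.sum_filter, Finset.sum_filter]
      exact h2
    · push Not at hs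
      rw [Finset.filter_false_of_mem fun i _ => hs _, Finset.filter_false_of_mem fun i _ => hs _]
      simp
  · rintro ⟨ρ, hρ, y, hy⟩
    have ha : ∀ i, a i = y (ρ (.inl i)) := fun i => hy (.inl i)
    have hb : ∀ j, b j = y (ρ (.inr j)) := fun j => hy (.inr j)
    simp only [ha, hb]
    rw [← Finset.sum_fiberwise (s := Finset.univ) (g := fun i => ρ (.inl i)),
      ← Finset.sum_fiberwise (s := Finset.univ) (g := fun j => ρ (.inr j))]
    refine Finset.sum_congr rfl fun s _ => ?_
    have e1 : ∑ i with ρ (.inl i) = s, Finsupp.single (y (ρ (.inl i))) (ℓ i) =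
        Finsupp.single (y s) (∑ i with ρ (.inl i) = s, ℓ i) := by
      rw [Finsupp.single_finsetSum]
      exact Finset.sum_congr rfl fun i hi => by rw [(Finset.mem_filter.mp hi).2]
    have e2 : ∑ j with ρ (.inr j) = s, Finsupp.single (y (ρ (.inr j))) (ℓ' j) =
        Finsupp.single (y s) (∑ j with ρ (.inr j) = s, ℓ' j) := by
      rw [Finsupp.single_finsetSum]
      exact Finset.sum_congr rfl fun i hi => by rw [(Finset.mem_filter.mp hi).2]
    rw [e1, e2, hρ]

variable [IsSeparated X.obj.hom]

/-- The locus in a product of parameter spaces where two configurations agree is, on field-valued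
points, the image of a scheme of finite type. -/
lemma Chart.exists_coincidence (C D : Chart X M) : ∃ (R : Type) (_ : Fintype R)
    (W : R → FTScheme k) (p : ∀ r, (W r).obj ⟶ C.V.obj) (p' : ∀ r, (W r).obj ⟶ D.V.obj),
    ∀ (T : Over (Spec (CommRingCat.of k))) (v : T ⟶ C.V.obj) (w : T ⟶ D.V.obj),
      C.config v = D.config w ↔ ∃ r, ∃ t : T ⟶ (W r).obj, t ≫ p r = v ∧ t ≫ p' r = w := by
  classical
  let R : Type := {ρ : C.I ⊕ D.I → C.I ⊕ D.I //
    ∀ s, ∑ i with ρ (.inl i) = s, C.label i = ∑ j with ρ (.inr j) = s, D.label j}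
  let P : FTScheme k := powerFT X (C.I ⊕ D.I)
  let m : (C.V.prod D.V).obj ⟶ P.obj :=
    Pi.lift (f := fun _ : C.I ⊕ D.I => X.obj) fun s =>
      s.elim (fun i => C.V.fst D.V ≫ C.x i) fun j => C.V.snd D.V ≫ D.x j
  let n : R → (P.obj ⟶ P.obj) := fun r =>
    Pi.lift (f := fun _ : C.I ⊕ D.I => X.obj) fun s => Pi.π (fun _ : C.I ⊕ D.I => X.obj) (r.1 s)
  refine ⟨R, Fintype.ofFinite _, fun r => FTScheme.pull m (n r),
    fun r => FTScheme.pullFst m (n r) ≫ C.V.fst D.V,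
    fun r => FTScheme.pullFst m (n r) ≫ C.V.snd D.V, fun T v w => ?_⟩
  unfold Chart.config
  rw [sum_single_eq_iff]
  constructor
  · rintro ⟨ρ, hρ, y, hy⟩
    obtain ⟨t, ht, -⟩ := FTScheme.exists_pull_lift m (n ⟨ρ, hρ⟩) (FTScheme.lift v w)
      (Pi.lift (f := fun _ : C.I ⊕ D.I => X.obj) y) (by
        refine Pi.hom_ext _ _ fun s => ?_
        rw [Category.assoc, Category.assoc]
        simp only [m, n, limit.lift_π, Fan.mk_π_app]
        rw [← hy s]
        rcases s with i | j
        · simp [← Category.assoc]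
        · simp [← Category.assoc])
    exact ⟨⟨ρ, hρ⟩, t, by simp [← Category.assoc, ht], by simp [← Category.assoc, ht]⟩
  · rintro ⟨⟨ρ, hρ⟩, t, rfl, rfl⟩
    refine ⟨ρ, hρ, fun s => (t ≫ FTScheme.pullSnd m (n ⟨ρ, hρ⟩)) ≫
      Pi.π (fun _ : C.I ⊕ D.I => X.obj) s, fun s => ?_⟩
    have h1 : t ≫ FTScheme.pullFst m (n ⟨ρ, hρ⟩) ≫ m ≫ Pi.π (fun _ : C.I ⊕ D.I => X.obj) s =
        t ≫ FTScheme.pullSnd m (n ⟨ρ, hρ⟩) ≫ n ⟨ρ, hρ⟩ ≫ Pi.π (fun _ : C.I ⊕ D.I => X.obj) s := by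
      rw [← Category.assoc _ m, FTScheme.pull_condition, Category.assoc]
    simp only [m, n, limit.lift_π, Fan.mk_π_app] at h1
    rcases s with i | j
    · simpa [m, n] using h1
    · simpa [m, n] using h1

end Coincidence

end

section

variable {k : Type u} [Field k] {X : FTScheme k}

/-! ### The class of a family of configurations -/

/-- A field-valued point of a disjoint union is a point of a summand. -/
lemma FTScheme.exists_fieldPoint_comp_sigmaι {A : Type} [Finite A] (Q : A → FTScheme k)
    {T : Over (Spec (CommRingCat.of k))} [hT : IsFieldPoint T] (g : T ⟶ (sigma Q).obj) :
    ∃ a, ∃ g' : T ⟶ (Q a).obj, g' ≫ sigmaι Q a = g := by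
  obtain ⟨K, _, ⟨i⟩⟩ := hT
  obtain ⟨a, g', hg'⟩ := exists_comp_sigmaι Q (i.hom ≫ g.left)
  have h1 : (i.inv ≫ g') ≫ (sigmaι Q a).left = g.left := by
    rw [Category.assoc, hg', Iso.inv_hom_id_assoc]
  refine ⟨a, Over.homMk (i.inv ≫ g') ?_, ?_⟩
  · rw [← Over.w (sigmaι Q a), ← Category.assoc, h1, Over.w g]
  · ext1; exact h1

lemma IsFieldPoint.nonempty (T : Over (Spec (CommRingCat.of k))) [hT : IsFieldPoint T] :
    Nonempty T.left := by
  obtain ⟨K, _, ⟨i⟩⟩ := hT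
  exact ⟨i.hom (IsLocalRing.closedPoint K)⟩

lemma FTScheme.comp_sigmaι_eq {A : Type} [Finite A] (Q : A → FTScheme k)
    {T : Over (Spec (CommRingCat.of k))} [IsFieldPoint T] {a b : A} (g : T ⟶ (Q a).obj)
    (h : T ⟶ (Q b).obj) (e : g ≫ sigmaι Q a = h ≫ sigmaι Q b) : a = b := by
  obtain ⟨z⟩ := IsFieldPoint.nonempty T
  exact sigmaι_apply_eq Q (x := g.left z) (y := h.left z) congr($(e).left z)

instance FTScheme.mono_sigmaι {A : Type} [Finite A] (Q : A → FTScheme k) (a : A) :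
    Mono (sigmaι Q a) :=
  (Over.forget _).mono_of_mono_map (inferInstanceAs (Mono (sigmaι Q a).left))

lemma FTScheme.comp_sigmaι_inj {A : Type} [Finite A] (Q : A → FTScheme k)
    {T : Over (Spec (CommRingCat.of k))} {a : A} (g h : T ⟶ (Q a).obj) :
    g ≫ sigmaι Q a = h ≫ sigmaι Q a ↔ g = h := cancel_mono _

/-- If distinct charts describe distinct configurations, then their disjoint union identifies exactly
the field-valued points with the same configuration. -/
lemma comp_q_comp_sigmaι_eq_iff {M : Type*} [AddCommMonoid M] {A : Type} [Finite A]
    (C : A → Chart X M) {T : Over (Spec (CommRingCat.of k))} [IsFieldPoint T]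
    (hC : ∀ (a b : A) (v : T ⟶ (C a).V.obj) (w : T ⟶ (C b).V.obj),
      (C a).config v = (C b).config w → a = b) {a b : A} (v : T ⟶ (C a).V.obj)
    (w : T ⟶ (C b).V.obj) :
    v ≫ (C a).q ≫ FTScheme.sigmaι (fun a => (C a).Q) a =
      w ≫ (C b).q ≫ FTScheme.sigmaι (fun a => (C a).Q) b ↔ (C a).config v = (C b).config w := by
  rw [← Category.assoc, ← Category.assoc]
  constructor
  · intro h
    obtain rfl : a = b := FTScheme.comp_sigmaι_eq (fun a => (C a).Q) _ _ h
    exact ((C a).ker _ _ _).mp ((FTScheme.comp_sigmaι_inj (fun a => (C a).Q) _ _).mp h)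
  · intro h
    obtain rfl := hC _ _ _ _ h
    rw [((C a).ker _ _ _).mpr h]

/-- The class of a space of configurations is determined by the configurations. -/
theorem Presents.unique {M : Type*} [AddCommMonoid M] [IsSeparated X.obj.hom] {c c' : K0 k}
    {F : ∀ T : Over (Spec (CommRingCat.of k)), Set ((T ⟶ X.obj) →₀ M)} (h : Presents X c F)
    (h' : Presents X c' F) : c = c' := by
  obtain ⟨A, _, C, rfl, hC⟩ := h
  obtain ⟨B, _, D, rfl, hD⟩ := h'
  rw [← FTScheme.cls_sigma, ← FTScheme.cls_sigma]
  choose R hR W p p' hW using fun a b => (C a).exists_coincidence (D b)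
  -- the pairs of parameters of equal configurations
  let S := Σ a : A, Σ b : B, R a b
  let V : S → FTScheme k := fun s => W s.1 s.2.1 s.2.2
  let d : ∀ s : S, (V s).obj ⟶ (FTScheme.sigma fun a => (C a).Q).obj := fun s =>
    p _ _ s.2.2 ≫ (C s.1).q ≫ FTScheme.sigmaι (fun a => (C a).Q) s.1
  let d' : ∀ s : S, (V s).obj ⟶ (FTScheme.sigma fun b => (D b).Q).obj := fun s =>
    p' _ _ s.2.2 ≫ (D s.2.1).q ≫ FTScheme.sigmaι (fun b => (D b).Q) s.2.1
  have hcoin : ∀ (T : Over (Spec (CommRingCat.of k))) (s : S) (v : T ⟶ (V s).obj),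
      (C s.1).config (v ≫ p _ _ s.2.2) = (D s.2.1).config (v ≫ p' _ _ s.2.2) := fun T s v =>
    (hW _ _ T _ _).mpr ⟨s.2.2, v, rfl, rfl⟩
  have h1 : Surjective (FTScheme.sigmaDesc V d).left := by
    refine surjective_of_fieldPoint _ fun T _ y => ?_
    obtain ⟨a, y, rfl⟩ := FTScheme.exists_fieldPoint_comp_sigmaι _ y
    obtain ⟨T', _, e, v, hv⟩ := exists_fieldPoint_lift (C a).q y
      (by rw [(C a).surjective.surj.range_eq]; exact Set.subset_univ _)
    obtain ⟨b, w, hw⟩ := ((hD T').1 _).mp (((hC T').1 _).mpr ⟨a, v, rfl⟩)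
    obtain ⟨r, t, ht, -⟩ := (hW a b T' v w).mp hw.symm
    refine ⟨T', inferInstance, e, t ≫ FTScheme.sigmaι V ⟨a, b, r⟩, ?_⟩
    rw [Category.assoc, FTScheme.sigmaι_sigmaDesc]
    simp only [d]
    rw [← Category.assoc, ht, ← Category.assoc, hv, Category.assoc]
  have h2 : Surjective (FTScheme.sigmaDesc V d').left := by
    refine surjective_of_fieldPoint _ fun T _ y => ?_
    obtain ⟨b, y, rfl⟩ := FTScheme.exists_fieldPoint_comp_sigmaι _ y
    obtain ⟨T', _, e, w, hw⟩ := exists_fieldPoint_lift (D b).q y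
      (by rw [(D b).surjective.surj.range_eq]; exact Set.subset_univ _)
    obtain ⟨a, v, hv⟩ := ((hC T').1 _).mp (((hD T').1 _).mpr ⟨b, w, rfl⟩)
    obtain ⟨r, t, -, ht⟩ := (hW a b T' v w).mp hv
    refine ⟨T', inferInstance, e, t ≫ FTScheme.sigmaι V ⟨a, b, r⟩, ?_⟩
    rw [Category.assoc, FTScheme.sigmaι_sigmaDesc]
    simp only [d']
    rw [← Category.assoc, ht, ← Category.assoc, hw, Category.assoc]
  refine cls_eq_of_same_kernel (FTScheme.sigmaDesc V d) (FTScheme.sigmaDesc V d')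
    fun T _ v w => ?_
  obtain ⟨s, v, rfl⟩ := FTScheme.exists_fieldPoint_comp_sigmaι _ v
  obtain ⟨t, w, rfl⟩ := FTScheme.exists_fieldPoint_comp_sigmaι _ w
  simp only [Category.assoc, FTScheme.sigmaι_sigmaDesc]
  have e1 := comp_q_comp_sigmaι_eq_iff C (hC T).2 (v ≫ p _ _ s.2.2) (w ≫ p _ _ t.2.2)
  have e2 := comp_q_comp_sigmaι_eq_iff D (hD T).2 (v ≫ p' _ _ s.2.2) (w ≫ p' _ _ t.2.2)
  rw [hcoin, hcoin, ← e2] at e1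
  simpa only [Category.assoc] using e1

/-- Classes of disjoint families of configurations add up. -/
lemma Presents.sum {M : Type*} [AddCommMonoid M] {ι : Type} [Fintype ι] {c : ι → K0 k}
    {F : ι → ∀ T : Over (Spec (CommRingCat.of k)), Set ((T ⟶ X.obj) →₀ M)}
    (h : ∀ i, Presents X (c i) (F i))
    (hd : ∀ (T : Over (Spec (CommRingCat.of k))) [IsFieldPoint T] (i j : ι) f, f ∈ F i T →
      f ∈ F j T → i = j) :
    Presents X (∑ i, c i) fun T => ⋃ i, F i T := by
  choose A hA C hc hC using h
  refine ⟨Σ i, A i, inferInstance, fun s => C s.1 s.2, ?_, fun T _ => ⟨fun f => ?_, ?_⟩⟩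
  · rw [Fintype.sum_sigma]
    exact Finset.sum_congr rfl fun i _ => hc i
  · rw [Set.mem_iUnion]
    simp only [(hC _ T).1, Sigma.exists]
  · rintro ⟨i, a⟩ ⟨j, b⟩ v w h
    have h1 : (C i a).config v ∈ F i T := ((hC i T).1 _).mpr ⟨a, v, rfl⟩
    have h2 : (C i a).config v ∈ F j T := ((hC j T).1 _).mpr ⟨b, w, h.symm⟩
    obtain rfl := hd T i j _ h1 h2
    obtain rfl := (hC i T).2 a b v w h
    rfl

/-- The empty configuration. -/
lemma presents_one (X : FTScheme k) (M : Type*) [AddCommMonoid M] :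
    Presents X 1 fun T => ({0} : Set ((T ⟶ X.obj) →₀ M)) := by
  have hsub : ∀ (T : Over (Spec (CommRingCat.of k))) (v w : T ⟶ (FTScheme.point k).obj), v = w :=
    fun T v w => by
      ext1
      exact ((Category.comp_id _).symm.trans (Over.w v)).trans
        ((Category.comp_id _).symm.trans (Over.w w)).symm
  let C : Chart X M :=
    { V := FTScheme.point k
      Q := FTScheme.point k
      q := 𝟙 _
      I := Empty
      x := Empty.elim
      label := Empty.elim
      surjective := inferInstanceAs (Surjective (𝟙 (Spec (CommRingCat.of k))))
      ker := fun T _ v w => by simp [hsub T v w] }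
  refine ⟨Unit, inferInstance, fun _ => C, ?_, fun T _ => ⟨fun f => ?_, fun _ _ _ _ _ => rfl⟩⟩
  · rw [Fintype.sum_unique]
    exact (cls_unit (inferInstanceAs (IsIso (𝟙 (Spec (CommRingCat.of k)))))).symm
  · have h : ∀ v : T ⟶ C.V.obj, C.config v = 0 := fun v => by simp [Chart.config, C]
    rw [Set.mem_singleton_iff]
    constructor
    · rintro rfl
      exact ⟨(), Over.homMk T.hom (Category.comp_id _), h _⟩
    · rintro ⟨_, v, hv⟩
      rw [← hv]
      exact h v

end

section

variable {k : Type u} [Field k] {X : FTScheme k}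

/-- A superposition of two configurations, labelled by pairs, is determined by the two. -/
lemma sum_single_pair_eq_iff {I J P M N : Type*} [Fintype I] [Fintype J] [AddCommMonoid M]
    [AddCommMonoid N] (p : I ⊕ J → P) (ℓ : I → M) (ℓ' : J → N) (f : P →₀ M × N) :
    ∑ s, Finsupp.single (p s) (Sum.elim (fun i => (ℓ i, (0 : N))) (fun j => ((0 : M), ℓ' j)) s) =
      f ↔ ∑ i, Finsupp.single (p (.inl i)) (ℓ i) =
          Finsupp.mapRange.addMonoidHom (AddMonoidHom.fst M N) f ∧
        ∑ j, Finsupp.single (p (.inr j)) (ℓ' j) =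
          Finsupp.mapRange.addMonoidHom (AddMonoidHom.snd M N) f := by
  have e1 : Finsupp.mapRange.addMonoidHom (AddMonoidHom.fst M N) (∑ s, Finsupp.single (p s)
      (Sum.elim (fun i => (ℓ i, (0 : N))) (fun j => ((0 : M), ℓ' j)) s)) =
      ∑ i, Finsupp.single (p (.inl i)) (ℓ i) := by
    rw [map_sum, Fintype.sum_sum_type]
    simp
  have e2 : Finsupp.mapRange.addMonoidHom (AddMonoidHom.snd M N) (∑ s, Finsupp.single (p s)
      (Sum.elim (fun i => (ℓ i, (0 : N))) (fun j => ((0 : M), ℓ' j)) s)) =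
      ∑ j, Finsupp.single (p (.inr j)) (ℓ' j) := by
    rw [map_sum, Fintype.sum_sum_type]
    simp
  rw [← e1, ← e2]
  refine ⟨fun h => by rw [h]; exact ⟨rfl, rfl⟩, fun h => ?_⟩
  ext x
  · exact congr($(h.1) x)
  · exact congr($(h.2) x)

/-- The product of two charts: superpositions of configurations, labelled by pairs. -/
def Chart.prod {M N : Type*} [AddCommMonoid M] [AddCommMonoid N] (C : Chart X M)
    (D : Chart X N) : Chart X (M × N) where
  V := C.V.prod D.V
  Q := C.Q.prod D.Q
  q := FTScheme.lift (C.V.fst D.V ≫ C.q) (C.V.snd D.V ≫ D.q)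
  I := C.I ⊕ D.I
  x := Sum.elim (fun i => C.V.fst D.V ≫ C.x i) fun j => C.V.snd D.V ≫ D.x j
  label := Sum.elim (fun i => (C.label i, 0)) fun j => (0, D.label j)
  surjective := by
    have hC := C.surjective
    have hD := D.surjective
    refine surjective_of_fieldPoint _ fun T _ y => ?_
    obtain ⟨T₁, _, e, v, hv⟩ := exists_fieldPoint_lift C.q (y ≫ C.Q.fst D.Q)
      (by rw [hC.surj.range_eq]; exact Set.subset_univ _)
    obtain ⟨T₂, _, e', w, hw⟩ := exists_fieldPoint_lift D.q (e ≫ y ≫ C.Q.snd D.Q)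
      (by rw [hD.surj.range_eq]; exact Set.subset_univ _)
    refine ⟨T₂, inferInstance, e' ≫ e, FTScheme.lift (e' ≫ v) w, FTScheme.prod_hom_ext ?_ ?_⟩
    · rw [Category.assoc, FTScheme.lift_fst, ← Category.assoc, FTScheme.lift_fst, Category.assoc,
        hv]
      simp
    · rw [Category.assoc, FTScheme.lift_snd, ← Category.assoc, FTScheme.lift_snd, hw]
      simp
  ker := by
    intro T _ v w
    rw [sum_single_pair_eq_iff (fun s => v ≫ (Sum.elim (fun i => C.V.fst D.V ≫ C.x i)
      (fun j => C.V.snd D.V ≫ D.x j) : C.I ⊕ D.I → _) s)]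
    have h0 := (sum_single_pair_eq_iff (fun s => w ≫ (Sum.elim (fun i => C.V.fst D.V ≫ C.x i)
      (fun j => C.V.snd D.V ≫ D.x j) : C.I ⊕ D.I → _) s) C.label D.label _).mp rfl
    rw [← h0.1, ← h0.2]
    have h1 := C.ker T (v ≫ C.V.fst D.V) (w ≫ C.V.fst D.V)
    have h2 := D.ker T (v ≫ C.V.snd D.V) (w ≫ C.V.snd D.V)
    simp only [Category.assoc] at h1 h2
    simp only [Sum.elim_inl, Sum.elim_inr]
    rw [← h1, ← h2]
    constructor
    · intro h
      exact ⟨by simpa using congr($h ≫ C.Q.fst D.Q), by simpa using congr($h ≫ C.Q.snd D.Q)⟩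
    · rintro ⟨h3, h4⟩
      exact FTScheme.prod_hom_ext (by simpa using h3) (by simpa using h4)

lemma Chart.prod_config {M N : Type*} [AddCommMonoid M] [AddCommMonoid N] (C : Chart X M)
    (D : Chart X N) {T : Over (Spec (CommRingCat.of k))} (v : T ⟶ (C.V.prod D.V).obj)
    (f : (T ⟶ X.obj) →₀ M × N) : (C.prod D).config v = f ↔
      C.config (v ≫ C.V.fst D.V) = Finsupp.mapRange.addMonoidHom (AddMonoidHom.fst M N) f ∧
      D.config (v ≫ C.V.snd D.V) = Finsupp.mapRange.addMonoidHom (AddMonoidHom.snd M N) f := by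
  have h := sum_single_pair_eq_iff (fun s => v ≫ (Sum.elim (fun i => C.V.fst D.V ≫ C.x i)
      (fun j => C.V.snd D.V ≫ D.x j) : C.I ⊕ D.I → _) s) C.label D.label f
  simp only [Sum.elim_inl, Sum.elim_inr] at h
  simp only [Chart.config, Category.assoc]
  exact h

/-- The product of the classes of two spaces of configurations. -/
lemma Presents.mul {M N : Type*} [AddCommMonoid M] [AddCommMonoid N] {c c' : K0 k}
    {F : ∀ T : Over (Spec (CommRingCat.of k)), Set ((T ⟶ X.obj) →₀ M)}
    {F' : ∀ T : Over (Spec (CommRingCat.of k)), Set ((T ⟶ X.obj) →₀ N)}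
    (h : Presents X c F) (h' : Presents X c' F') :
    Presents X (c * c') fun T => {f : (T ⟶ X.obj) →₀ M × N |
      Finsupp.mapRange.addMonoidHom (AddMonoidHom.fst M N) f ∈ F T ∧
      Finsupp.mapRange.addMonoidHom (AddMonoidHom.snd M N) f ∈ F' T} := by
  obtain ⟨A, _, C, rfl, hC⟩ := h
  obtain ⟨B, _, D, rfl, hD⟩ := h'
  refine ⟨A × B, inferInstance, fun s => (C s.1).prod (D s.2), ?_, fun T _ => ⟨fun f => ?_, ?_⟩⟩
  · rw [Finset.sum_mul_sum, ← Finset.univ_product_univ, Finset.sum_product]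
    exact Finset.sum_congr rfl fun a _ => Finset.sum_congr rfl fun b _ =>
      (FTScheme.cls_prod' _ _).symm
  · rw [Set.mem_ofPred_eq, (hC T).1, (hD T).1]
    constructor
    · rintro ⟨⟨a, v, hv⟩, ⟨b, w, hw⟩⟩
      exact ⟨(a, b), FTScheme.lift v w, (Chart.prod_config _ _ _ _).mpr
        ⟨(congr_arg (C a).config (FTScheme.lift_fst v w)).trans hv,
          (congr_arg (D b).config (FTScheme.lift_snd v w)).trans hw⟩⟩
    · rintro ⟨⟨a, b⟩, v, hv⟩
      obtain ⟨h1, h2⟩ := (Chart.prod_config _ _ _ _).mp hv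
      exact ⟨⟨a, _, h1⟩, ⟨b, _, h2⟩⟩
  · rintro ⟨a, b⟩ ⟨a', b'⟩ v w h
    obtain ⟨h1, h2⟩ := (Chart.prod_config _ _ _ _).mp h
    obtain ⟨h3, h4⟩ := (Chart.prod_config _ _ w _).mp rfl
    exact Prod.ext ((hC T).2 _ _ _ _ (h1.trans h3.symm)) ((hD T).2 _ _ _ _ (h2.trans h4.symm))

/-! ### Configuration spaces as quotients of powers -/

/-- A field-valued point lifts along an immersion as soon as one of its topological points does. -/
lemma exists_fieldPoint_factor {Y Z T : Over (Spec (CommRingCat.of k))} [hT : IsFieldPoint T]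
    (j : Y ⟶ Z) [IsPreimmersion j.left] (g : T ⟶ Z) (z : T.left)
    (h : g.left z ∈ Set.range j.left) : ∃ g' : T ⟶ Y, g' ≫ j = g := by
  obtain ⟨K, _, ⟨i⟩⟩ := hT
  have hz : i.hom (IsLocalRing.closedPoint K) = z := by
    have h1 : i.hom (i.inv z) = z := congr($(i.inv_hom_id) z)
    rw [← h1]
    exact congr_arg i.hom (Subsingleton.elim (α := PrimeSpectrum K) _ _)
  obtain ⟨g', hg'⟩ := exists_field_lift j.left (i.hom ≫ g.left) (by
    rw [← hz] at h
    exact h)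
  have h1 : (i.inv ≫ g') ≫ j.left = g.left := by
    rw [Category.assoc, hg', Iso.inv_hom_id_assoc]
  refine ⟨Over.homMk (i.inv ≫ g') ?_, ?_⟩
  · rw [← Over.w j, ← Category.assoc, h1, Over.w g]
  · ext1; exact h1

namespace QuotientStratum

variable {I : Type} [Finite I] {G : Subgroup (Equiv.Perm I)}

/-- The subscheme of a stratum as a scheme of finite type. -/
def space [IsSeparated X.obj.hom] (S : QuotientStratum X.obj I G) : FTScheme k where
  obj := S.Z
  locallyOfFiniteType := by
    have := S.isImmersion
    have := (power_finiteType X I).1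
    rw [← Over.w S.incl]
    infer_instance
  quasiCompact := by
    have := S.isImmersion
    have := (power_finiteType X I).2.1
    have : TopologicalSpace.NoetherianSpace (power X.obj I).left := (powerFT X I).noetherianSpace
    have : TopologicalSpace.NoetherianSpace S.Z.left :=
      S.incl.left.isEmbedding.isInducing.noetherianSpace
    rw [← Over.w S.incl]
    infer_instance

lemma surjective (S : QuotientStratum X.obj I G) : Surjective S.quot.left :=
  S.isGroupQuotient.surjective S.isAction_act

lemma comp_quot_eq_iff (S : QuotientStratum X.obj I G) {T : Over (Spec (CommRingCat.of k))}
    [hT : IsFieldPoint T] (v w : T ⟶ S.Z) : v ≫ S.quot = w ≫ S.quot ↔ ∃ σ : G, w = v ≫ S.act σ := by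
  constructor
  · intro h
    obtain ⟨K, _, ⟨i⟩⟩ := hT
    have h1 : v.left ≫ S.quot.left = w.left ≫ S.quot.left := congr($(h).left)
    obtain ⟨σ, hσ⟩ := (S.isGroupQuotient.comp_eq_comp_iff S.isAction_act
      (i.hom ≫ v.left) (i.hom ≫ w.left)).mp (by simp only [Category.assoc, h1])
    refine ⟨σ, ?_⟩
    ext1
    rw [Category.assoc, cancel_epi] at hσ
    exact hσ
  · rintro ⟨σ, rfl⟩
    ext1
    have := S.isGroupQuotient.inv σ
    change v.left ≫ S.quot.left = (v.left ≫ (S.act σ).left) ≫ S.quot.left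
    rw [Category.assoc, this]

end QuotientStratum

/-- The class of the quotient of an invariant open subset of a power describes the configurations
of its points. -/
theorem presents_quotientClass [IsSeparated X.obj.hom] {M : Type*} [AddCommMonoid M] (I : Type)
    [Fintype I] (G : Subgroup (Equiv.Perm I)) {O : Set (power X.obj I).left} (hO : IsOpen O)
    (hOs : ∀ σ : G, ∀ x ∈ O, (permMap X.obj I σ).left x ∈ O) (ℓ : I → M)
    (hker : ∀ (T : Over (Spec (CommRingCat.of k))) [IsFieldPoint T] (y y' : I → (T ⟶ X.obj)),
      Set.range (Pi.lift y).left ⊆ O → Set.range (Pi.lift y').left ⊆ O →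
      (∑ i, Finsupp.single (y i) (ℓ i) = ∑ i, Finsupp.single (y' i) (ℓ i) ↔
        ∃ σ : G, ∀ i, y' i = y (σ.1 i))) :
    Presents X (quotientClass X.obj I G O) fun T => {f | ∃ y : I → (T ⟶ X.obj),
      Set.range (Pi.lift y).left ⊆ O ∧ ∑ i, Finsupp.single (y i) (ℓ i) = f} := by
  obtain ⟨m, S, hSd, hSu, hc⟩ : IsQuotientClass X.obj I G O (quotientClass X.obj I G O) :=
    Classical.epsilon_spec (exists_isQuotientClass X I G hO hOs)
  rw [hc]
  have hlift : ∀ {T : Over (Spec (CommRingCat.of k))} (g : T ⟶ power X.obj I),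
      Pi.lift (fun i => g ≫ Pi.π (fun _ : I => X.obj) i) = g := fun g =>
    Pi.hom_ext _ _ fun i => by simp
  have hSO : ∀ (a : Fin m) {T : Over (Spec (CommRingCat.of k))} (v : T ⟶ (S a).Z),
      Set.range (v ≫ (S a).incl).left ⊆ O := by
    rintro a T v _ ⟨z, rfl⟩
    rw [← hSu]
    exact Set.mem_iUnion.mpr ⟨a, v.left z, rfl⟩
  have hSO' : ∀ (a : Fin m) {T : Over (Spec (CommRingCat.of k))} (v : T ⟶ (S a).Z),
      Set.range (Pi.lift fun i => v ≫ (S a).incl ≫ Pi.π (fun _ : I => X.obj) i).left ⊆ O := by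
    intro a T v
    have := hlift (v ≫ (S a).incl)
    simp only [Category.assoc] at this
    rw [this]
    exact hSO a v
  have hact : ∀ (a b : Fin m) (T : Over (Spec (CommRingCat.of k))) (v : T ⟶ (S a).Z)
      (w : T ⟶ (S b).Z) (σ : G), w ≫ (S b).incl = v ≫ (S a).act σ ≫ (S a).incl ↔
      ∀ i, w ≫ (S b).incl ≫ Pi.π (fun _ : I => X.obj) i =
        v ≫ (S a).incl ≫ Pi.π (fun _ : I => X.obj) (σ.1 i) := by
    intro a b T v w σ
    rw [(S a).act_incl]
    constructor
    · intro h i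
      rw [← Category.assoc, h]
      simp [permMap_π]
    · intro h
      refine Pi.hom_ext _ _ fun i => ?_
      simpa [permMap_π] using h i
  have hquot : ∀ (a : Fin m) (T : Over (Spec (CommRingCat.of k))) [IsFieldPoint T]
      (v w : T ⟶ (S a).Z), v ≫ (S a).quot = w ≫ (S a).quot ↔ ∃ σ : G, ∀ i,
        w ≫ (S a).incl ≫ Pi.π (fun _ : I => X.obj) i =
          v ≫ (S a).incl ≫ Pi.π (fun _ : I => X.obj) (σ.1 i) := by
    intro a T _ v w
    have := (S a).isImmersion
    have hm : Mono (S a).incl := (Over.forget _).mono_of_mono_map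
      (inferInstanceAs (Mono (S a).incl.left))
    rw [(S a).comp_quot_eq_iff]
    refine exists_congr fun σ => ?_
    rw [← hact, ← cancel_mono (S a).incl, Category.assoc]
  let C : Fin m → Chart X M := fun a =>
    { V := (S a).space
      Q := (S a).Q
      q := (S a).quot
      I := I
      x := fun i => (S a).incl ≫ Pi.π (fun _ : I => X.obj) i
      label := ℓ
      surjective := (S a).surjective
      ker := fun T _ v w => by
        exact (hquot a T v w).trans (hker T _ _ (hSO' a v) (hSO' a w)).symm }
  refine ⟨Fin m, inferInstance, C, rfl, fun T _ => ⟨fun f => ?_, ?_⟩⟩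
  · constructor
    · rintro ⟨y, hy, rfl⟩
      obtain ⟨z⟩ := IsFieldPoint.nonempty T
      have hz : (Pi.lift y).left z ∈ O := hy ⟨z, rfl⟩
      rw [← hSu] at hz
      obtain ⟨a, ha⟩ := Set.mem_iUnion.mp hz
      have := (S a).isImmersion
      obtain ⟨v, hv⟩ := exists_fieldPoint_factor (S a).incl (Pi.lift y) z ha
      refine ⟨a, v, Finset.sum_congr rfl fun i _ => ?_⟩
      have : v ≫ (S a).incl ≫ Pi.π (fun _ : I => X.obj) i = y i := by
        rw [← Category.assoc, hv, Pi.lift_π]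
      exact congr_arg (Finsupp.single · (ℓ i)) this
    · rintro ⟨a, v, rfl⟩
      exact ⟨_, hSO' a v, rfl⟩
  · intro a b v w h
    obtain ⟨σ, hσ⟩ := (hker T _ _ (hSO' a v) (hSO' b w)).mp h
    by_contra hab
    obtain ⟨z⟩ := IsFieldPoint.nonempty T
    have h1 := (hact a b T v w σ).mpr hσ
    exact Set.disjoint_left.mp (hSd hab) ⟨(S a).act σ |>.left (v.left z), rfl⟩
      ⟨w.left z, congr($(h1).left z)⟩

end

section

variable {k : Type u} [Field k] {X : FTScheme k}

/-! ### The big diagonal -/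

/-- Each topological point of a scheme is the image of a field-valued point. -/
lemma exists_fieldPoint {Y : Over (Spec (CommRingCat.of k))} (y : Y.left) :
    ∃ (T : Over (Spec (CommRingCat.of k))) (_ : IsFieldPoint T) (g : T ⟶ Y) (z : T.left),
      g.left z = y := by
  refine ⟨Over.mk (Y.left.fromSpecResidueField y ≫ Y.hom), inferInstance,
    Over.homMk (Y.left.fromSpecResidueField y),
    IsLocalRing.closedPoint (Y.left.residueField y), ?_⟩
  exact Scheme.fromSpecResidueField_apply _ _

section Diagonal

variable [IsSeparated X.obj.hom] {I : Type} [Finite I]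

lemma mem_range_equalizer_iff {T : Over (Spec (CommRingCat.of k))} [IsFieldPoint T]
    (g : T ⟶ power X.obj I) (z : T.left) (i j : I) :
    g.left z ∈ Set.range (equalizer.ι (Pi.π (fun _ : I => X.obj) i)
      (Pi.π (fun _ : I => X.obj) j)).left ↔
    g ≫ Pi.π (fun _ : I => X.obj) i = g ≫ Pi.π (fun _ : I => X.obj) j := by
  constructor
  · intro h
    obtain ⟨g', rfl⟩ := exists_fieldPoint_factor (equalizer.ι (Pi.π (fun _ : I => X.obj) i)
      (Pi.π (fun _ : I => X.obj) j)) g z h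
    rw [Category.assoc, equalizer.condition, Category.assoc]
  · intro h
    rw [← equalizer.lift_ι g h]
    exact ⟨_, rfl⟩

lemma mem_distinctLocus_iff {T : Over (Spec (CommRingCat.of k))} [IsFieldPoint T]
    (g : T ⟶ power X.obj I) (z : T.left) : g.left z ∈ distinctLocus X.obj I ↔
      Function.Injective fun i => g ≫ Pi.π (fun _ : I => X.obj) i := by
  have h : g.left z ∈ distinctLocus X.obj I ↔ ∀ i j : I, i ≠ j →
      ¬ g ≫ Pi.π (fun _ : I => X.obj) i = g ≫ Pi.π (fun _ : I => X.obj) j :=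
    forall_congr' fun i => forall_congr' fun j => imp_congr_right fun _ =>
      not_congr (mem_range_equalizer_iff g z i j)
  rw [h]
  exact ⟨fun h i j => not_imp_not.mp (h i j), fun h i j => mt fun e => h e⟩

/-- The complement of the big diagonal consists of the tuples of distinct points. -/
lemma range_subset_distinctLocus_iff {T : Over (Spec (CommRingCat.of k))} [IsFieldPoint T]
    (y : I → (T ⟶ X.obj)) :
    Set.range (Pi.lift y).left ⊆ distinctLocus X.obj I ↔ Function.Injective y := by
  have h := mem_distinctLocus_iff (Pi.lift y)
  simp only [limit.lift_π, Fan.mk_π_app] at h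
  obtain ⟨z⟩ := IsFieldPoint.nonempty T
  constructor
  · intro h'
    exact (h z).mp (h' ⟨z, rfl⟩)
  · rintro h' _ ⟨z, rfl⟩
    exact (h z).mpr h'

lemma isOpen_distinctLocus : IsOpen (distinctLocus X.obj I) := by
  have h : distinctLocus X.obj I = ⋂ i : I, ⋂ j : I, ⋂ _ : i ≠ j,
      (Set.range (equalizer.ι (Pi.π (fun _ : I => X.obj) i)
        (Pi.π (fun _ : I => X.obj) j)).left)ᶜ := by
    ext x
    simp [distinctLocus]
  rw [h]
  refine isOpen_iInter_of_finite fun i => isOpen_iInter_of_finite fun j =>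
    isOpen_iInter_of_finite fun _ => IsClosed.isOpen_compl (self := ?_)
  exact (Scheme.Hom.isClosedEmbedding _).isClosed_range

lemma permMap_mem_distinctLocus (σ : Equiv.Perm I) (x : (power X.obj I).left)
    (hx : x ∈ distinctLocus X.obj I) : (permMap X.obj I σ).left x ∈ distinctLocus X.obj I := by
  obtain ⟨T, _, g, z, rfl⟩ := exists_fieldPoint x
  rw [mem_distinctLocus_iff] at hx
  have h := (mem_distinctLocus_iff (g ≫ permMap X.obj I σ) z).mpr (by
    simp only [Category.assoc, permMap_π]
    exact hx.comp σ.injective)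
  exact h

end Diagonal

/-! ### Configurations as multisets of labels -/

lemma Presents.congr {M : Type*} [AddCommMonoid M] {c : K0 k}
    {F F' : ∀ T : Over (Spec (CommRingCat.of k)), Set ((T ⟶ X.obj) →₀ M)} (h : Presents X c F)
    (hF : ∀ (T : Over (Spec (CommRingCat.of k))) [IsFieldPoint T], F T = F' T) :
    Presents X c F' := by
  obtain ⟨A, hA, C, hc, hC⟩ := h
  refine ⟨A, hA, C, hc, fun T _ => ?_⟩
  rw [← hF]
  exact hC T

/-- Two finite families with the same multiset of values differ by a bijection. -/
lemma exists_equiv_of_map_univ_eq {I J P : Type*} [Fintype I] [Fintype J] {f : I → P} {g : J → P}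
    (h : Finset.univ.val.map f = Finset.univ.val.map g) : ∃ e : I ≃ J, ∀ i, g (e i) = f i := by
  classical
  have hc : ∀ p, Nonempty ({i // f i = p} ≃ {j // g j = p}) := fun p => by
    refine ⟨Fintype.equivOfCardEq ?_⟩
    have h1 := congr_arg (Multiset.count p) h
    rw [Multiset.count_map, Multiset.count_map] at h1
    rw [Fintype.card_subtype, Fintype.card_subtype]
    simp only [eq_comm (a := p)] at h1
    exact h1
  refine ⟨(Equiv.sigmaFiberEquiv f).symm.trans ((Equiv.sigmaCongrRight fun p =>
    (hc p).some).trans (Equiv.sigmaFiberEquiv g)), fun i => ?_⟩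
  exact ((hc (f i)).some ⟨i, rfl⟩).2

section Labels

variable {I P M : Type*} [Fintype I] [AddCommMonoid M]

lemma sum_single_apply_of_injective {y : I → P} (hy : Function.Injective y) (ℓ : I → M) (i : I) :
    (∑ i, Finsupp.single (y i) (ℓ i)) (y i) = ℓ i := by
  classical
  rw [Finsupp.finsetSum_apply, Finset.sum_eq_single i]
  · simp
  · intro j _ hj
    rw [Finsupp.single_eq_of_ne]
    exact fun h => hj (hy h.symm)
  · simp

lemma support_sum_single [DecidableEq P] {y : I → P} (hy : Function.Injective y) {ℓ : I → M}
    (hℓ : ∀ i, ℓ i ≠ 0) : (∑ i, Finsupp.single (y i) (ℓ i)).support = Finset.univ.image y := by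
  ext p
  rw [Finsupp.mem_support_iff, Finset.mem_image]
  constructor
  · intro h
    rw [Finsupp.finsetSum_apply] at h
    obtain ⟨i, -, hi⟩ := Finset.exists_ne_zero_of_sum_ne_zero h
    refine ⟨i, Finset.mem_univ _, ?_⟩
    by_contra h'
    exact hi (Finsupp.single_eq_of_ne (Ne.symm h'))
  · rintro ⟨i, -, rfl⟩
    rw [sum_single_apply_of_injective hy]
    exact hℓ i

/-- Two configurations of distinct points with nonzero labels agree if and only if they differ by a
permutation that preserves the labels. -/
lemma sum_single_eq_iff_exists_perm {y y' : I → P} (hy : Function.Injective y)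
    (hy' : Function.Injective y') {ℓ : I → M} (hℓ : ∀ i, ℓ i ≠ 0) :
    ∑ i, Finsupp.single (y i) (ℓ i) = ∑ i, Finsupp.single (y' i) (ℓ i) ↔
      ∃ σ : Equiv.Perm I, (∀ i, ℓ (σ i) = ℓ i) ∧ ∀ i, y' i = y (σ i) := by
  classical
  constructor
  · intro h
    have h1 : ∀ i, ∃ j, y j = y' i := fun i => by
      have h2 : y' i ∈ (∑ i, Finsupp.single (y i) (ℓ i)).support := by
        rw [h, support_sum_single hy' hℓ]
        exact Finset.mem_image_of_mem _ (Finset.mem_univ i)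
      rw [support_sum_single hy hℓ] at h2
      obtain ⟨j, -, hj⟩ := Finset.mem_image.mp h2
      exact ⟨j, hj⟩
    choose σ hσ using h1
    have hσi : Function.Injective σ := fun i j hij => hy' (by rw [← hσ, ← hσ, hij])
    refine ⟨Equiv.ofBijective σ (Finite.injective_iff_bijective.mp hσi), fun i => ?_,
      fun i => (hσ i).symm⟩
    rw [Equiv.ofBijective_apply, ← sum_single_apply_of_injective hy ℓ, h, hσ,
      sum_single_apply_of_injective hy']
  · rintro ⟨σ, hσ, hyσ⟩
    rw [← Equiv.sum_comp σ]
    exact Finset.sum_congr rfl fun i _ => by rw [hσ, hyσ]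

/-- The configurations of distinct points with prescribed nonzero labels. -/
lemma exists_sum_single_eq_iff {ℓ : I → M} (hℓ : ∀ i, ℓ i ≠ 0) (f : P →₀ M) :
    (∃ y : I → P, Function.Injective y ∧ ∑ i, Finsupp.single (y i) (ℓ i) = f) ↔
      f.support.val.map f = Finset.univ.val.map ℓ := by
  classical
  constructor
  · rintro ⟨y, hy, rfl⟩
    rw [support_sum_single hy hℓ, Finset.image_val_of_injOn hy.injOn, Multiset.map_map]
    exact Multiset.map_congr rfl fun i _ => sum_single_apply_of_injective hy ℓ i
  · intro h
    have h1 : (Finset.univ : Finset f.support).val.map (fun p => f p.1) =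
        Finset.univ.val.map ℓ := by
      rw [← h]
      exact Multiset.attach_map_val' f.support.val f
    obtain ⟨e, he⟩ := exists_equiv_of_map_univ_eq h1
    refine ⟨fun i => (e.symm i).1, Subtype.val_injective.comp e.symm.injective, ?_⟩
    rw [← Equiv.sum_comp e]
    simp only [Equiv.symm_apply_apply, he]
    exact (Finset.sum_coe_sort f.support fun p => Finsupp.single p (f p)).trans f.sum_single

lemma toMultiset_sum_single_one (y : I → P) :
    Finsupp.toMultiset (∑ i, Finsupp.single (y i) 1) = Finset.univ.val.map y := by
  simp only [map_sum, Finsupp.toMultiset_single, one_smul]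
  have h := Multiset.sum_map_singleton (Finset.univ.val.map y)
  rw [Multiset.map_map] at h
  exact h

/-- Two tuples agree up to a permutation if and only if they give the same sum of points. -/
lemma sum_single_one_eq_iff {y y' : I → P} :
    ∑ i, Finsupp.single (y i) 1 = ∑ i, Finsupp.single (y' i) 1 ↔
      ∃ σ : Equiv.Perm I, ∀ i, y' i = y (σ i) := by
  constructor
  · intro h
    have h1 := congr_arg Finsupp.toMultiset h
    rw [toMultiset_sum_single_one, toMultiset_sum_single_one] at h1
    obtain ⟨e, he⟩ := exists_equiv_of_map_univ_eq h1.symm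
    exact ⟨e, fun i => (he i).symm⟩
  · rintro ⟨σ, hσ⟩
    rw [← Equiv.sum_comp σ]
    simp only [hσ]

lemma exists_sum_single_one_eq_iff (f : P →₀ ℕ) :
    (∃ y : I → P, ∑ i, Finsupp.single (y i) 1 = f) ↔ (f.sum fun _ m => m) = Fintype.card I := by
  classical
  constructor
  · rintro ⟨y, rfl⟩
    have h := Finsupp.card_toMultiset (∑ i, Finsupp.single (y i) 1)
    rw [toMultiset_sum_single_one, Multiset.card_map] at h
    exact h.symm
  · intro h
    have h1 : Fintype.card (Finsupp.toMultiset f) = Fintype.card I := by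
      rw [Multiset.card_coe, Finsupp.card_toMultiset, ← h]
      rfl
    let e := Fintype.equivOfCardEq h1
    refine ⟨fun i => (e.symm i).1, (Multiset.toFinsupp (α := P)).symm.injective ?_⟩
    refine (toMultiset_sum_single_one _).trans ?_
    have h2 : (Finset.univ.val.map e.symm).map (fun i => i.1) = Finsupp.toMultiset f := by
      rw [Multiset.map_univ_val_equiv, Multiset.map_univ_coe]
    rw [Multiset.map_map] at h2
    exact h2

end Labels

section Classes

variable [IsSeparated X.obj.hom]

/-- The class `w_l` describes the configurations of points whose labels form the multiset `l`. The
labels may be renamed by a map `e` that is injective on `l` and takes nonzero values. -/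
theorem presents_w {M : Type*} [AddCommMonoid M] (l : Multiset ℕ) (e : ℕ → M)
    (he : ∀ i ∈ l, ∀ j ∈ l, e i = e j → i = j) (he0 : ∀ i ∈ l, e i ≠ 0) :
    Presents X (w X.obj l) fun T => {f : (T ⟶ X.obj) →₀ M | f.support.val.map f = l.map e} := by
  classical
  have h0 : ∀ i : l, e i.1 ≠ 0 := fun i => he0 _ (Multiset.coe_mem (x := i))
  have h := presents_quotientClass (X := X) l (labelPerms l) isOpen_distinctLocus
    (fun σ => permMap_mem_distinctLocus σ.1) (fun i => e i.1) (fun T _ y y' hy hy' => by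
      rw [range_subset_distinctLocus_iff] at hy hy'
      rw [sum_single_eq_iff_exists_perm hy hy' h0]
      constructor
      · rintro ⟨σ, hσ, hyσ⟩
        exact ⟨⟨σ, fun i => he _ (Multiset.coe_mem (x := σ i)) _ (Multiset.coe_mem (x := i)) (hσ i)⟩, hyσ⟩
      · rintro ⟨σ, hyσ⟩
        exact ⟨σ.1, fun i => congr_arg e (σ.2 i), hyσ⟩)
  refine h.congr fun T _ => ?_
  ext f
  have h1 := exists_sum_single_eq_iff h0 f
  have h2 := congr_arg (Multiset.map e) (Multiset.map_univ_coe l)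
  rw [Multiset.map_map] at h2
  rw [← h2]
  simp only [range_subset_distinctLocus_iff]
  exact h1

/-- The class of a symmetric power describes the effective zero-cycles of a given degree. -/
theorem presents_symClass (n : ℕ) :
    Presents X (symClass X.obj n) fun T => {f : (T ⟶ X.obj) →₀ ℕ | (f.sum fun _ m => m) = n} := by
  have h := presents_quotientClass (X := X) (Fin n) ⊤ isOpen_univ (fun _ _ _ => trivial)
    (fun _ => 1) (fun T _ y y' _ _ => by
      rw [sum_single_one_eq_iff]
      exact ⟨fun ⟨σ, hσ⟩ => ⟨⟨σ, trivial⟩, hσ⟩, fun ⟨σ, hσ⟩ => ⟨σ.1, hσ⟩⟩)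
  refine h.congr fun T _ => ?_
  ext f
  have h1 := exists_sum_single_one_eq_iff (I := Fin n) f
  rw [Fintype.card_fin] at h1
  simp only [Set.subset_univ, true_and]
  exact h1

end Classes

end

section

variable {k : Type u} [Field k] {X : FTScheme k}

/-! ### Relations between the classes of configuration spaces -/

/-- The multiset `κ` of pairs of labels describes superpositions of configurations labelled by `l`
and `m`: a label `0` means that the point belongs to one of the two configurations only. -/
def IsSuperposition (l m : Multiset ℕ) (κ : Multiset (ℕ × ℕ)) : Prop :=
  (0, 0) ∉ κ ∧ (κ.map Prod.fst).filter (· ≠ 0) = l ∧ (κ.map Prod.snd).filter (· ≠ 0) = m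

/-- The relations between the classes of the spaces of labelled configurations on a scheme on
which the generating functions depend: the empty configuration has class `1`, the labels may be
renamed, and a product of classes is the sum over all ways to superpose configurations. Pairs of
labels are encoded by natural numbers. -/
structure ConfigLaws {R : Type*} [CommRing R] (w : Multiset ℕ → R) : Prop where
  zero : w 0 = 1
  rename : ∀ (l : Multiset ℕ) (e : ℕ → ℕ), 0 ∉ l → 0 ∉ l.map e →
    (∀ i ∈ l, ∀ j ∈ l, e i = e j → i = j) → w (l.map e) = w l
  mul : ∀ (l m : Multiset ℕ), 0 ∉ l → 0 ∉ m → ∀ S : Finset (Multiset (ℕ × ℕ)),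
    (∀ κ, κ ∈ S ↔ IsSuperposition l m κ) →
    w l * w m = ∑ κ ∈ S, w (κ.map fun c => Nat.pair c.1 c.2)

/-- The labels of the image of a configuration under a homomorphism on labels. -/
lemma map_support_mapRange {P M N : Type*} [AddCommMonoid M] [AddCommMonoid N] [DecidableEq N]
    (φ : M →+ N) (f : P →₀ M) :
    (Finsupp.mapRange.addMonoidHom φ f).support.val.map (Finsupp.mapRange.addMonoidHom φ f) =
      ((f.support.val.map f).map φ).filter (· ≠ 0) := by
  classical
  have h : (Finsupp.mapRange.addMonoidHom φ f).support =
      f.support.filter fun p => φ (f p) ≠ 0 := by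
    ext p
    simp only [Finsupp.mapRange.addMonoidHom_apply, Finsupp.mem_support_iff,
      Finsupp.mapRange_apply, Finset.mem_filter]
    refine ⟨fun h => ⟨fun h' => h (by rw [h', map_zero]), h⟩, fun h => h.2⟩
  rw [h, Finset.filter_val, Multiset.map_map, Multiset.filter_map]
  rfl

theorem configLaws_w [IsSeparated X.obj.hom] : ConfigLaws (w X.obj) where
  zero := by
    have h := presents_w (X := X) (M := ℕ) 0 id (by simp) (by simp)
    refine (h.congr fun T _ => ?_).unique (presents_one X ℕ)
    ext f
    simp
  rename l e hl hle he := by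
    have h := presents_w (X := X) (M := ℕ) (l.map e) id (fun _ _ _ _ => id)
      fun i hi h0 => hle (h0 ▸ hi)
    refine (h.congr fun T _ => ?_).unique (presents_w l e he fun i hi h0 =>
      hle (h0 ▸ Multiset.mem_map_of_mem e hi))
    rw [Multiset.map_id]
  mul l m hl hm S hS := by
    have h1 := (presents_w (X := X) (M := ℕ) l id (fun _ _ _ _ => id)
      fun i hi h0 => hl (h0 ▸ hi)).mul (presents_w (X := X) (M := ℕ) m id (fun _ _ _ _ => id)
      fun i hi h0 => hm (h0 ▸ hi))
    have h2 : ∀ κ : S, Presents X (w X.obj (κ.1.map fun c => Nat.pair c.1 c.2)) fun T =>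
        {f : (T ⟶ X.obj) →₀ ℕ × ℕ | f.support.val.map f = κ.1} := fun κ => by
      have h3 : (κ.1.map fun c => Nat.pair c.1 c.2).map Nat.unpair = κ.1 := by
        rw [Multiset.map_map]
        simp
      have h4 := presents_w (X := X) (κ.1.map fun c => Nat.pair c.1 c.2) Nat.unpair
        (fun i _ j _ hij => Nat.pairEquiv.symm.injective hij) (fun i hi h0 => by
          have h5 := Multiset.mem_map_of_mem Nat.unpair hi
          rw [h0, h3] at h5
          exact ((hS _).mp κ.2).1 h5)
      rw [h3] at h4
      exact h4
    have h5 := Presents.sum h2 fun T _ κ κ' f hκ hκ' => Subtype.ext (hκ.symm.trans hκ')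
    rw [Finset.sum_coe_sort S fun κ => w X.obj (κ.map fun c => Nat.pair c.1 c.2)] at h5
    refine h1.unique (h5.congr fun T _ => ?_)
    ext f
    have h6 : f.support.val.map f ∈ S ↔ f ∈ ⋃ κ : S,
        {f : (T ⟶ X.obj) →₀ ℕ × ℕ | f.support.val.map f = κ.1} := by
      rw [Set.mem_iUnion]
      exact ⟨fun h => ⟨⟨_, h⟩, rfl⟩, fun ⟨κ, hκ⟩ => by rw [hκ]; exact κ.2⟩
    have h7 : (0, 0) ∉ f.support.val.map f := fun h => by
      obtain ⟨p, hp, hp0⟩ := Multiset.mem_map.mp h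
      exact Finsupp.mem_support_iff.mp hp hp0
    rw [← h6, hS, IsSuperposition]
    simp only [Set.mem_ofPred_eq, map_support_mapRange, Multiset.map_id]
    exact ⟨fun h => h.2, fun h => ⟨h7, h⟩⟩

/-- Effective zero-cycles are configurations labelled by the multiplicities. -/
theorem symClass_eq [IsSeparated X.obj.hom] (n : ℕ) :
    symClass X.obj n = ∑ p : Nat.Partition n, w X.obj p.parts := by
  have h1 : ∀ p : Nat.Partition n, Presents X (w X.obj p.parts) fun T =>
      {f : (T ⟶ X.obj) →₀ ℕ | f.support.val.map f = p.parts} := fun p => by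
    have h := presents_w (X := X) (M := ℕ) p.parts id (fun _ _ _ _ => id)
      fun i hi h0 => (p.parts_pos hi).ne' h0
    rwa [Multiset.map_id] at h
  refine (presents_symClass n).unique ((Presents.sum h1 ?_).congr fun T _ => ?_)
  · intro T _ p q f hp hq
    exact Nat.Partition.ext (hp.symm.trans hq)
  · ext f
    rw [Set.mem_iUnion]
    constructor
    · rintro ⟨p, hp⟩
      have h2 := p.parts_sum
      rw [← hp] at h2
      exact h2
    · intro hf
      refine ⟨⟨f.support.val.map f, fun {i} hi => ?_, hf⟩, rfl⟩
      obtain ⟨p, hp, rfl⟩ := Multiset.mem_map.mp hi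
      exact Nat.pos_of_ne_zero (Finsupp.mem_support_iff.mp hp)

end

section

/-! ### Generating series of weighted sets -/

section GenSeries

variable {R : Type*} [CommRing R] {α β : Type*}

/-- The generating series `∑ f(x) t ^ wt(x)` of the elements of `S`; it is meaningful if there are
finitely many elements of each weight. -/
def genSeries (f : α → R) (S : Set α) (wt : α → ℕ) : PowerSeries R :=
  PowerSeries.mk fun n => ∑ᶠ x ∈ {x | x ∈ S ∧ wt x = n}, f x

/-- There are finitely many elements of each weight. -/
def FiniteFibers (S : Set α) (wt : α → ℕ) : Prop :=
  ∀ n, {x | x ∈ S ∧ wt x = n}.Finite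

lemma FiniteFibers.mono {S T : Set α} {wt : α → ℕ} (h : FiniteFibers T wt) (hST : S ⊆ T) :
    FiniteFibers S wt :=
  fun n => (h n).subset fun _ hx => ⟨hST hx.1, hx.2⟩

/-- A bijection that preserves weights and values preserves the generating series. -/
lemma genSeries_bijOn {f : α → R} {g : β → R} {S : Set α} {T : Set β} {u : α → ℕ} {v : β → ℕ}
    (e : α → β) (he : Set.BijOn e S T) (hw : ∀ x ∈ S, v (e x) = u x)
    (hf : ∀ x ∈ S, f x = g (e x)) : genSeries f S u = genSeries g T v := by
  ext n
  rw [genSeries, genSeries, PowerSeries.coeff_mk, PowerSeries.coeff_mk]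
  refine finsum_mem_eq_of_bijOn e ⟨fun x hx => ⟨he.mapsTo hx.1, (hw x hx.1).trans hx.2⟩,
    he.injOn.mono fun x hx => hx.1, ?_⟩ fun x hx => hf x hx.1
  rintro y ⟨hy, hyn⟩
  obtain ⟨x, hx, rfl⟩ := he.surjOn hy
  exact ⟨x, ⟨hx, (hw x hx).symm.trans hyn⟩, rfl⟩

lemma genSeries_congr {f g : α → R} {S T : Set α} {u v : α → ℕ} (hS : S = T)
    (hw : ∀ x ∈ S, v x = u x) (hf : ∀ x ∈ S, f x = g x) : genSeries f S u = genSeries g T v :=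
  genSeries_bijOn id (hS ▸ Set.bijOn_id S) hw hf

lemma genSeries_empty (f : α → R) (wt : α → ℕ) : genSeries f ∅ wt = 0 := by
  ext n
  simp [genSeries]

lemma genSeries_shift {f : α → R} {S : Set α} {u v : α → ℕ} (c : ℕ)
    (h : ∀ x ∈ S, u x = v x + c) : genSeries f S u = PowerSeries.X ^ c * genSeries f S v := by
  ext n
  rw [PowerSeries.coeff_X_pow_mul', genSeries, genSeries, PowerSeries.coeff_mk]
  split_ifs with hc
  · rw [PowerSeries.coeff_mk]
    refine finsum_mem_congr (Set.ext fun x => and_congr_right fun hx => ?_) fun _ _ => rfl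
    rw [h x hx]
    omega
  · refine finsum_mem_eq_zero_of_forall_eq_zero fun x hx => ?_
    have := h x hx.1
    have := hx.2
    omega

lemma FiniteFibers.prod {S : Set α} {T : Set β} {u : α → ℕ} {v : β → ℕ} (hS : FiniteFibers S u)
    (hT : FiniteFibers T v) : FiniteFibers (S ×ˢ T) fun p => u p.1 + v p.2 := by
  intro n
  refine Set.Finite.subset (Set.Finite.biUnion (Finset.HasAntidiagonal.antidiagonal n).finite_toSet
    fun c _ => (hS c.1).prod (hT c.2)) ?_
  rintro ⟨x, y⟩ ⟨⟨hx, hy⟩, hn⟩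
  exact Set.mem_biUnion (x := (u x, v y)) (Finset.mem_coe.mpr (Finset.HasAntidiagonal.mem_antidiagonal.mpr hn))
    ⟨⟨hx, rfl⟩, ⟨hy, rfl⟩⟩

lemma genSeries_mul (f : α → R) (g : β → R) {S : Set α} {T : Set β} {u : α → ℕ} {v : β → ℕ}
    (hS : FiniteFibers S u) (hT : FiniteFibers T v) : genSeries f S u * genSeries g T v =
      genSeries (fun p => f p.1 * g p.2) (S ×ˢ T) fun p => u p.1 + v p.2 := by
  classical
  ext n
  rw [PowerSeries.coeff_mul]
  simp only [genSeries, PowerSeries.coeff_mk]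
  rw [finsum_mem_eq_finite_toFinset_sum _ (hS.prod hT n),
    ← Finset.sum_fiberwise_of_maps_to (t := Finset.HasAntidiagonal.antidiagonal n)
      (g := fun p : α × β => (u p.1, v p.2))
      (fun p hp => Finset.HasAntidiagonal.mem_antidiagonal.mpr ((Set.Finite.mem_toFinset _).mp hp).2)]
  refine Finset.sum_congr rfl fun c hc => ?_
  rw [finsum_mem_eq_finite_toFinset_sum _ (hS c.1), finsum_mem_eq_finite_toFinset_sum _ (hT c.2),
    Finset.sum_mul_sum, ← Finset.sum_product']
  refine Finset.sum_congr (Finset.ext fun p => ?_) fun _ _ => rfl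
  rw [Finset.HasAntidiagonal.mem_antidiagonal] at hc
  simp only [Finset.mem_product, Set.Finite.mem_toFinset, Finset.mem_filter, Set.mem_ofPred_eq,
    Set.mem_prod, Prod.ext_iff]
  constructor
  · rintro ⟨⟨h1, h2⟩, h3, h4⟩
    exact ⟨⟨⟨h1, h3⟩, by rw [h2, h4, hc]⟩, h2, h4⟩
  · rintro ⟨⟨⟨h1, h3⟩, -⟩, h2, h4⟩
    exact ⟨⟨h1, h2⟩, h3, h4⟩

/-- Replacing each term of a generating series by a finite sum. -/
lemma genSeries_sigma {f : α → R} {g : β → R} {S : Set α} {T : Set β} {u : α → ℕ} (e : β → α)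
    (hS : FiniteFibers S u) (he : Set.MapsTo e T S)
    (hfin : ∀ x ∈ S, {y | y ∈ T ∧ e y = x}.Finite)
    (hf : ∀ x ∈ S, f x = ∑ᶠ y ∈ {y | y ∈ T ∧ e y = x}, g y) :
    genSeries f S u = genSeries g T (u ∘ e) := by
  ext n
  rw [genSeries, genSeries, PowerSeries.coeff_mk, PowerSeries.coeff_mk]
  rw [finsum_mem_congr rfl fun x hx => hf x hx.1, ← finsum_mem_biUnion ?_ (hS n)
    fun x hx => hfin x hx.1]
  · refine finsum_mem_congr (Set.ext fun y => ?_) fun _ _ => rfl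
    simp only [Set.mem_iUnion, Set.mem_ofPred_eq, Function.comp_apply, exists_prop]
    constructor
    · rintro ⟨x, ⟨hx, hn⟩, hy, rfl⟩
      exact ⟨hy, hn⟩
    · rintro ⟨hy, hn⟩
      exact ⟨_, ⟨he hy, hn⟩, hy, rfl⟩
  · intro x _ x' _ hxx'
    exact Set.disjoint_left.mpr fun y hy hy' => hxx' (hy.2.symm.trans hy'.2)

/-- Sorting the terms of a generating series into finitely many classes. -/
lemma genSeries_fiberwise [DecidableEq β] (f : α → R) {S : Set α} {u : α → ℕ} (e : α → β)
    (B : Finset β) (hS : FiniteFibers S u) (he : ∀ x ∈ S, e x ∈ B) :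
    genSeries f S u = ∑ b ∈ B, genSeries f {x | x ∈ S ∧ e x = b} u := by
  classical
  ext n
  rw [map_sum]
  simp only [genSeries, PowerSeries.coeff_mk]
  rw [finsum_mem_eq_finite_toFinset_sum _ (hS n), ← Finset.sum_fiberwise_of_maps_to (t := B)
    (g := e) fun x hx => he x ((Set.Finite.mem_toFinset _).mp hx).1]
  refine Finset.sum_congr rfl fun b _ => ?_
  rw [finsum_mem_eq_finite_toFinset_sum _
    ((hS n).subset fun x hx => ⟨hx.1.1, hx.2⟩)]
  refine Finset.sum_congr (Finset.ext fun x => ?_) fun _ _ => rfl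
  simp only [Set.Finite.mem_toFinset, Finset.mem_filter, Set.mem_ofPred_eq]
  tauto

lemma genSeries_prod_finset [DecidableEq β] (f : β × α → R) (B : Finset β) {S : Set α}
    {u : α → ℕ} (v : β → ℕ) (hS : FiniteFibers S u) :
    genSeries f ((B : Set β) ×ˢ S) (fun p => v p.1 + u p.2) =
      ∑ b ∈ B, PowerSeries.X ^ v b * genSeries (fun x => f (b, x)) S u := by
  have hB : FiniteFibers (B : Set β) v := fun n => B.finite_toSet.subset fun _ h => h.1
  rw [genSeries_fiberwise f Prod.fst B (hB.prod hS) fun x hx => (Set.mem_prod.mp hx).1]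
  refine Finset.sum_congr rfl fun b hb => ?_
  rw [← genSeries_shift (u := fun x => v b + u x) (v b) fun x _ => add_comm _ _]
  have hbij : Set.BijOn (fun x => (b, x)) S {x : β × α | x ∈ (B : Set β) ×ˢ S ∧ x.1 = b} := by
    refine ⟨fun x hx => ⟨⟨hb, hx⟩, rfl⟩, fun x _ y _ h => congr_arg Prod.snd h, ?_⟩
    rintro ⟨b', x⟩ ⟨⟨-, hx⟩, rfl⟩
    exact ⟨x, hx, rfl⟩
  exact (genSeries_bijOn _ hbij (fun _ _ => rfl) fun _ _ => rfl).symm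

/-- Splitting a generating series in two. -/
lemma genSeries_split (f : α → R) {S : Set α} {u : α → ℕ} (p : α → Prop)
    (hS : FiniteFibers S u) : genSeries f S u =
      genSeries f {x | x ∈ S ∧ p x} u + genSeries f {x | x ∈ S ∧ ¬ p x} u := by
  ext n
  simp only [genSeries, PowerSeries.coeff_mk, map_add]
  rw [← finsum_mem_union ?_ ((hS n).subset fun x hx => ⟨hx.1.1, hx.2⟩)
    ((hS n).subset fun x hx => ⟨hx.1.1, hx.2⟩)]
  · refine finsum_mem_congr (Set.ext fun x => ?_) fun _ _ => rfl
    simp only [Set.mem_union, Set.mem_ofPred_eq]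
    tauto
  · exact Set.disjoint_left.mpr fun x hx hx' => hx'.1.2 hx.1.2

end GenSeries

end

section

/-! ### Products with series of configurations with small labels -/

lemma finite_multisets {γ : Type*} (F : Finset γ) (N : ℕ) :
    {κ : Multiset γ | (∀ c ∈ κ, c ∈ F) ∧ κ.card ≤ N}.Finite := by
  classical
  refine Set.Finite.subset (N • F.val).powerset.toFinset.finite_toSet ?_
  rintro κ ⟨hκ, hN⟩
  rw [Finset.mem_coe, Multiset.mem_toFinset, Multiset.mem_powerset, Multiset.le_iff_count]
  intro c
  rw [Multiset.count_nsmul]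
  by_cases hc : c ∈ κ
  · rw [Multiset.count_eq_one_of_mem F.nodup (hκ c hc), mul_one]
    exact (Multiset.count_le_card c κ).trans hN
  · rw [Multiset.count_eq_zero_of_notMem hc]
    exact Nat.zero_le _

lemma finite_isSuperposition (l m : Multiset ℕ) : {κ | IsSuperposition l m κ}.Finite := by
  classical
  refine (finite_multisets (insert 0 l.toFinset ×ˢ insert 0 m.toFinset) (l.card + m.card)).subset ?_
  rintro κ ⟨h0, rfl, rfl⟩
  constructor
  · intro c hc
    simp only [Finset.mem_product, Finset.mem_insert, Multiset.mem_toFinset, Multiset.mem_filter]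
    exact ⟨or_iff_not_imp_left.mpr fun h => ⟨Multiset.mem_map_of_mem _ hc, h⟩,
      or_iff_not_imp_left.mpr fun h => ⟨Multiset.mem_map_of_mem _ hc, h⟩⟩
  · rw [Multiset.filter_map, Multiset.filter_map, Multiset.card_map, Multiset.card_map,
      ← Multiset.card_add, Multiset.filter_add_filter, Multiset.card_add]
    refine le_trans (le_of_eq ?_) (Nat.le_add_right _ _)
    rw [Multiset.filter_eq_self.mpr]
    rintro ⟨a, b⟩ hc
    by_contra h
    simp only [Function.comp_apply, not_or, not_not] at h
    obtain ⟨rfl, rfl⟩ := h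
    exact h0 hc

lemma finiteFibers_sum : FiniteFibers {l : Multiset ℕ | 0 ∉ l} Multiset.sum := by
  intro n
  refine (Set.finite_range fun p : Nat.Partition n => p.parts).subset ?_
  rintro l ⟨hl, hn⟩
  exact ⟨⟨l, fun {i} hi => Nat.pos_of_ne_zero fun h => hl (h ▸ hi), hn⟩, rfl⟩

lemma sum_filter_ne_zero (l : Multiset ℕ) : (l.filter (· ≠ 0)).sum = l.sum := by
  induction l using Multiset.induction with
  | empty => rfl
  | cons a l ih =>
    by_cases ha : a = 0
    · rw [Multiset.filter_cons_of_neg (p := fun x => x ≠ 0) _ (not_not.mpr ha), Multiset.sum_cons,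
        ha, zero_add, ih]
    · rw [Multiset.filter_cons_of_pos (p := fun x => x ≠ 0) _ ha, Multiset.sum_cons, Multiset.sum_cons, ih]

lemma sum_map_mul_add (a : ℕ) (κ : Multiset (ℕ × ℕ)) :
    (κ.map fun c => a * c.1 + c.2).sum = a * (κ.map Prod.fst).sum + (κ.map Prod.snd).sum := by
  rw [Multiset.sum_map_add, Multiset.sum_map_mul_left]

lemma mul_add_inj {a : ℕ} {c d : ℕ × ℕ} (hc : c.2 < a) (hd : d.2 < a)
    (h : a * c.1 + c.2 = a * d.1 + d.2) : c = d := by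
  have h1 := congr_arg (· / a) h
  have h2 := congr_arg (· % a) h
  have ha : 0 < a := by omega
  simp only [Nat.mul_add_div ha, Nat.div_eq_of_lt hc, Nat.div_eq_of_lt hd, add_zero] at h1
  simp only [Nat.mul_add_mod, Nat.mod_eq_of_lt hc, Nat.mod_eq_of_lt hd] at h2
  exact Prod.ext h1 h2

lemma genSeries_C_mul {R α : Type*} [CommRing R] (r : R) (f : α → R) {S : Set α} {u : α → ℕ}
    (hS : FiniteFibers S u) :
    PowerSeries.C r * genSeries f S u = genSeries (fun x => r * f x) S u := by
  ext n
  simp only [genSeries, PowerSeries.coeff_C_mul, PowerSeries.coeff_mk]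
  rw [finsum_mem_eq_finite_toFinset_sum _ (hS n), finsum_mem_eq_finite_toFinset_sum _ (hS n),
    Finset.mul_sum]

/-- The multisets of positive integers less than `a`. -/
def smallLabels (a : ℕ) : Set (Multiset ℕ) := {l | 0 ∉ l ∧ ∀ i ∈ l, i < a}

lemma finiteFibers_smallLabels (a : ℕ) : FiniteFibers (smallLabels a) Multiset.sum :=
  finiteFibers_sum.mono fun _ h => h.1

/-- The ways to attach numbers less than `a` to the elements of `ν`. -/
def decorations (a : ℕ) (ν : Multiset ℕ) : Set (Multiset (ℕ × ℕ)) :=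
  {κ | κ.map Prod.fst = ν ∧ ∀ c ∈ κ, c.2 < a}

lemma finite_decorations (a : ℕ) (ν : Multiset ℕ) : (decorations a ν).Finite := by
  classical
  refine (finite_multisets (ν.toFinset ×ˢ Finset.range a) ν.card).subset ?_
  rintro κ ⟨rfl, hκ⟩
  refine ⟨fun c hc => ?_, by rw [Multiset.card_map]⟩
  rw [Finset.mem_product, Multiset.mem_toFinset, Finset.mem_range]
  exact ⟨Multiset.mem_map_of_mem _ hc, hκ c hc⟩

section Laws

variable {R : Type*} [CommRing R]

/-- The series `∑ w_l t ^ |l|` over all partitions. -/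
def totalSeries (w : Multiset ℕ → R) : PowerSeries R := genSeries w {l | 0 ∉ l} Multiset.sum

/-- The series of the configurations that have the labels `ν` and further labels less than `a`. -/
def smallSeries (w : Multiset ℕ → R) (a : ℕ) (ν : Multiset ℕ) : PowerSeries R :=
  genSeries (fun l => w (l + ν)) (smallLabels a) Multiset.sum

variable {w : Multiset ℕ → R}

lemma ConfigLaws.mul_eq_finsum (h : ConfigLaws w) {l m : Multiset ℕ} (hl : 0 ∉ l) (hm : 0 ∉ m) :
    w l * w m = ∑ᶠ κ ∈ {κ | IsSuperposition l m κ}, w (κ.map fun c => Nat.pair c.1 c.2) := by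
  rw [finsum_mem_eq_finite_toFinset_sum _ (finite_isSuperposition l m)]
  exact h.mul l m hl hm _ fun κ => Set.Finite.mem_toFinset _

/-- The pairs of labels in a superposition may be encoded by any injective function with nonzero values. -/
lemma ConfigLaws.map_pair (h : ConfigLaws w) {κ : Multiset (ℕ × ℕ)} (F : ℕ × ℕ → ℕ)
    (hκ : (0, 0) ∉ κ) (hF : ∀ c ∈ κ, F c ≠ 0) (hFi : ∀ c ∈ κ, ∀ d ∈ κ, F c = F d → c = d) :
    w (κ.map fun c => Nat.pair c.1 c.2) = w (κ.map F) := by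
  have h1 : (κ.map fun c => Nat.pair c.1 c.2).map (F ∘ Nat.unpair) = κ.map F := by
    rw [Multiset.map_map]
    simp
  rw [← h1, h.rename]
  · intro h0
    obtain ⟨c, hc, hc0⟩ := Multiset.mem_map.mp h0
    have hc' : c = (0, 0) := by
      have h2 := congr_arg Nat.unpair hc0
      rwa [Nat.unpair_pair, Nat.unpair_zero] at h2
    exact hκ (hc' ▸ hc)
  · rw [h1]
    intro h0
    obtain ⟨c, hc, hc0⟩ := Multiset.mem_map.mp h0
    exact hF c hc hc0
  · intro i hi j hj hij
    obtain ⟨c, hc, rfl⟩ := Multiset.mem_map.mp hi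
    obtain ⟨d, hd, rfl⟩ := Multiset.mem_map.mp hj
    simp only [Function.comp_apply, Nat.unpair_pair] at hij
    rw [hFi c hc d hd hij]

/-- Division with remainder of the labels by `a` factors the series of all configurations. -/
theorem ConfigLaws.totalSeries_eq (h : ConfigLaws w) {a : ℕ} (ha : 0 < a) :
    totalSeries w = genSeries w {l | 0 ∉ l} (fun l => a * l.sum) * smallSeries w a 0 := by
  have hfib : FiniteFibers {l : Multiset ℕ | 0 ∉ l} fun l => a * l.sum := fun n =>
    (finiteFibers_sum (n / a)).subset fun l hl =>
      ⟨hl.1, by rw [← hl.2, Nat.mul_div_cancel_left _ ha]⟩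
  let Y : Set (Multiset (ℕ × ℕ)) := {κ | (0, 0) ∉ κ ∧ ∀ c ∈ κ, c.2 < a}
  let e : Multiset (ℕ × ℕ) → Multiset ℕ × Multiset ℕ := fun κ =>
    ((κ.map Prod.fst).filter (· ≠ 0), (κ.map Prod.snd).filter (· ≠ 0))
  have hY : ∀ l m, m ∈ smallLabels a →
      {κ | κ ∈ Y ∧ e κ = (l, m)} = {κ | IsSuperposition l m κ} := by
    intro l m hm
    ext κ
    constructor
    · rintro ⟨h1, h2⟩
      exact ⟨h1.1, congr_arg Prod.fst h2, congr_arg Prod.snd h2⟩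
    · rintro ⟨h1, h2, h3⟩
      refine ⟨⟨h1, fun c hc => ?_⟩, Prod.ext h2 h3⟩
      by_cases hc0 : c.2 = 0
      · omega
      · refine hm.2 _ ?_
        rw [← h3, Multiset.mem_filter]
        exact ⟨Multiset.mem_map_of_mem _ hc, hc0⟩
  rw [smallSeries, genSeries_mul _ _ hfib (finiteFibers_smallLabels a),
    genSeries_sigma (g := fun κ => w (κ.map fun c => Nat.pair c.1 c.2)) (T := Y) e
      (hfib.prod (finiteFibers_smallLabels a))]
  · refine (genSeries_bijOn (fun κ => κ.map fun c => a * c.1 + c.2) ⟨?_, ?_, ?_⟩ ?_ ?_).symm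
    · intro κ hκ h0
      obtain ⟨c, hc, hc0⟩ := Multiset.mem_map.mp h0
      have h1 : c = (0, 0) := by
        refine mul_add_inj (hκ.2 c hc) ha ?_
        simpa using hc0
      exact hκ.1 (h1 ▸ hc)
    · intro κ hκ κ' hκ' hh
      have h1 : ∀ κ ∈ Y, (κ.map fun c => a * c.1 + c.2).map (fun x => (x / a, x % a)) = κ := by
        intro κ hκ
        rw [Multiset.map_map]
        refine (Multiset.map_congr rfl fun c hc => ?_).trans (Multiset.map_id κ)
        have := hκ.2 c hc
        simp [Nat.mul_add_div ha, Nat.div_eq_of_lt this, Nat.mod_eq_of_lt this]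
      rw [← h1 κ hκ, ← h1 κ' hκ']
      exact congr_arg _ hh
    · intro l hl
      refine ⟨l.map fun x => (x / a, x % a), ⟨fun h0 => ?_, fun c hc => ?_⟩, ?_⟩
      · obtain ⟨x, hx, hx0⟩ := Multiset.mem_map.mp h0
        have h1 := Nat.div_add_mod x a
        rw [(Prod.mk.inj hx0).1, (Prod.mk.inj hx0).2] at h1
        have h2 : x = 0 := by simpa using h1.symm
        exact hl (h2 ▸ hx)
      · obtain ⟨x, hx, rfl⟩ := Multiset.mem_map.mp hc
        exact Nat.mod_lt _ ha
      · change (l.map fun x => (x / a, x % a)).map (fun c => a * c.1 + c.2) = l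
        rw [Multiset.map_map]
        refine (Multiset.map_congr rfl fun x _ => ?_).trans (Multiset.map_id l)
        exact Nat.div_add_mod x a
    · intro κ _
      simp only [Function.comp_apply, e, sum_filter_ne_zero, sum_map_mul_add]
    · intro κ hκ
      refine h.map_pair _ hκ.1 (fun c hc h0 => ?_) fun c hc d hd => mul_add_inj (hκ.2 c hc)
        (hκ.2 d hd)
      have h1 : c = (0, 0) := mul_add_inj (hκ.2 c hc) ha (by simpa using h0)
      exact hκ.1 (h1 ▸ hc)
  · intro κ hκ
    refine ⟨by simp [e], by simp [e], fun i hi => ?_⟩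
    obtain ⟨c, hc, rfl⟩ := Multiset.mem_map.mp (Multiset.mem_of_mem_filter hi)
    exact hκ.2 c hc
  · rintro ⟨l, m⟩ ⟨-, hm⟩
    rw [hY l m hm]
    exact finite_isSuperposition l m
  · rintro ⟨l, m⟩ ⟨hl, hm⟩
    rw [hY l m hm, add_zero]
    exact h.mul_eq_finsum hl hm.1

/-- Superposing the configurations with small labels and the configurations labelled by `ν`: a point
with labels `i` and `r` gets the label `a * i + r`, where `r` is `0` if the point belongs only to the
configuration labelled by `ν`. The points that belong only to the other one keep their labels. -/
theorem ConfigLaws.C_mul_smallSeries (h : ConfigLaws w) {a : ℕ} (ha : 0 < a) {ν : Multiset ℕ}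
    (hν : 0 ∉ ν) : PowerSeries.C (w ν) * smallSeries w a 0 =
      ∑ κ ∈ (finite_decorations a ν).toFinset, PowerSeries.X ^ (κ.map Prod.snd).sum *
        smallSeries w a (κ.map fun c => a * c.1 + c.2) := by
  classical
  let Y : Set (Multiset (ℕ × ℕ)) :=
    {κ | (0, 0) ∉ κ ∧ (κ.map Prod.fst).filter (· ≠ 0) = ν ∧ ∀ c ∈ κ, c.2 < a}
  let e : Multiset (ℕ × ℕ) → Multiset ℕ := fun κ => (κ.map Prod.snd).filter (· ≠ 0)
  have hY : ∀ m, m ∈ smallLabels a →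
      {κ | κ ∈ Y ∧ e κ = m} = {κ | IsSuperposition ν m κ} := by
    intro m hm
    ext κ
    constructor
    · rintro ⟨h1, h2⟩
      exact ⟨h1.1, h1.2.1, h2⟩
    · rintro ⟨h1, h2, h3⟩
      refine ⟨⟨h1, h2, fun c hc => ?_⟩, h3⟩
      by_cases hc0 : c.2 = 0
      · omega
      · refine hm.2 _ ?_
        rw [← h3, Multiset.mem_filter]
        exact ⟨Multiset.mem_map_of_mem _ hc, hc0⟩
  have hpos : ∀ κ ∈ decorations a ν, ∀ c ∈ κ, c.1 ≠ 0 := fun κ hκ c hc h0 =>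
    hν (by rw [← hκ.1, ← h0]; exact Multiset.mem_map_of_mem _ hc)
  rw [smallSeries, genSeries_C_mul _ _ (finiteFibers_smallLabels a),
    genSeries_sigma (g := fun κ => w (κ.map fun c => Nat.pair c.1 c.2)) (T := Y) e
      (finiteFibers_smallLabels a)]
  · unfold smallSeries
    rw [← genSeries_prod_finset (fun p : Multiset (ℕ × ℕ) × Multiset ℕ =>
        w (p.2 + p.1.map fun c => a * c.1 + c.2)) (finite_decorations a ν).toFinset
        (fun κ => (κ.map Prod.snd).sum) (finiteFibers_smallLabels a)]
    refine (genSeries_bijOn (fun p => p.1 + p.2.map fun i => (0, i)) ⟨?_, ?_, ?_⟩ ?_ ?_).symm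
    · rintro ⟨κ, m⟩ ⟨hκ, hm⟩
      rw [Set.Finite.coe_toFinset] at hκ
      refine ⟨fun h0 => ?_, ?_, fun c hc => ?_⟩
      · rcases Multiset.mem_add.mp h0 with h0 | h0
        · exact hpos κ hκ _ h0 rfl
        · obtain ⟨i, hi, hi0⟩ := Multiset.mem_map.mp h0
          exact hm.1 ((Prod.mk.inj hi0).2 ▸ hi)
      · rw [Multiset.map_add, hκ.1, Multiset.map_map, Multiset.filter_add,
          (Multiset.filter_eq_self (p := fun x => x ≠ 0)).mpr fun i hi h0 => hν (h0 ▸ hi),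
          Multiset.filter_eq_nil.mpr]
        · exact add_zero _
        · intro i hi
          obtain ⟨_, _, rfl⟩ := Multiset.mem_map.mp hi
          simp
      · rcases Multiset.mem_add.mp hc with hc | hc
        · exact hκ.2 c hc
        · obtain ⟨i, hi, rfl⟩ := Multiset.mem_map.mp hc
          exact hm.2 i hi
    · rintro ⟨κ, m⟩ ⟨hκ, hm⟩ ⟨κ', m'⟩ ⟨hκ', hm'⟩ hh
      rw [Set.Finite.coe_toFinset] at hκ hκ'
      have h1 : ∀ κ ∈ decorations a ν, ∀ m : Multiset ℕ,
          (κ + m.map fun i => (0, i)).filter (fun c => c.1 ≠ 0) = κ := by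
        intro κ hκ m
        rw [Multiset.filter_add, Multiset.filter_eq_self.mpr (hpos κ hκ),
          Multiset.filter_eq_nil.mpr, add_zero]
        intro c hc
        obtain ⟨i, _, rfl⟩ := Multiset.mem_map.mp hc
        simp
      have h2 : κ = κ' := by
        rw [← h1 κ hκ m, ← h1 κ' hκ' m']
        exact congr_arg _ hh
      subst h2
      have h3 : (m.map fun i => ((0 : ℕ), i)) = m'.map fun i => (0, i) := add_left_cancel hh
      rw [Multiset.map_injective (fun i j hij => (Prod.mk.inj hij).2) h3]
    · rintro κ ⟨h0, hκν, hκa⟩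
      refine ⟨(κ.filter fun c => c.1 ≠ 0, (κ.filter fun c => ¬ c.1 ≠ 0).map Prod.snd),
        ⟨?_, ?_, ?_⟩, ?_⟩
      · rw [Set.Finite.coe_toFinset]
        refine ⟨?_, fun c hc => hκa c (Multiset.mem_of_mem_filter hc)⟩
        rw [← hκν, Multiset.filter_map]
        rfl
      · intro hm
        obtain ⟨⟨c, d⟩, hc, hc0⟩ := Multiset.mem_map.mp hm
        obtain ⟨hc1, hc2⟩ := Multiset.mem_filter.mp hc
        simp only [not_not] at hc2 hc0
        rw [hc2, hc0] at hc1
        exact h0 hc1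
      · intro i hi
        obtain ⟨c, hc, rfl⟩ := Multiset.mem_map.mp hi
        exact hκa c (Multiset.mem_of_mem_filter hc)
      · change (κ.filter fun c => c.1 ≠ 0) +
          ((κ.filter fun c => ¬ c.1 ≠ 0).map Prod.snd).map (fun i => (0, i)) = κ
        rw [Multiset.map_map]
        conv_rhs => rw [← Multiset.filter_add_not (fun c : ℕ × ℕ => c.1 ≠ 0) κ]
        refine congr_arg _ ((Multiset.map_congr rfl fun c hc => ?_).trans (Multiset.map_id _))
        have := (Multiset.mem_filter.mp hc).2
        exact Prod.ext (not_not.mp this).symm rfl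
    · rintro ⟨κ, m⟩ ⟨hκ, hm⟩
      simp only [Function.comp_apply, e, sum_filter_ne_zero, Multiset.map_add, Multiset.map_map,
        Multiset.sum_add]
      simp
    · rintro ⟨κ, m⟩ ⟨hκ, hm⟩
      rw [Set.Finite.coe_toFinset] at hκ
      have h1 : ((κ + m.map fun i => ((0 : ℕ), i)).map fun c => a * c.1 + c.2) =
          m + κ.map fun c => a * c.1 + c.2 := by
        rw [Multiset.map_add, Multiset.map_map, add_comm]
        simp
      have hlt : ∀ c ∈ κ + m.map fun i => ((0 : ℕ), i), c.2 < a := by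
        intro c hc
        rcases Multiset.mem_add.mp hc with hc | hc
        · exact hκ.2 c hc
        · obtain ⟨i, hi, rfl⟩ := Multiset.mem_map.mp hc
          exact hm.2 i hi
      have h0 : (0, 0) ∉ κ + m.map fun i => ((0 : ℕ), i) := by
        intro h0
        rcases Multiset.mem_add.mp h0 with h0 | h0
        · exact hpos κ hκ _ h0 rfl
        · obtain ⟨i, hi, hi0⟩ := Multiset.mem_map.mp h0
          exact hm.1 ((Prod.mk.inj hi0).2 ▸ hi)
      have h2 := h.map_pair (fun c => a * c.1 + c.2) h0 (fun c hc hc0 => by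
        have h3 : c = (0, 0) := mul_add_inj (hlt c hc) ha (by simpa using hc0)
        exact h0 (h3 ▸ hc)) fun c hc d hd => mul_add_inj (hlt c hc) (hlt d hd)
      rw [h1] at h2
      exact h2.symm
  · intro κ hκ
    refine ⟨by simp [e], fun i hi => ?_⟩
    obtain ⟨c, hc, rfl⟩ := Multiset.mem_map.mp (Multiset.mem_of_mem_filter hi)
    exact hκ.2.2 c hc
  · intro m hm
    rw [hY m hm]
    exact finite_isSuperposition ν m
  · intro m hm
    rw [hY m hm, add_zero]
    exact h.mul_eq_finsum hν hm.1

end Laws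

end

section

/-! ### The refinement ordering -/

lemma RefineLE.add_right {l m : Multiset ℕ} (h : RefineLE l m) (s : Multiset ℕ) :
    RefineLE (l + s) (m + s) := by
  refine Relation.ReflTransGen.lift (· + s) ?_ _ _ h
  rintro _ _ ⟨x, y, r, rfl, rfl⟩
  exact ⟨x, y, r + s, by simp, by simp⟩

lemma RefineLE.add {l m l' m' : Multiset ℕ} (h : RefineLE l m) (h' : RefineLE l' m') :
    RefineLE (l + l') (m + m') := by
  refine (h.add_right l').trans ?_
  rw [add_comm m, add_comm m]
  exact h'.add_right m

lemma refineLE_singleton_sum {c : Multiset ℕ} (hc : c ≠ 0) : RefineLE c {c.sum} := by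
  induction c using Multiset.induction with
  | empty => exact absurd rfl hc
  | cons x c ih =>
    by_cases h : c = 0
    · subst h
      simp only [Multiset.cons_zero, Multiset.sum_singleton]
      exact .refl
    · have h1 := (ih h).add_right {x}
      rw [add_comm c, Multiset.singleton_add] at h1
      refine h1.tail ⟨x, c.sum, 0, ?_, ?_⟩
      · rw [add_comm]; rfl
      · rw [Multiset.sum_cons]; rfl

/-- Merging the elements of each block gives a coarser multiset. -/
lemma refineLE_of_blocks (Cs : Multiset (Multiset ℕ)) (h : ∀ c ∈ Cs, c ≠ 0) :
    RefineLE Cs.sum (Cs.map Multiset.sum) := by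
  induction Cs using Multiset.induction with
  | empty => exact .refl
  | cons c Cs ih =>
    rw [Multiset.sum_cons, Multiset.map_cons, ← Multiset.singleton_add]
    exact (refineLE_singleton_sum (h c (Multiset.mem_cons_self _ _))).add
      (ih fun d hd => h d (Multiset.mem_cons_of_mem hd))

lemma RefineLE.exists_blocks {l m : Multiset ℕ} (h : RefineLE l m) :
    ∃ Cs : Multiset (Multiset ℕ), Cs.sum = l ∧ Cs.map Multiset.sum = m := by
  induction h with
  | refl =>
    refine ⟨l.map fun x => {x}, Multiset.sum_map_singleton l, ?_⟩
    rw [Multiset.map_map]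
    simp
  | tail _ h ih =>
    obtain ⟨Cs, hs, hm⟩ := ih
    obtain ⟨x, y, r, rfl, rfl⟩ := h
    obtain ⟨c, hc, rfl, h1⟩ := (Multiset.map_eq_cons _ _ _ _).mpr hm
    obtain ⟨d, hd, rfl, h2⟩ := (Multiset.map_eq_cons _ _ _ _).mpr h1
    refine ⟨(c + d) ::ₘ (Cs.erase c).erase d, ?_, ?_⟩
    · rw [Multiset.sum_cons, add_assoc, ← Multiset.sum_cons, Multiset.cons_erase hd,
        ← Multiset.sum_cons, Multiset.cons_erase hc, hs]
    · rw [Multiset.map_cons, Multiset.sum_add, h2]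

lemma map_val_eq_sum_singleton {α β : Type*} (s : Finset α) (f : α → β) :
    s.val.map f = ∑ x ∈ s, {f x} := by
  have h := Multiset.sum_map_singleton (s.val.map f)
  rw [Multiset.map_map] at h
  exact h.symm

lemma multPartition_map {α : Type*} [DecidableEq α] (κ : Multiset α) {f : α → ℕ}
    (hf : ∀ x ∈ κ, ∀ y ∈ κ, f x = f y → x = y) :
    multPartition (κ.map f) = κ.toFinset.val.map fun x => κ.count x := by
  have hinj : Set.InjOn f (κ.toFinset : Set α) := fun x hx y hy h =>
    hf x (Multiset.mem_toFinset.mp hx) y (Multiset.mem_toFinset.mp hy) h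
  rw [multPartition, Multiset.toFinset_map, Finset.image_val_of_injOn hinj, Multiset.map_map]
  refine Multiset.map_congr rfl fun x hx => ?_
  exact Multiset.count_map_eq_count f κ
    (fun y hy z hz h => hf y hy z hz h) x
    (Multiset.mem_toFinset.mp hx)

/-- Identifying some of the labels merges multiplicities. -/
lemma refineLE_multPartition {α : Type*} (κ : Multiset α) {f : α → ℕ} (g : α → ℕ)
    (hf : ∀ x ∈ κ, ∀ y ∈ κ, f x = f y → x = y) :
    RefineLE (multPartition (κ.map f)) (multPartition (κ.map g)) := by
  classical
  have h := refineLE_of_blocks ((κ.map g).toFinset.val.map fun i =>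
    (κ.toFinset.filter (g · = i)).val.map fun x => κ.count x) (by
      intro c hc
      obtain ⟨i, hi, rfl⟩ := Multiset.mem_map.mp hc
      obtain ⟨x, hx, rfl⟩ := Multiset.mem_map.mp (Multiset.mem_toFinset.mp hi)
      intro h0
      rw [Multiset.map_eq_zero, Finset.val_eq_zero, Finset.filter_eq_empty_iff] at h0
      exact h0 (Multiset.mem_toFinset.mpr hx) rfl)
  convert h using 1
  · rw [multPartition_map κ hf, map_val_eq_sum_singleton,
      ← Finset.sum_fiberwise_of_maps_to (t := (κ.map g).toFinset) (g := g) fun x hx =>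
        Multiset.mem_toFinset.mpr (Multiset.mem_map_of_mem g (Multiset.mem_toFinset.mp hx))]
    exact Finset.sum_congr rfl fun i _ => (map_val_eq_sum_singleton _ _).symm
  · rw [Multiset.map_map, multPartition]
    refine Multiset.map_congr rfl fun i _ => ?_
    rw [Multiset.count_map, Function.comp_apply]
    have h1 : (κ.filter fun x => i = g x).toFinset = κ.toFinset.filter (g · = i) := by
      ext x
      simp [eq_comm]
    rw [← Multiset.toFinset_sum_count_eq, h1]
    refine Finset.sum_congr rfl fun x hx => ?_
    exact Multiset.count_filter_of_pos (Finset.mem_filter.mp hx).2.symm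

/-! ### Rational combinations of power series -/

section RatComb

variable {R ι : Type*} [CommRing R]

/-- `f` is a linear combination of the series `u i`, `i ∈ P`, where the coefficients are quotients
of integer polynomials with denominators of constant coefficient `1`. -/
def RatComb (u : ι → PowerSeries R) (P : Set ι) (f : PowerSeries R) : Prop :=
  ∃ (α : ι →₀ Polynomial ℤ) (B : Polynomial ℤ), (∀ i ∈ α.support, i ∈ P) ∧ B.coeff 0 = 1 ∧
    intPoly B * f = α.sum fun i p => intPoly p * u i

lemma intPoly_mul (p q : Polynomial ℤ) :
    (intPoly (p * q) : PowerSeries R) = intPoly p * intPoly q := map_mul _ _ _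

lemma intPoly_X_pow (n : ℕ) :
    (intPoly (Polynomial.X ^ n) : PowerSeries R) = PowerSeries.X ^ n := by
  simp [intPoly]

lemma intPoly_sum {A : Type*} (s : Finset A) (p : A → Polynomial ℤ) :
    (intPoly (∑ i ∈ s, p i) : PowerSeries R) = ∑ i ∈ s, intPoly (p i) := map_sum _ _ _

namespace RatComb

variable {u : ι → PowerSeries R} {P : Set ι} {f g : PowerSeries R}

lemma zero : RatComb u P 0 := ⟨0, 1, by simp, by simp, by simp⟩

lemma base {i : ι} (hi : i ∈ P) : RatComb u P (u i) := by
  classical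
  refine ⟨Finsupp.single i 1, 1, fun j hj => ?_, by simp, ?_⟩
  · rw [Finset.mem_singleton.mp (Finsupp.support_single_subset hj)]
    exact hi
  · rw [Finsupp.sum_single_index (by simp [intPoly])]

lemma mono {Q : Set ι} (hPQ : P ⊆ Q) (h : RatComb u P f) : RatComb u Q f := by
  obtain ⟨α, B, h1, h2⟩ := h
  exact ⟨α, B, fun i hi => hPQ (h1 i hi), h2⟩

lemma sum_smul (α : ι →₀ Polynomial ℤ) (q : Polynomial ℤ) :
    ((q • α).sum fun i p => intPoly p * u i) =
      intPoly q * α.sum fun i p => intPoly p * u i := by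
  rw [Finsupp.sum_smul_index (fun i => by simp [intPoly]), Finsupp.mul_sum]
  exact Finsupp.sum_congr fun i _ => by rw [intPoly_mul, mul_assoc]

lemma add (hf : RatComb u P f) (hg : RatComb u P g) : RatComb u P (f + g) := by
  classical
  obtain ⟨α, B, h1, h2, h3⟩ := hf
  obtain ⟨β, D, h4, h5, h6⟩ := hg
  refine ⟨D • α + B • β, B * D, fun i hi => ?_, by simp [Polynomial.mul_coeff_zero, h2, h5], ?_⟩
  · rcases Finset.mem_union.mp (Finsupp.support_add hi) with h | h
    · exact h1 i (Finsupp.support_smul h)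
    · exact h4 i (Finsupp.support_smul h)
  · rw [Finsupp.sum_add_index' (fun i => by simp [intPoly]) fun i p q => by
      simp [intPoly, add_mul], sum_smul, sum_smul, ← h3, ← h6, intPoly_mul]
    ring

lemma intPoly_mul (p : Polynomial ℤ) (hf : RatComb u P f) : RatComb u P (intPoly p * f) := by
  obtain ⟨α, B, h1, h2, h3⟩ := hf
  refine ⟨p • α, B, fun i hi => h1 i (Finsupp.support_smul hi), h2, ?_⟩
  rw [sum_smul, ← h3]
  ring

lemma X_pow_mul (n : ℕ) (hf : RatComb u P f) : RatComb u P (PowerSeries.X ^ n * f) := by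
  rw [← intPoly_X_pow]
  exact hf.intPoly_mul _

lemma neg (hf : RatComb u P f) : RatComb u P (-f) := by
  have h := hf.intPoly_mul (-1)
  simpa [intPoly] using h

lemma sub (hf : RatComb u P f) (hg : RatComb u P g) : RatComb u P (f - g) := by
  rw [sub_eq_add_neg]
  exact hf.add hg.neg

lemma sum {A : Type*} (s : Finset A) {F : A → PowerSeries R} (h : ∀ i ∈ s, RatComb u P (F i)) :
    RatComb u P (∑ i ∈ s, F i) := by
  classical
  induction s using Finset.induction_on with
  | empty => exact zero
  | insert i s hi ih =>
    rw [Finset.sum_insert hi]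
    exact (h i (Finset.mem_insert_self _ _)).add (ih fun j hj => h j (Finset.mem_insert_of_mem hj))

lemma of_intPoly_mul {B : Polynomial ℤ} (hB : B.coeff 0 = 1) (h : RatComb u P (intPoly B * f)) :
    RatComb u P f := by
  obtain ⟨α, D, h1, h2, h3⟩ := h
  exact ⟨α, D * B, h1, by simp [Polynomial.mul_coeff_zero, h2, hB], by
    rw [MotivicConf.intPoly_mul, mul_assoc, h3]⟩

/-- Multiplying by a series and changing the names of the generators. -/
lemma mul_left {κ : Type*} {v : κ → PowerSeries R} {Q : Set κ} (r : PowerSeries R) (e : ι → κ)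
    (he : ∀ i ∈ P, v (e i) = r * u i ∧ e i ∈ Q) (hf : RatComb u P f) :
    RatComb v Q (r * f) := by
  classical
  obtain ⟨α, B, h1, h2, h3⟩ := hf
  refine of_intPoly_mul h2 ?_
  rw [mul_left_comm, h3, Finsupp.mul_sum]
  refine sum _ fun i hi => ?_
  have h4 := he i (h1 i hi)
  beta_reduce
  rw [mul_left_comm, ← h4.1]
  exact (base h4.2).intPoly_mul _

end RatComb

end RatComb

/-! ### Configurations with few large labels -/

section Laws

variable {R : Type*} [CommRing R] {w : Multiset ℕ → R}

/-- If equal labels `i` of `ν` receive equal remainders `r`, then the labels `a * i + r` form a relabelling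
of `ν`, so that they have the same series of configurations with further small labels. -/
lemma ConfigLaws.smallSeries_eq (h : ConfigLaws w) {a : ℕ} {ν : Multiset ℕ}
    (hν : ∀ i ∈ ν, a ≤ i) (ha : 0 < a) {κ : Multiset (ℕ × ℕ)} (hκ : κ ∈ decorations a ν)
    (hi : ∀ c ∈ κ, ∀ d ∈ κ, c.1 = d.1 → c = d) :
    smallSeries w a (κ.map fun c => a * c.1 + c.2) = smallSeries w a ν := by
  refine genSeries_congr rfl (fun _ _ => rfl) fun l hl => ?_
  let e : ℕ → ℕ := fun x => if x < a then x else x / a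
  have h1 : ∀ i ∈ l, e i = i := fun i hi' => if_pos (hl.2 i hi')
  have hge : ∀ c ∈ κ, a ≤ c.1 := fun c hc => hν _ (hκ.1 ▸ Multiset.mem_map_of_mem _ hc)
  have h2 : ∀ c ∈ κ, e (a * c.1 + c.2) = c.1 := fun c hc => by
    have h3 := hge c hc
    have h4 : ¬ a * c.1 + c.2 < a := by nlinarith
    simp only [e, if_neg h4]
    rw [Nat.mul_add_div ha, Nat.div_eq_of_lt (hκ.2 c hc), add_zero]
  have h3 : (l + κ.map fun c => a * c.1 + c.2).map e = l + ν := by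
    rw [Multiset.map_add, Multiset.map_map, ← hκ.1]
    congr 1
    · exact (Multiset.map_congr rfl h1).trans (Multiset.map_id _)
    · exact Multiset.map_congr rfl h2
  rw [← h3, h.rename]
  · intro h0
    rcases Multiset.mem_add.mp h0 with h0 | h0
    · exact hl.1 h0
    · obtain ⟨c, hc, hc0⟩ := Multiset.mem_map.mp h0
      have := hge c hc
      have : 0 < a * c.1 := Nat.mul_pos ha (by omega)
      omega
  · rw [h3]
    intro h0
    rcases Multiset.mem_add.mp h0 with h0 | h0
    · exact hl.1 h0
    · exact absurd (hν 0 h0) (by omega)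
  · intro x hx y hy hxy
    rcases Multiset.mem_add.mp hx with hx | hx <;> rcases Multiset.mem_add.mp hy with hy | hy
    · rwa [h1 x hx, h1 y hy] at hxy
    · obtain ⟨c, hc, rfl⟩ := Multiset.mem_map.mp hy
      rw [h1 x hx, h2 c hc] at hxy
      exact absurd (hl.2 x hx) (by have := hge c hc; omega)
    · obtain ⟨c, hc, rfl⟩ := Multiset.mem_map.mp hx
      rw [h1 y hy, h2 c hc] at hxy
      exact absurd (hl.2 y hy) (by have := hge c hc; omega)
    · obtain ⟨c, hc, rfl⟩ := Multiset.mem_map.mp hx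
      obtain ⟨d, hd, rfl⟩ := Multiset.mem_map.mp hy
      rw [h2 c hc, h2 d hd] at hxy
      rw [hi c hc d hd hxy]

/-- The generators of the rational combinations that express `smallSeries w a ν`. -/
def sameShape (ν : Multiset ℕ) : Set (Multiset ℕ) :=
  {ν' | 0 ∉ ν' ∧ ν'.card = ν.card ∧ RefineLE (multPartition ν') (multPartition ν)}

/-- `ConfigLaws.C_mul_smallSeries` is a linear equation between the series `smallSeries w a ν'`, where
the labels of `ν'` are `a * i + r` for the parts `i` of `ν` and certain remainders `r < a`. Either
equal labels receive equal remainders, and then `ν'` has the same series as `ν`; or `ν'` has more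
distinct labels than `ν`, and induction on the number of coincidences among the labels applies. -/
theorem ConfigLaws.ratComb_smallSeries (h : ConfigLaws w) {a : ℕ} (ha : 0 < a) (ν : Multiset ℕ)
    (hν : ∀ i ∈ ν, a ≤ i) : RatComb (fun ν' => smallSeries w a 0 * PowerSeries.C (w ν'))
      (sameShape ν) (smallSeries w a ν) := by
  classical
  induction hn : ν.card - ν.toFinset.card using Nat.strong_induction_on generalizing ν with
  | _ n ih =>
  subst hn
  have hν0 : 0 ∉ ν := fun h0 => absurd (hν 0 h0) (by omega)
  let T := (finite_decorations a ν).toFinset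
  have hT : ∀ κ ∈ T, κ ∈ decorations a ν := fun κ => (Set.Finite.mem_toFinset _).mp
  let U : Multiset (ℕ × ℕ) → Prop := fun κ => ∀ c ∈ κ, ∀ d ∈ κ, c.1 = d.1 → c = d
  -- the constant coefficient is `1` since only the zero remainders contribute to it
  let B : Polynomial ℤ := ∑ κ ∈ T with U κ, Polynomial.X ^ (κ.map Prod.snd).sum
  have hB : B.coeff 0 = 1 := by
    have hκ₀ : ν.map (fun n => (n, 0)) ∈ T.filter U := by
      rw [Finset.mem_filter, Set.Finite.mem_toFinset]
      refine ⟨⟨by rw [Multiset.map_map]; simp, fun c hc => ?_⟩, fun c hc d hd hcd => ?_⟩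
      · obtain ⟨_, _, rfl⟩ := Multiset.mem_map.mp hc
        exact ha
      · obtain ⟨_, _, rfl⟩ := Multiset.mem_map.mp hc
        obtain ⟨_, _, rfl⟩ := Multiset.mem_map.mp hd
        exact Prod.ext hcd rfl
    simp only [B, Polynomial.finsetSum_coeff, Polynomial.coeff_X_pow]
    rw [Finset.sum_eq_single_of_mem _ hκ₀]
    · rw [Multiset.map_map]
      simp
    · intro κ hκ hne
      rw [if_neg]
      intro h0
      apply hne
      have h1 : ∀ c ∈ κ, c = (c.1, 0) := fun c hc => by
        refine Prod.ext rfl (Multiset.sum_eq_zero_iff.mp h0.symm _ (Multiset.mem_map_of_mem _ hc))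
      rw [← (hT κ (Finset.mem_filter.mp hκ).1).1, Multiset.map_map]
      exact ((Multiset.map_congr rfl fun c hc => (h1 c hc).symm).trans (Multiset.map_id κ)).symm
  have key := h.C_mul_smallSeries ha hν0
  rw [← Finset.sum_filter_add_sum_filter_not _ U] at key
  have h1 : ∑ κ ∈ T with U κ, PowerSeries.X ^ (κ.map Prod.snd).sum *
      smallSeries w a (κ.map fun c => a * c.1 + c.2) = intPoly B * smallSeries w a ν := by
    rw [intPoly_sum, Finset.sum_mul]
    refine Finset.sum_congr rfl fun κ hκ => ?_
    obtain ⟨h1, h2⟩ := Finset.mem_filter.mp hκ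
    rw [h.smallSeries_eq hν ha (hT κ h1) h2, intPoly_X_pow]
  rw [h1] at key
  refine RatComb.of_intPoly_mul hB ?_
  rw [← sub_eq_iff_eq_add] at key
  rw [← key, mul_comm]
  refine RatComb.sub (RatComb.base (u := fun ν' => smallSeries w a 0 * PowerSeries.C (w ν'))
    ⟨hν0, rfl, .refl⟩) (RatComb.sum _ fun κ hκ => RatComb.X_pow_mul _ ?_)
  obtain ⟨hκT, hκU⟩ := Finset.mem_filter.mp hκ
  have hκ' := hT κ hκT
  have hF : ∀ c ∈ κ, ∀ d ∈ κ, a * c.1 + c.2 = a * d.1 + d.2 → c = d := fun c hc d hd =>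
    mul_add_inj (hκ'.2 c hc) (hκ'.2 d hd)
  have hcard : (κ.map fun c => a * c.1 + c.2).card = ν.card := by
    rw [Multiset.card_map, ← hκ'.1, Multiset.card_map]
  -- two equal labels with different remainders have become distinct
  have hlt : (κ.map fun c => a * c.1 + c.2).card -
      (κ.map fun c => a * c.1 + c.2).toFinset.card < ν.card - ν.toFinset.card := by
    have e1 : (κ.map fun c => a * c.1 + c.2).toFinset.card = κ.toFinset.card := by
      rw [Multiset.toFinset_map, Finset.card_image_of_injOn]
      exact fun c hc d hd => hF c (Multiset.mem_toFinset.mp hc) d (Multiset.mem_toFinset.mp hd)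
    have e2 : ν.toFinset.card < κ.toFinset.card := by
      rw [← hκ'.1, Multiset.toFinset_map]
      refine lt_of_le_of_ne Finset.card_image_le fun he => hκU ?_
      rw [Finset.card_image_iff] at he
      exact fun c hc d hd => he (Multiset.mem_toFinset.mpr hc) (Multiset.mem_toFinset.mpr hd)
    have e3 := Multiset.toFinset_card_le (κ.map fun c => a * c.1 + c.2)
    rw [hcard] at e3 ⊢
    omega
  have hge : ∀ x ∈ κ.map fun c => a * c.1 + c.2, a ≤ x := by
    intro x hx
    obtain ⟨c, hc, rfl⟩ := Multiset.mem_map.mp hx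
    have := hν _ (hκ'.1 ▸ Multiset.mem_map_of_mem Prod.fst hc)
    nlinarith
  have h5 := refineLE_multPartition κ Prod.fst hF
  rw [hκ'.1] at h5
  generalize (κ.map fun c => a * c.1 + c.2) = μ at *
  refine (ih _ hlt μ hge rfl).mono ?_
  rintro ν' ⟨h2, h3, h4⟩
  exact ⟨h2, h3.trans hcard, h4.trans h5⟩

end Laws

end

section

/-! ### Packing a partition into another one -/

/-- The parts of `ν` can be distributed to the parts of `l` in such a way that each part of `l` is
at least the sum of what it receives. -/
def Packs (ν l : Multiset ℕ) : Prop :=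
  ∃ Cs : Multiset (Multiset ℕ), Cs.sum = ν ∧ Multiset.Rel (fun c b => c.sum ≤ b) Cs l

lemma exists_rel_le_of_le_sum (Cs : Multiset (Multiset ℕ)) {ν : Multiset ℕ} (h : ν ≤ Cs.sum) :
    ∃ Ds : Multiset (Multiset ℕ), Ds.sum = ν ∧ Multiset.Rel (fun d c => d ≤ c) Ds Cs := by
  induction Cs using Multiset.induction generalizing ν with
  | empty =>
    rw [Multiset.sum_zero, Multiset.le_zero] at h
    exact ⟨0, h.symm, .zero⟩
  | cons c Cs ih =>
    rw [Multiset.sum_cons] at h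
    obtain ⟨Ds, h1, h2⟩ := ih (ν := ν - c) (by rwa [tsub_le_iff_left])
    refine ⟨(ν ∩ c) ::ₘ Ds, ?_, .cons Multiset.inter_le_right h2⟩
    rw [Multiset.sum_cons, h1, add_comm]
    exact Multiset.sub_add_inter ν c

lemma sum_le_sum_of_multiset_le {l m : Multiset ℕ} (h : l ≤ m) : l.sum ≤ m.sum := by
  obtain ⟨s, rfl⟩ := Multiset.le_iff_exists_add.mp h
  rw [Multiset.sum_add]
  exact Nat.le_add_right _ _

lemma Packs.mono {ν ν' l : Multiset ℕ} (h : Packs ν l) (hν : ν' ≤ ν) : Packs ν' l := by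
  obtain ⟨Cs, rfl, h⟩ := h
  obtain ⟨Ds, h1, h2⟩ := exists_rel_le_of_le_sum Cs hν
  refine ⟨Ds, h1, ?_⟩
  clear h1 hν
  induction h2 generalizing l with
  | zero => exact h
  | cons hdc _ ih =>
    obtain ⟨b, l', hb, hl, rfl⟩ := Multiset.rel_cons_left.mp h
    exact .cons ((sum_le_sum_of_multiset_le hdc).trans hb) (ih hl)

lemma packs_zero (l : Multiset ℕ) : Packs 0 l := by
  induction l using Multiset.induction with
  | empty => exact ⟨0, rfl, .zero⟩
  | cons b l ih =>
    obtain ⟨Cs, h1, h2⟩ := ih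
    exact ⟨0 ::ₘ Cs, by rw [Multiset.sum_cons, h1, add_zero], .cons (Nat.zero_le _) h2⟩

/-- Packings are put side by side. -/
lemma Packs.add {ν ν' l l' : Multiset ℕ} (h : Packs ν l) (h' : Packs ν' l') :
    Packs (ν + ν') (l + l') := by
  obtain ⟨Cs, rfl, h⟩ := h
  obtain ⟨Ds, rfl, h'⟩ := h'
  exact ⟨Cs + Ds, Multiset.sum_add _ _, h.add h'⟩

/-- Refinements of `l` by parts `1` and the parts of `ν` are packings of `ν` into `l`. -/
lemma refineLE_replicate_one_add_iff {ν l : Multiset ℕ} {j : ℕ} (hl : 0 ∉ l)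
    (hj : l.sum = j + ν.sum) : RefineLE (Multiset.replicate j 1 + ν) l ↔ Packs ν l := by
  constructor
  · intro h
    obtain ⟨Cs, h1, rfl⟩ := h.exists_blocks
    refine Packs.mono (ν := Cs.sum) ⟨Cs, rfl, ?_⟩ (h1 ▸ Multiset.le_add_left _ _)
    rw [Multiset.rel_map_right]
    exact Multiset.rel_refl_of_refl_on fun c _ => le_rfl
  · rintro ⟨Cs, rfl, h⟩
    -- each part of `l` is filled up with parts `1`
    obtain ⟨Ds, i, h1, h2⟩ : ∃ (Ds : Multiset (Multiset ℕ)) (i : ℕ),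
        Ds.sum = Multiset.replicate i 1 + Cs.sum ∧ Ds.map Multiset.sum = l := by
      clear hj hl
      induction h with
      | zero => exact ⟨0, 0, rfl, rfl⟩
      | @cons c b Cs l hcb _ ih =>
        obtain ⟨Ds, i, h1, h2⟩ := ih
        refine ⟨(Multiset.replicate (b - c.sum) 1 + c) ::ₘ Ds, (b - c.sum) + i, ?_, ?_⟩
        · rw [Multiset.sum_cons, h1, Multiset.sum_cons, Multiset.replicate_add]
          abel
        · rw [Multiset.map_cons, h2, Multiset.sum_add, Multiset.sum_replicate, smul_eq_mul, mul_one,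
            Nat.sub_add_cancel hcb]
    have h3 : i = j := by
      have h4 : (Ds.map Multiset.sum).sum = Ds.sum.sum := by
        clear h1 h2
        induction Ds using Multiset.induction with
        | empty => rfl
        | cons c Ds ih => rw [Multiset.map_cons, Multiset.sum_cons, Multiset.sum_cons,
            Multiset.sum_add, ih]
      rw [h1, h2, hj, Multiset.sum_add, Multiset.sum_replicate, smul_eq_mul, mul_one] at h4
      omega
    rw [← h3, ← h1, ← h2]
    refine refineLE_of_blocks Ds fun c hc h0 => hl ?_
    rw [← h2]
    exact Multiset.mem_map.mpr ⟨c, hc, by rw [h0]; rfl⟩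

/-- Some part of `l` that is at least `e` receives nothing, since there are more such parts than parts
to be distributed; it takes `e`. -/
lemma exists_empty_block {e : ℕ} {Cs : Multiset (Multiset ℕ)} {l : Multiset ℕ}
    (h : Multiset.Rel (fun c b => c.sum ≤ b) Cs l) (he : Cs.sum.card < (l.filter (e ≤ ·)).card) :
    Packs (e ::ₘ Cs.sum) l := by
  induction h with
  | zero => simp at he
  | @cons c b Cs l hcb hrel ih =>
    rw [Multiset.sum_cons, Multiset.card_add] at he
    have hIH : Cs.sum.card < (l.filter (e ≤ ·)).card →
        Packs (e ::ₘ (c ::ₘ Cs).sum) (b ::ₘ l) := by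
      intro h1
      have h2 : Packs c {b} := ⟨{c}, Multiset.sum_singleton c, Multiset.rel_cons_left.mpr
        ⟨b, 0, hcb, .zero, rfl⟩⟩
      have h3 := h2.add (ih h1)
      rw [Multiset.add_cons, Multiset.singleton_add] at h3
      rwa [Multiset.sum_cons]
    by_cases heb : e ≤ b
    · rw [Multiset.filter_cons_of_pos (p := fun i => e ≤ i) _ heb, Multiset.card_cons] at he
      by_cases hc : c = 0
      · subst hc
        refine ⟨{e} ::ₘ Cs, ?_, .cons (by rwa [Multiset.sum_singleton]) hrel⟩
        rw [Multiset.sum_cons, Multiset.sum_cons, zero_add, Multiset.singleton_add]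
      · have := Multiset.card_pos.mpr hc
        exact hIH (by omega)
    · rw [Multiset.filter_cons_of_neg (p := fun i => e ≤ i) _ heb] at he
      exact hIH (by omega)

/-- If many parts of `l` are at least `e`, then there remains space for a further part `e`. -/
lemma packs_cons_iff {e : ℕ} {ν l : Multiset ℕ} (h : ν.card < (l.filter (e ≤ ·)).card) :
    Packs (e ::ₘ ν) l ↔ Packs ν l := by
  refine ⟨fun h' => h'.mono (Multiset.le_cons_self _ _), ?_⟩
  rintro ⟨Cs, rfl, hrel⟩
  exact exists_empty_block hrel h

/-- The parts of `l` that are at least `e`, capped at `M`. -/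
def capped (e M : ℕ) (l : Multiset ℕ) : Multiset ℕ := (l.filter (e ≤ ·)).map (min M)

lemma packs_map_min_iff {ν l : Multiset ℕ} {M : ℕ} (hM : ν.sum ≤ M) :
    Packs ν (l.map (min M)) ↔ Packs ν l := by
  refine exists_congr fun Cs => and_congr_right fun h => ?_
  rw [Multiset.rel_map_right]
  subst h
  have h1 : ∀ c ∈ Cs, c.sum ≤ M := fun c hc =>
    (sum_le_sum_of_multiset_le (Multiset.single_le_sum (fun _ _ => Multiset.zero_le _) c hc)).trans
      hM
  constructor
  · exact fun h => h.mono fun c _ b _ hcb => hcb.trans (min_le_right _ _)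
  · exact fun h => h.mono fun c hc b _ hcb => le_min (h1 c hc) hcb

lemma packs_filter_iff {ν l : Multiset ℕ} {e : ℕ} (he : ∀ i ∈ ν, e ≤ i) :
    Packs ν (l.filter (e ≤ ·)) ↔ Packs ν l := by
  constructor
  · intro h
    have h1 := h.add (packs_zero (l.filter fun i => ¬ e ≤ i))
    rwa [add_zero, Multiset.filter_add_not] at h1
  · rintro ⟨Cs, rfl, h⟩
    induction h with
    | zero => exact packs_zero 0
    | @cons c b Cs l hcb hrel ih =>
      rw [Multiset.sum_cons] at he ⊢
      have h1 := ih fun i hi => he i (Multiset.mem_add.mpr (Or.inr hi))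
      by_cases heb : e ≤ b
      · rw [Multiset.filter_cons_of_pos (p := fun i => e ≤ i) _ heb, ← Multiset.singleton_add]
        exact Packs.add ⟨{c}, Multiset.sum_singleton c, Multiset.rel_cons_left.mpr
          ⟨b, 0, hcb, .zero, rfl⟩⟩ h1
      · rw [Multiset.filter_cons_of_neg (p := fun i => e ≤ i) _ heb]
        have hc : c = 0 := by
          by_contra hc
          obtain ⟨i, hi⟩ := Multiset.exists_mem_of_ne_zero hc
          have h2 := he i (Multiset.mem_add.mpr (Or.inl hi))
          have h3 := Multiset.single_le_sum (fun _ _ => Nat.zero_le _) i hi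
          omega
        rwa [hc, zero_add]

/-- Whether `ν` can be packed into `l` depends only on the large parts of `l`, and only on their values
up to a bound: there are finitely many cases as long as the number of large parts is bounded. -/
lemma packs_capped_iff {ν l : Multiset ℕ} {e M : ℕ} (he : ∀ i ∈ ν, e ≤ i) (hM : ν.sum ≤ M) :
    Packs ν (capped e M l) ↔ Packs ν l := by
  rw [capped, packs_map_min_iff hM, packs_filter_iff he]

end

section

/-! ### Configurations with a bounded number of large labels -/

/-- The partitions whose parts that are at least `e` are the elements of `η` and `s` further parts,
each at least `M`. -/
def largeLabels (e : ℕ) (η : Multiset ℕ) (s M : ℕ) : Set (Multiset ℕ) :=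
  {l | 0 ∉ l ∧ ∃ ξ : Multiset ℕ, ξ.card = s ∧ (∀ x ∈ ξ, M ≤ x) ∧
    l.filter (fun x => e ≤ x) = η + ξ}

lemma map_eq_self {l : Multiset ℕ} {f : ℕ → ℕ} (h : ∀ x ∈ l, f x = x) : l.map f = l :=
  (Multiset.map_congr rfl h).trans (Multiset.map_id l)

section Laws

variable {R : Type*} [CommRing R] {w : Multiset ℕ → R}

lemma genSeries_largeLabels_zero (w : Multiset ℕ → R) {e : ℕ} (he : 0 < e) {η : Multiset ℕ}
    (hη : ∀ i ∈ η, e ≤ i) (M : ℕ) : genSeries w (largeLabels e η 0 M) Multiset.sum =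
      PowerSeries.X ^ η.sum * smallSeries w e η := by
  rw [smallSeries, ← genSeries_shift (u := fun l => l.sum + η.sum) (v := Multiset.sum) η.sum fun _ _ => rfl]
  refine (genSeries_bijOn (fun l => l + η) ⟨?_, ?_, ?_⟩ ?_ fun _ _ => rfl).symm
  · intro l hl
    refine ⟨fun h0 => ?_, 0, rfl, by simp, ?_⟩
    · rcases Multiset.mem_add.mp h0 with h0 | h0
      · exact hl.1 h0
      · exact absurd (hη 0 h0) (by omega)
    · rw [Multiset.filter_add, Multiset.filter_eq_nil.mpr fun i hi => not_le.mpr (hl.2 i hi),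
        Multiset.filter_eq_self.mpr hη, zero_add, add_zero]
  · exact fun l _ l' _ h => add_right_cancel h
  · rintro l ⟨h0, ξ, hξ, -, hl⟩
    rw [Multiset.card_eq_zero] at hξ
    subst hξ
    refine ⟨l.filter fun x => ¬ e ≤ x, ⟨fun h => h0 (Multiset.mem_of_mem_filter h), fun i hi =>
      not_le.mp (Multiset.mem_filter.mp hi).2⟩, ?_⟩
    rw [add_zero] at hl
    change (l.filter fun x => ¬ e ≤ x) + η = l
    rw [← hl, add_comm]
    exact Multiset.filter_add_not _ _
  · exact fun l _ => Multiset.sum_add _ _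

/-- Sorting by the multiplicity of the least large label that is allowed. -/
lemma genSeries_largeLabels_eq_sum (w : Multiset ℕ → R) {e M : ℕ} (heM : e ≤ M)
    {η : Multiset ℕ} (hη : ∀ i ∈ η, i < M) (s : ℕ) :
    genSeries w (largeLabels e η s M) Multiset.sum = ∑ j ∈ Finset.range (s + 1),
      genSeries w (largeLabels e (η + Multiset.replicate j M) (s - j) (M + 1)) Multiset.sum := by
  have hηM : η.count M = 0 := Multiset.count_eq_zero.mpr fun h => lt_irrefl _ (hη M h)
  have hcount : ∀ l : Multiset ℕ, l.count M = (l.filter fun x => e ≤ x).count M := fun l =>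
    (Multiset.count_filter_of_pos heM).symm
  rw [genSeries_fiberwise w (fun l => l.count M) (Finset.range (s + 1))
    (finiteFibers_sum.mono fun _ h => h.1)]
  · refine Finset.sum_congr rfl fun j hj => ?_
    rw [Finset.mem_range] at hj
    congr 1
    ext l
    constructor
    · rintro ⟨⟨h0, ξ, hξ, hξM, hl⟩, hc⟩
      have h1 : (ξ.filter fun x => M = x) = Multiset.replicate j M := by
        rw [Multiset.filter_eq, ← hc, hcount l, hl, Multiset.count_add, hηM, zero_add]
      have h2 : ξ = Multiset.replicate j M + ξ.filter fun x => ¬ M = x := by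
        rw [← h1, Multiset.filter_add_not]
      refine ⟨h0, ξ.filter fun x => ¬ M = x, ?_, fun x hx => ?_, ?_⟩
      · have h3 := congr_arg Multiset.card h2
        rw [Multiset.card_add, Multiset.card_replicate, hξ] at h3
        omega
      · obtain ⟨hx1, hx2⟩ := Multiset.mem_filter.mp hx
        have := hξM x hx1
        omega
      · rw [hl, add_assoc, ← h2]
    · rintro ⟨h0, ξ, hξ, hξM, hl⟩
      refine ⟨⟨h0, Multiset.replicate j M + ξ, ?_, fun x hx => ?_, by rw [hl, add_assoc]⟩, ?_⟩
      · rw [Multiset.card_add, Multiset.card_replicate, hξ]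
        omega
      · rcases Multiset.mem_add.mp hx with hx | hx
        · exact (Multiset.eq_of_mem_replicate hx).ge
        · exact (Nat.le_succ M).trans (hξM x hx)
      · rw [hcount, hl, Multiset.count_add, Multiset.count_add, hηM,
          Multiset.count_replicate_self,
          Multiset.count_eq_zero.mpr fun h => absurd (hξM M h) (by omega), zero_add, add_zero]
  · rintro l ⟨h0, ξ, hξ, hξM, hl⟩
    rw [Finset.mem_range, hcount, hl, Multiset.count_add, hηM, zero_add, ← hξ]
    exact Nat.lt_succ_of_le (Multiset.count_le_card _ _)

/-- Increasing the large labels by one. -/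
lemma ConfigLaws.genSeries_largeLabels_succ (h : ConfigLaws w) {e M : ℕ} (he : 0 < e)
    (heM : e ≤ M) {η : Multiset ℕ} (hη : ∀ i ∈ η, i < M) (s : ℕ) :
    genSeries w (largeLabels e η s (M + 1)) Multiset.sum =
      PowerSeries.X ^ s * genSeries w (largeLabels e η s M) Multiset.sum := by
  rw [← genSeries_shift (u := fun l => l.sum + s) (v := Multiset.sum) s fun _ _ => rfl]
  let f : ℕ → ℕ := fun x => if M ≤ x then x + 1 else x
  let g : ℕ → ℕ := fun x => if M ≤ x then x - 1 else x
  have hf : Function.Injective f := by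
    intro x y hxy
    simp only [f] at hxy
    split_ifs at hxy <;> omega
  have hfe : ∀ x, e ≤ f x ↔ e ≤ x := by
    intro x
    simp only [f]
    split_ifs <;> omega
  have hf0 : ∀ x, f x = 0 → x = 0 := by
    intro x hx
    simp only [f] at hx
    split_ifs at hx
    exact hx
  have hmem0 : ∀ l : Multiset ℕ, 0 ∉ l → 0 ∉ l.map f := by
    intro l hl h0
    obtain ⟨x, hx, hx0⟩ := Multiset.mem_map.mp h0
    exact hl (hf0 x hx0 ▸ hx)
  have hfη : η.map f = η := map_eq_self fun i hi => if_neg (not_le.mpr (hη i hi))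
  have hfilter : ∀ l : Multiset ℕ, (l.map f).filter (fun x => e ≤ x) =
      (l.filter fun x => e ≤ x).map f := by
    intro l
    rw [Multiset.filter_map]
    simp only [Function.comp_def, hfe]
  refine (genSeries_bijOn (fun l => l.map f) ⟨?_, ?_, ?_⟩ ?_ ?_).symm
  · rintro l ⟨h0, ξ, hξ, hξM, hl⟩
    refine ⟨hmem0 l h0, ξ.map f, by rw [Multiset.card_map, hξ], fun y hy => ?_, ?_⟩
    · obtain ⟨x, hx, rfl⟩ := Multiset.mem_map.mp hy
      have := hξM x hx
      simp only [f, if_pos this]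
      omega
    · rw [hfilter, hl, Multiset.map_add, hfη]
  · exact (Multiset.map_injective hf).injOn
  · rintro l ⟨h0, ξ, hξ, hξM, hl⟩
    have hM : M ∉ l := by
      intro hM
      have h1 : M ∈ η + ξ := by
        rw [← hl, Multiset.mem_filter]
        exact ⟨hM, heM⟩
      rcases Multiset.mem_add.mp h1 with h1 | h1
      · exact lt_irrefl _ (hη M h1)
      · exact absurd (hξM M h1) (by omega)
    have hgl : (l.map g).map f = l := by
      rw [Multiset.map_map]
      refine map_eq_self fun x hx => ?_
      have : x ≠ M := fun h => hM (h ▸ hx)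
      simp only [f, g, Function.comp_apply]
      split_ifs <;> omega
    refine ⟨l.map g, ⟨fun h => ?_, ξ.map g, by rw [Multiset.card_map, hξ], fun y hy => ?_, ?_⟩, hgl⟩
    · obtain ⟨x, hx, hx0⟩ := Multiset.mem_map.mp h
      have h1 : x ≠ M := fun h => hM (h ▸ hx)
      have h2 : x ≠ 0 := fun h => h0 (h ▸ hx)
      simp only [g] at hx0
      split_ifs at hx0 <;> omega
    · obtain ⟨x, hx, rfl⟩ := Multiset.mem_map.mp hy
      have := hξM x hx
      simp only [g]
      split_ifs <;> omega
    · refine Multiset.map_injective hf ?_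
      rw [← hfilter, hgl, hl, Multiset.map_add, hfη, Multiset.map_map]
      congr 1
      refine (map_eq_self fun x hx => ?_).symm
      have := hξM x hx
      simp only [f, g, Function.comp_apply]
      split_ifs <;> omega
  · rintro l ⟨h0, ξ, hξ, hξM, hl⟩
    have h1 : (ξ.map f).sum = ξ.sum + s := by
      rw [Multiset.map_congr rfl fun x hx => if_pos (hξM x hx), Multiset.sum_map_add, ← hξ]
      simp
    have h2 : ∀ l : Multiset ℕ, l.sum = (l.filter fun x => e ≤ x).sum +
        (l.filter fun x => ¬ e ≤ x).sum := fun l => by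
      rw [← Multiset.sum_add, Multiset.filter_add_not]
    have h3 : (l.map f).filter (fun x => ¬ e ≤ x) = l.filter fun x => ¬ e ≤ x := by
      rw [Multiset.filter_map]
      simp only [Function.comp_def, hfe]
      refine map_eq_self fun x hx => if_neg ?_
      have := (Multiset.mem_filter.mp hx).2
      omega
    rw [h2 (l.map f), h2 l, h3, hfilter, hl, Multiset.map_add, hfη, Multiset.sum_add,
      Multiset.sum_add, h1]
    omega
  · intro l hl
    exact (h.rename l f hl.1 (hmem0 l hl.1) fun x _ y _ hxy => hf hxy).symm

/-- Raising the `s` unspecified labels by one multiplies the series by `t ^ s`, and the labels that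
cannot be so obtained are those with some of the `s` labels equal to `M`. Hence `1 - t ^ s` times the
series is a combination of series with fewer unspecified labels. -/
theorem ConfigLaws.ratComb_largeLabels (h : ConfigLaws w) {e : ℕ} (he : 0 < e) (s : ℕ) :
    ∀ (M : ℕ) (η : Multiset ℕ), e ≤ M → (∀ i ∈ η, e ≤ i ∧ i < M) →
    RatComb (fun ν' => smallSeries w e 0 * PowerSeries.C (w ν'))
      {ν' | 0 ∉ ν' ∧ ν'.card = η.card + s} (genSeries w (largeLabels e η s M) Multiset.sum) := by
  induction s using Nat.strong_induction_on with
  | _ s ih =>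
  intro M η heM hη
  rcases Nat.eq_zero_or_pos s with rfl | hs
  · rw [genSeries_largeLabels_zero w he (fun i hi => (hη i hi).1)]
    refine ((h.ratComb_smallSeries he η fun i hi => (hη i hi).1).mono ?_).X_pow_mul _
    exact fun ν' hν' => ⟨hν'.1, hν'.2.1⟩
  · have h1 := genSeries_largeLabels_eq_sum w heM (fun i hi => (hη i hi).2) s
    rw [Finset.sum_range_succ', Multiset.replicate_zero, add_zero, Nat.sub_zero,
      h.genSeries_largeLabels_succ he heM (fun i hi => (hη i hi).2) s] at h1
    refine RatComb.of_intPoly_mul (B := 1 - Polynomial.X ^ s) (by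
      simp [Polynomial.coeff_X_pow, hs.ne]) ?_
    have h2 : (intPoly (1 - Polynomial.X ^ s) : PowerSeries R) = 1 - PowerSeries.X ^ s := by
      simp [intPoly]
    rw [h2, sub_mul, one_mul, sub_eq_iff_eq_add.mpr h1]
    refine RatComb.sum _ fun j hj => ?_
    have hj' := Finset.mem_range.mp hj
    refine (ih (s - (j + 1)) (by omega) (M + 1) _ (by omega) fun i hi => ?_).mono ?_
    · rcases Multiset.mem_add.mp hi with hi | hi
      · have := hη i hi
        omega
      · have := Multiset.eq_of_mem_replicate hi
        omega
    · rintro ν' ⟨h3, h4⟩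
      refine ⟨h3, ?_⟩
      rw [h4, Multiset.card_add, Multiset.card_replicate]
      omega

/-- Conditions on the capped large labels define rational combinations if the number of large labels
is bounded. -/
theorem ConfigLaws.ratComb_capped (h : ConfigLaws w) {e M : ℕ} (he : 0 < e) (heM : e ≤ M) (r : ℕ)
    (p : Multiset ℕ → Prop) :
    RatComb (fun ν' => smallSeries w e 0 * PowerSeries.C (w ν')) {ν' | 0 ∉ ν' ∧ ν'.card < r}
      (genSeries w {l | 0 ∉ l ∧ (l.filter (e ≤ ·)).card < r ∧ p (capped e M l)} Multiset.sum) := by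
  classical
  rw [genSeries_fiberwise w (capped e M) (finite_multisets (Finset.range (M + 1)) r).toFinset
    (finiteFibers_sum.mono fun _ h => h.1)]
  swap
  · intro l hl
    rw [Set.Finite.mem_toFinset]
    refine ⟨fun c hc => ?_, ?_⟩
    · obtain ⟨x, _, rfl⟩ := Multiset.mem_map.mp hc
      rw [Finset.mem_range]
      exact Nat.lt_succ_of_le (min_le_left _ _)
    · rw [capped, Multiset.card_map]
      exact hl.2.1.le
  refine RatComb.sum _ fun θ _ => ?_
  rcases Set.eq_empty_or_nonempty {l : Multiset ℕ |
    l ∈ {l : Multiset ℕ | 0 ∉ l ∧ (l.filter (e ≤ ·)).card < r ∧ p (capped e M l)} ∧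
      capped e M l = θ} with hS | ⟨l₀, hl₀, rfl⟩
  · rw [hS, genSeries_empty]
    exact RatComb.zero
  -- the labels of `l₀` below `M`, and the number of the others, determine the fibre
  let η := (l₀.filter fun x => e ≤ x).filter fun x => x < M
  let s := ((l₀.filter fun x => e ≤ x).filter fun x => ¬ x < M).card
  have hcap : ∀ l : Multiset ℕ, (capped e M l).filter (fun x => x < M) =
      (l.filter fun x => e ≤ x).filter fun x => x < M := by
    intro l
    rw [capped, Multiset.filter_map]
    have h1 : ((fun x => x < M) ∘ min M) = fun x => x < M := by
      ext x
      simp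
    simp only [h1]
    exact map_eq_self fun x hx => min_eq_right (Multiset.mem_filter.mp hx).2.le
  have hmap : ∀ ξ : Multiset ℕ, (∀ x ∈ ξ, M ≤ x) →
      (η + ξ).map (min M) = η + Multiset.replicate ξ.card M := by
    intro ξ hξ
    rw [Multiset.map_add, map_eq_self fun x hx => min_eq_right (Multiset.mem_filter.mp hx).2.le,
      Multiset.map_congr rfl fun x hx => min_eq_left (hξ x hx), Multiset.map_const']
  have hl₀' : (l₀.filter fun x => e ≤ x) =
      η + (l₀.filter fun x => e ≤ x).filter fun x => ¬ x < M := (Multiset.filter_add_not _ _).symm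
  have hge : ∀ l : Multiset ℕ, ∀ x ∈ (l.filter fun x => e ≤ x).filter (fun x => ¬ x < M), M ≤ x :=
    fun l x hx => not_lt.mp (Multiset.mem_filter.mp hx).2
  have hcap₀ : capped e M l₀ = η + Multiset.replicate s M := by
    rw [← hmap _ (hge l₀), ← hl₀']
    rfl
  have hset : {l : Multiset ℕ |
      l ∈ {l : Multiset ℕ | 0 ∉ l ∧ (l.filter (e ≤ ·)).card < r ∧ p (capped e M l)} ∧
        capped e M l = capped e M l₀} = largeLabels e η s M := by
    ext l
    constructor
    · rintro ⟨⟨h0, -, -⟩, h1⟩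
      have h2 : (l.filter fun x => e ≤ x).filter (fun x => x < M) = η := by
        rw [← hcap, h1, hcap]
      have h3 : (l.filter fun x => e ≤ x) =
          η + (l.filter fun x => e ≤ x).filter fun x => ¬ x < M := by
        rw [← h2, Multiset.filter_add_not]
      refine ⟨h0, (l.filter fun x => e ≤ x).filter fun x => ¬ x < M, ?_, hge l, h3⟩
      have h4 := congr_arg Multiset.card h1
      rw [hcap₀, capped, Multiset.card_map, h3, Multiset.card_add, Multiset.card_add,
        Multiset.card_replicate] at h4
      exact add_left_cancel h4
    · rintro ⟨h0, ξ, hξ, hξM, hl⟩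
      have h1 : capped e M l = capped e M l₀ := by
        rw [hcap₀, ← hξ, ← hmap ξ hξM, ← hl]
        rfl
      refine ⟨⟨h0, ?_, by rw [h1]; exact hl₀.2.2⟩, h1⟩
      have h2 := congr_arg Multiset.card h1
      rw [capped, capped, Multiset.card_map, Multiset.card_map] at h2
      rw [h2]
      exact hl₀.2.1
  rw [hset]
  refine (h.ratComb_largeLabels he s M η heM fun i hi => ?_).mono ?_
  · obtain ⟨h1, h2⟩ := Multiset.mem_filter.mp hi
    exact ⟨(Multiset.mem_filter.mp h1).2, h2⟩
  · rintro ν' ⟨h1, h2⟩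
    refine ⟨h1, ?_⟩
    rw [h2, ← Multiset.card_add, ← hl₀']
    exact hl₀.2.1

/-- The generators of the rational combinations that express the series of the partitions into which
`ν` can be packed: the series of all partitions, and its quotients by `Z(t ^ i)`, multiplied by the
class of a configuration space. -/
def packGen (w : Multiset ℕ → R) : Option (Multiset ℕ × ℕ) → PowerSeries R
  | none => totalSeries w
  | some c => smallSeries w c.2 0 * PowerSeries.C (w c.1)

/-- The indices of the generators that occur for `ν`. -/
def packIndex (ν : Multiset ℕ) : Set (Option (Multiset ℕ × ℕ)) :=
  {i | ∀ c, i = some c → 0 ∉ c.1 ∧ c.1.card < ν.card ∧ c.2 ∈ ν}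

/-- Induction on `ν.card`. If `e` is the smallest part of `e ::ₘ ν'`, then packing `e ::ₘ ν'` is the same
as packing `ν'` as soon as more than `ν'.card` labels are at least `e`; the configurations with fewer
such labels contribute rational combinations of the series `smallSeries w e 0 * w`. -/
theorem ConfigLaws.ratComb_packs (h : ConfigLaws w) (ν : Multiset ℕ) (hν : 0 ∉ ν) :
    RatComb (packGen w) (packIndex ν) (genSeries w {l | 0 ∉ l ∧ Packs ν l} Multiset.sum) := by
  classical
  induction hn : ν.card generalizing ν with
  | zero =>
    rw [Multiset.card_eq_zero] at hn
    subst hn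
    have h1 : {l : Multiset ℕ | 0 ∉ l ∧ Packs 0 l} = {l | 0 ∉ l} :=
      Set.ext fun l => and_iff_left (packs_zero l)
    rw [h1]
    exact RatComb.base (u := packGen w) (i := none) fun c hc => by simp at hc
  | succ n ih =>
    have hne : ν.toFinset.Nonempty := by
      rw [Multiset.toFinset_nonempty, ← Multiset.card_pos, hn]
      exact Nat.succ_pos n
    obtain ⟨e, heν, hmin⟩ := Finset.exists_min_image ν.toFinset id hne
    rw [Multiset.mem_toFinset] at heν
    have hmin' : ∀ i ∈ ν, e ≤ i := fun i hi => hmin i (Multiset.mem_toFinset.mpr hi)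
    obtain ⟨ν', rfl⟩ := Multiset.exists_cons_of_mem heν
    have he : 0 < e := Nat.pos_of_ne_zero fun h0 => hν (h0 ▸ heν)
    rw [Multiset.card_cons, Nat.add_right_cancel_iff] at hn
    have hM : (e ::ₘ ν').sum ≤ (e ::ₘ ν').sum := le_rfl
    have hM' : ν'.sum ≤ (e ::ₘ ν').sum := by
      rw [Multiset.sum_cons]
      omega
    have heM : e ≤ (e ::ₘ ν').sum := by
      rw [Multiset.sum_cons]
      omega
    -- the partitions with few large labels contribute a rational combination
    have hsmall : ∀ μ : Multiset ℕ, (∀ i ∈ μ, e ≤ i) → μ.sum ≤ (e ::ₘ ν').sum →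
        RatComb (packGen w) (packIndex (e ::ₘ ν')) (genSeries w {l : Multiset ℕ |
          l ∈ {l | 0 ∉ l ∧ Packs μ l} ∧ ¬ ν'.card < (l.filter (e ≤ ·)).card} Multiset.sum) := by
      intro μ hμ hμM
      have h1 := h.ratComb_capped he heM (n + 1) (Packs μ)
      have h2 : {l : Multiset ℕ | l ∈ {l | 0 ∉ l ∧ Packs μ l} ∧
          ¬ ν'.card < (l.filter (e ≤ ·)).card} = {l : Multiset ℕ | 0 ∉ l ∧
            (l.filter (e ≤ ·)).card < n + 1 ∧ Packs μ (capped e (e ::ₘ ν').sum l)} := by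
        ext l
        simp only [Set.mem_ofPred_eq, packs_capped_iff hμ hμM, hn, not_lt, Nat.lt_succ_iff]
        tauto
      rw [h2]
      have h3 := RatComb.mul_left (v := packGen w) (Q := packIndex (e ::ₘ ν')) 1
        (fun ν' => some (ν', e)) (fun ν'' hν'' => ⟨(one_mul _).symm, ?_⟩) h1
      · rwa [one_mul] at h3
      · rintro _ ⟨⟩
        exact ⟨hν''.1, by rw [Multiset.card_cons, hn]; exact hν''.2, heν⟩
    have hfib : ∀ μ, FiniteFibers {l : Multiset ℕ | 0 ∉ l ∧ Packs μ l} Multiset.sum := fun μ =>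
      finiteFibers_sum.mono fun _ h => h.1
    have h1 := genSeries_split w (fun l => ν'.card < (l.filter (e ≤ ·)).card) (hfib (e ::ₘ ν'))
    have h2 := genSeries_split w (fun l => ν'.card < (l.filter (e ≤ ·)).card) (hfib ν')
    have h3 : {l : Multiset ℕ | l ∈ {l | 0 ∉ l ∧ Packs (e ::ₘ ν') l} ∧
        ν'.card < (l.filter (e ≤ ·)).card} = {l : Multiset ℕ | l ∈ {l | 0 ∉ l ∧ Packs ν' l} ∧
          ν'.card < (l.filter (e ≤ ·)).card} := by
      ext l
      refine and_congr_left fun hl => and_congr_right fun _ => packs_cons_iff hl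
    rw [h3, ← sub_eq_iff_eq_add.mpr h2] at h1
    rw [h1]
    refine ((ih ν' (fun h0 => hν (Multiset.mem_cons_of_mem h0)) hn).mono fun i hi c hc => ?_).sub
      (hsmall ν' (fun i hi => hmin' i (Multiset.mem_cons_of_mem hi)) hM') |>.add
      (hsmall (e ::ₘ ν') hmin' hM)
    obtain ⟨h4, h5, h6⟩ := hi c hc
    exact ⟨h4, h5.trans (by simp), Multiset.mem_cons_of_mem h6⟩

end Laws

end

section

/-! ### Specialization of the universal formulas -/

section Specialize

variable {R S : Type*} [CommRing R] [CommRing S]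

lemma map_genSeries {α : Type*} (φ : R →+* S) (f : α → R) {T : Set α} {wt : α → ℕ}
    (hT : FiniteFibers T wt) :
    PowerSeries.map φ (genSeries f T wt) = genSeries (fun x => φ (f x)) T wt := by
  ext n
  simp only [genSeries, PowerSeries.coeff_map, PowerSeries.coeff_mk]
  exact φ.toAddMonoidHom.map_finsum_mem f (hT n)

lemma map_intPoly (φ : R →+* S) (p : Polynomial ℤ) :
    PowerSeries.map φ (intPoly p) = intPoly p := by
  rw [intPoly, intPoly, Polynomial.aeval_def, Polynomial.aeval_def, Polynomial.hom_eval₂,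
    PowerSeries.map_X]
  congr 1
  exact RingHom.ext_int _ _

lemma constantCoeff_intPoly (p : Polynomial ℤ) :
    PowerSeries.constantCoeff (intPoly p : PowerSeries R) = p.coeff 0 := by
  rw [intPoly, Polynomial.aeval_def, Polynomial.hom_eval₂, PowerSeries.constantCoeff_X,
    Polynomial.eval₂_at_zero]
  simp

lemma mul_inv1 {f : PowerSeries R} (hf : PowerSeries.constantCoeff f = 1) : f * inv1 f = 1 :=
  PowerSeries.mul_invOfUnit f 1 hf

lemma eq_mul_inv1 {f g r : PowerSeries R} (hf : PowerSeries.constantCoeff f = 1)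
    (h : f * g = r) : g = r * inv1 f := by
  rw [← h, mul_right_comm, mul_inv1 hf, one_mul]

lemma coeff_genSeries_partition (f : Multiset ℕ → R) (p : Multiset ℕ → Prop) (n : ℕ)
    [∀ q : Nat.Partition n, Decidable (p q.parts)] :
    PowerSeries.coeff n (genSeries f {l | 0 ∉ l ∧ p l} Multiset.sum) =
      ∑ q : Nat.Partition n, if p q.parts then f q.parts else 0 := by
  rw [← Finset.sum_filter, ← finsum_mem_coe_finset, genSeries, PowerSeries.coeff_mk]
  refine (finsum_mem_eq_of_bijOn Nat.Partition.parts ⟨?_, ?_, ?_⟩ fun _ _ => rfl).symm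
  · intro q hq
    exact ⟨⟨fun h0 => (q.parts_pos h0).ne rfl, (Finset.mem_filter.mp hq).2⟩, q.parts_sum⟩
  · exact fun q _ q' _ h => Nat.Partition.ext h
  · rintro l ⟨⟨h0, hp⟩, hn⟩
    exact ⟨⟨l, fun {i} hi => Nat.pos_of_ne_zero fun h => h0 (h ▸ hi), hn⟩,
      Finset.mem_filter.mpr ⟨Finset.mem_univ _, hp⟩, rfl⟩

/-- The laws hold in a product of rings if they hold in each factor. -/
lemma ConfigLaws.pi {D : Type*} {A : D → Type*} [∀ d, CommRing (A d)]
    {w : ∀ d, Multiset ℕ → A d} (h : ∀ d, ConfigLaws (w d)) :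
    ConfigLaws fun l d => w d l where
  zero := funext fun d => (h d).zero
  rename l e hl hle he := funext fun d => (h d).rename l e hl hle he
  mul l m hl hm S hS := funext fun d => by
    rw [Finset.sum_apply]
    exact (h d).mul l m hl hm S hS

lemma coeff_totalSeries (w : Multiset ℕ → R) (n : ℕ) :
    PowerSeries.coeff n (totalSeries w) = ∑ q : Nat.Partition n, w q.parts := by
  have h := coeff_genSeries_partition w (fun _ => True) n
  simp only [and_true, if_true] at h
  exact h

end Specialize

section Scheme

variable {k : Type u} [Field k] (X : FTScheme k)

lemma K_eq (a : ℕ) (ν : Multiset ℕ) : K X.obj a ν = smallSeries (w X.obj) a ν := by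
  classical
  ext n
  have h := coeff_genSeries_partition (fun l => w X.obj (l + ν)) (fun l => ∀ i ∈ l, i < a) n
  rw [K, PowerSeries.coeff_mk, wLT]
  refine Eq.trans ?_ h.symm
  exact Finset.sum_congr rfl fun _ _ => if_congr Iff.rfl rfl rfl

lemma wbar_eq (l : Multiset ℕ) : wbar X.obj l =
    ∑ᶠ m ∈ {m | (0 ∉ m ∧ RefineLE l m) ∧ m.sum = l.sum}, w X.obj m := by
  classical
  have h := coeff_genSeries_partition (w X.obj) (RefineLE l) l.sum
  rw [genSeries, PowerSeries.coeff_mk] at h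
  refine Eq.trans ?_ h.symm
  exact Finset.sum_congr rfl fun _ _ => if_congr Iff.rfl rfl rfl

/-- Shifted by `t ^ ν.sum`, the series of the closed configuration classes runs over all partitions
into which `ν` can be packed. -/
lemma X_pow_mul_Kbar (ν : Multiset ℕ) : PowerSeries.X ^ ν.sum * Kbar X.obj ν =
    genSeries (w X.obj) {l | 0 ∉ l ∧ Packs ν l} Multiset.sum := by
  ext n
  rw [PowerSeries.coeff_X_pow_mul', genSeries, PowerSeries.coeff_mk]
  split_ifs with hn
  · rw [Kbar, PowerSeries.coeff_mk, wbar_eq]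
    have hsum : (Multiset.replicate (n - ν.sum) 1 + ν).sum = n := by
      rw [Multiset.sum_add, Multiset.sum_replicate, smul_eq_mul, mul_one, Nat.sub_add_cancel hn]
    rw [hsum]
    refine finsum_mem_congr (Set.ext fun l => and_congr_left fun hl => and_congr_right fun h0 =>
      refineLE_replicate_one_add_iff h0 ?_) fun _ _ => rfl
    rw [hl, Nat.sub_add_cancel hn]
  · refine (finsum_mem_eq_zero_of_forall_eq_zero fun l hl => ?_).symm
    exfalso
    obtain ⟨⟨-, Cs, rfl, h⟩, rfl⟩ := hl
    apply hn
    clear hn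
    induction h with
    | zero => simp
    | cons hcb _ ih =>
      rw [Multiset.sum_cons, Multiset.sum_add, Multiset.sum_cons]
      exact add_le_add hcb ih

variable [IsSeparated X.obj.hom]

lemma zeta_eq : zeta X.obj = totalSeries (w X.obj) := by
  ext n
  rw [zeta, PowerSeries.coeff_mk, symClass_eq, coeff_totalSeries]

lemma zetaPow_eq {a : ℕ} (ha : 0 < a) :
    zetaPow X.obj a = genSeries (w X.obj) {l | 0 ∉ l} fun l => a * l.sum := by
  ext n
  rw [zetaPow, PowerSeries.coeff_mk, genSeries, PowerSeries.coeff_mk]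
  split_ifs with h
  · obtain ⟨m, rfl⟩ := h
    rw [Nat.mul_div_cancel_left _ ha, symClass_eq, ← coeff_totalSeries, totalSeries, genSeries,
      PowerSeries.coeff_mk]
    refine finsum_mem_congr (Set.ext fun l => and_congr_right fun _ => ?_) fun _ _ => rfl
    exact (Nat.mul_right_inj ha.ne').symm
  · refine (finsum_mem_eq_zero_of_forall_eq_zero fun l hl => ?_).symm
    exact absurd ⟨l.sum, hl.2.symm⟩ h

lemma constantCoeff_zetaPow (a : ℕ) : PowerSeries.constantCoeff (zetaPow X.obj a) = 1 := by
  have h1 : (default : Nat.Partition 0).parts = 0 := rfl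
  rw [← PowerSeries.coeff_zero_eq_constantCoeff_apply, zetaPow, PowerSeries.coeff_mk,
    if_pos (dvd_zero a), Nat.zero_div, symClass_eq, Fintype.sum_unique, h1,
    configLaws_w.zero]

/-- The series of configurations with small labels is a quotient of zeta functions. -/
lemma smallSeries_zero_eq {a : ℕ} (ha : 0 < a) :
    smallSeries (w X.obj) a 0 = zeta X.obj * inv1 (zetaPow X.obj a) := by
  refine eq_mul_inv1 (constantCoeff_zetaPow X a) ?_
  rw [zetaPow_eq X ha, zeta_eq]
  exact (configLaws_w.totalSeries_eq ha).symm

end Scheme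

/-- The data to which the universal formulas apply: a field and a separated scheme of finite
type. -/
structure SchemeDatum where
  /-- the base field -/
  k : Type u
  [field : Field k]
  /-- the scheme -/
  X : FTScheme k
  separated : IsSeparated X.obj.hom

attribute [instance] SchemeDatum.field

/-- The classes `w_l` of all schemes over all fields at once. Formulas in the product of the
Grothendieck rings are universal formulas. -/
def universalW (l : Multiset ℕ) : ∀ d : SchemeDatum.{u}, K0 d.k := fun d => w d.X.obj l

lemma configLaws_universalW : ConfigLaws universalW.{u} :=
  ConfigLaws.pi fun d => haveI := d.separated; configLaws_w (X := d.X)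

/-- The projection from the product of the Grothendieck rings. -/
def specialize {k : Type u} [Field k] (X : FTScheme k) (hX : IsSeparated X.obj.hom) :
    (∀ d : SchemeDatum.{u}, K0 d.k) →+* K0 k :=
  Pi.evalRingHom (fun d : SchemeDatum.{u} => K0 d.k) ⟨k, X, hX⟩

lemma specialize_universalW {k : Type u} [Field k] (X : FTScheme k) (hX : IsSeparated X.obj.hom)
    (l : Multiset ℕ) : specialize X hX (universalW l) = w X.obj l := rfl

lemma map_smallSeries {k : Type u} [Field k] (X : FTScheme k) (hX : IsSeparated X.obj.hom)
    (a : ℕ) (ν : Multiset ℕ) : PowerSeries.map (specialize X hX) (smallSeries universalW a ν) =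
      smallSeries (w X.obj) a ν :=
  map_genSeries _ _ (finiteFibers_smallLabels a)

/-- The universal form of the series of configurations with bounded labels. -/
theorem exists_formula_K (ν : Multiset ℕ) {a : ℕ} (ha : 0 < a) (hν : ∀ i ∈ ν, a ≤ i) :
    ∃ (A : Multiset ℕ →₀ Polynomial ℤ) (B : Polynomial ℤ),
      (∀ ν' ∈ A.support, ν' ∈ sameShape ν) ∧ B.coeff 0 = 1 ∧
      ∀ (k : Type u) [Field k] (X : FTScheme k), IsSeparated X.obj.hom →
        K X.obj a ν = zeta X.obj * inv1 (zetaPow X.obj a) * (evalA A X.obj * inv1 (intPoly B)) := by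
  obtain ⟨A, B, hA, hB, h⟩ := configLaws_universalW.{u}.ratComb_smallSeries ha ν hν
  refine ⟨A, B, hA, hB, fun k _ X hX => ?_⟩
  have h1 := congr_arg (PowerSeries.map (specialize X hX)) h
  rw [map_mul, map_intPoly, map_smallSeries, Finsupp.sum, map_sum] at h1
  simp only [map_mul, map_intPoly, map_smallSeries, PowerSeries.map_C,
    specialize_universalW] at h1
  rw [K_eq, eq_mul_inv1 (by rw [constantCoeff_intPoly, hB, Int.cast_one]) h1,
    ← smallSeries_zero_eq X ha, ← mul_assoc, evalA, Finsupp.sum, Finset.mul_sum]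
  congr 1
  exact Finset.sum_congr rfl fun _ _ => mul_left_comm _ _ _

/-- The universal form of the series of coarsenings. -/
theorem exists_formula_Kbar (ν : Multiset ℕ) (hν : 0 ∉ ν) :
    ∃ (C₀ : Polynomial ℤ) (C : Multiset ℕ × ℕ →₀ Polynomial ℤ) (D : Polynomial ℤ),
      (∀ c ∈ C.support, 0 ∉ c.1 ∧ c.1.card < ν.card ∧ c.2 ∈ ν) ∧ D.coeff 0 = 1 ∧
      ∀ (k : Type u) [Field k] (X : FTScheme k), IsSeparated X.obj.hom →
        PowerSeries.X ^ ν.sum * Kbar X.obj ν =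
          zeta X.obj * (evalC C₀ C X.obj * inv1 (intPoly D)) := by
  obtain ⟨A, D, hA, hD, h⟩ := configLaws_universalW.{u}.ratComb_packs ν hν
  have hC : ∀ c ∈ A.some.support, 0 ∉ c.1 ∧ c.1.card < ν.card ∧ c.2 ∈ ν := fun c hc =>
    hA (some c) (by simpa using hc) c rfl
  refine ⟨A none, A.some, D, hC, hD, fun k _ X hX => ?_⟩
  rw [Finsupp.sum_option_index _ _ (by simp [intPoly]) (by simp [intPoly, add_mul])] at h
  have h1 := congr_arg (PowerSeries.map (specialize X hX)) h
  rw [map_mul, map_add, map_intPoly, map_genSeries _ _ (finiteFibers_sum.mono fun _ h => h.1),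
    Finsupp.sum, map_sum] at h1
  simp only [packGen, map_mul, map_intPoly, map_smallSeries, PowerSeries.map_C,
    specialize_universalW, totalSeries] at h1
  rw [map_genSeries _ _ finiteFibers_sum] at h1
  simp only [specialize_universalW] at h1
  rw [X_pow_mul_Kbar, eq_mul_inv1 (by rw [constantCoeff_intPoly, hD, Int.cast_one]) h1,
    ← totalSeries, ← zeta_eq, ← mul_assoc, evalC, mul_add, mul_comm (intPoly _), Finsupp.sum,
    Finset.mul_sum]
  congr 2
  refine Finset.sum_congr rfl fun c hc => ?_
  have hc2 : 0 < c.2 := Nat.pos_of_ne_zero fun h0 => hν (h0 ▸ (hC c hc).2.2)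
  rw [smallSeries_zero_eq X hc2]
  ring

end

end MotivicConf

end

theorem theorem5p1 (ν : Multiset ℕ) (hν : ∀ i ∈ ν, 0 < i) :
    (∀ a : ℕ, 2 ≤ a →
      ∃ (A : Multiset ℕ →₀ Polynomial ℤ) (B : Polynomial ℤ),
        (∀ ν' ∈ A.support, (∀ i ∈ ν', 0 < i) ∧ ν'.card = ν.card ∧
          MotivicConf.RefineLE (MotivicConf.multPartition ν') (MotivicConf.multPartition ν)) ∧
        B.coeff 0 = 1 ∧
        ((∀ i ∈ ν, a ≤ i) →
          ∀ (k : Type u) [Field k] (X : Over (Spec (CommRingCat.of k)))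
            [IsSeparated X.hom] [LocallyOfFiniteType X.hom] [QuasiCompact X.hom],
            MotivicConf.K X a ν =
              MotivicConf.zeta X * MotivicConf.inv1 (MotivicConf.zetaPow X a) *
                (MotivicConf.evalA A X * MotivicConf.inv1 (MotivicConf.intPoly B)))) ∧
    (∃ (C₀ : Polynomial ℤ) (C : Multiset ℕ × ℕ →₀ Polynomial ℤ) (D : Polynomial ℤ),
        (∀ c ∈ C.support, (∀ i ∈ c.1, 0 < i) ∧ c.1.card < ν.card ∧ c.2 ∈ ν) ∧
        D.coeff 0 = 1 ∧
        ∀ (k : Type u) [Field k] (X : Over (Spec (CommRingCat.of k)))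
          [IsSeparated X.hom] [LocallyOfFiniteType X.hom] [QuasiCompact X.hom],
          PowerSeries.X ^ ν.sum * MotivicConf.Kbar X ν =
            MotivicConf.zeta X *
              (MotivicConf.evalC C₀ C X * MotivicConf.inv1 (MotivicConf.intPoly D))) := by
  constructor
  · intro a ha
    by_cases h : ∀ i ∈ ν, a ≤ i
    · obtain ⟨A, B, hA, hB, hAB⟩ := MotivicConf.exists_formula_K.{u} ν (by omega) h
      refine ⟨A, B, fun ν' hν' => ⟨fun i hi => ?_, (hA ν' hν').2⟩, hB, ?_⟩
      · exact Nat.pos_of_ne_zero fun h0 => (hA ν' hν').1 (h0 ▸ hi)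
      · intro _ k _ X hX hX' hX''
        exact hAB k ⟨X, hX', hX''⟩ hX
    · exact ⟨0, 1, by simp, by simp, fun h' => absurd h' h⟩
  · obtain ⟨C₀, C, D, hC, hD, hCD⟩ :=
      MotivicConf.exists_formula_Kbar.{u} ν fun h0 => lt_irrefl _ (hν 0 h0)
    refine ⟨C₀, C, D, fun c hc => ⟨fun i hi => ?_, (hC c hc).2⟩, hD, ?_⟩
    · exact Nat.pos_of_ne_zero fun h0 => (hC c hc).1 (h0 ▸ hi)
    · intro k _ X hX hX' hX''
      exact hCD k ⟨X, hX', hX''⟩ hX
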